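/- Let $\mathcal P$ be a Picard groupoid, i.e. a symmetric monoidal groupoid, with unit object $e$, in which $y\mapsto x+y$ is an equivalence for every object $x$ (the commutativity constraint is not assumed to be strict), and let $\pi_1(\mathcal P)=\mathrm{End}_{\mathcal P}(e)$. A *$\mathcal P$-torsor* is a nonempty category $\mathcal L$ with an action $+:\mathcal P\times\mathcal L\to\mathcal L$ (a module category structure) such that $v\mapsto x+v$ and $x\mapsto x+v$ are equivalences for all $x\in\mathcal P$, $v\in\mathcal L$. A $1$-morphism of torsors is a functor $F$ with coherent natural isomorphisms $F(x+v)\simeq x+F(v)$, and a $2$-morphism is a natural transformation compatible with these; all $1$-morphisms are equivalences and all $2$-morphisms are invertible. The sum $\mathcal L+\mathcal M$ of two torsors has the pairs $(v,w)$ as objects, and its morphisms $(v,w)\to(v',w')$ are the classes of triples $(x,\ v\to x+v',\ x+w\to w')$ with $x\in\mathcal P$. It is again a torsor, with associativity constraints $((v_1,v_2),v_3)\mapsto(v_1,(v_2,v_3))$ and commutativity constraints $C:(v,w)\mapsto(w,v)$, where $C$ sends the canonical isomorphism $(x+v,w)\simeq(v,x+w)$ to the inverse of $(x+w,v)\simeq(w,x+v)$.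 Let $G$ be a group. A *central extension* $\mathcal L$ of $G$ by $\mathcal P$ assigns to each $g\in G$ a torsor $\mathcal L_g$, to each $g,g'$ a $1$-isomorphism $\mathcal L_{gg'}\simeq\mathcal L_g+\mathcal L_{g'}$, and to each $g,g',g''$ a $2$-isomorphism between the two composites $\mathcal L_{gg'g''}\to\mathcal L_g+(\mathcal L_{g'}+\mathcal L_{g''})$, subject to the cocycle (cube) condition for four elements. An *isomorphism* $\mathcal L\to\mathcal L'$ assigns to each $g$ a $1$-isomorphism $\mathcal L_g\simeq\mathcal L'_g$ and to each $g,g'$ a $2$-isomorphism between the two composites $\mathcal L_{gg'}\to\mathcal L'_g+\mathcal L'_{g'}$, compatible with the $2$-isomorphisms of $\mathcal L$ and $\mathcal L'$. In the *trivial* central extension every $\mathcal L_g$ is $\mathcal P$, every $1$-isomorphism $\mathcal P\to\mathcal P+\mathcal P$ is the quasi-inverse $x\mapsto(x,e)$ of $(x,y)\mapsto x+y$, and every $2$-isomorphism is the natural one. For commuting $g,g'$ let $C_2^{\mathcal L}(g,g')\in\mathcal P$ be the object that corresponds to the composite $$\mathcal L_{gg'}\simeq\mathcal L_g+\mathcal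 L_{g'}\xrightarrow{\,C\,}\mathcal L_{g'}+\mathcal L_g\simeq\mathcal L_{g'g}=\mathcal L_{gg'}$$ under the equivalence $\mathcal P\to\mathrm{Hom}_{\mathcal P}(\mathcal L_{gg'},\mathcal L_{gg'})$, $z\mapsto z+\mathrm{id}$. If $b,c$ commute with $g$, there are canonical isomorphisms $C_2^{\mathcal L}(g,bc)\simeq C_2^{\mathcal L}(g,b)+C_2^{\mathcal L}(g,c)$: one compares the composite that defines $C_2^{\mathcal L}(g,bc)$ with the exchange of $\mathcal L_g$ first with $\mathcal L_b$ and then with $\mathcal L_c$ in $\mathcal L_{gbc}\simeq\mathcal L_g+\mathcal L_b+\mathcal L_c$, by means of the naturality of $C$, the hexagon for $C$, and the structure $2$-isomorphisms of $\mathcal L$ for $(g,b,c)$, $(b,g,c)$ and $(b,c,g)$. With these isomorphisms $C_g^{\mathcal L}=C_2^{\mathcal L}(g,\cdot)$ is a homomorphism from the centralizer $Z_G(g)$ to $\mathcal P$. For a homomorphism $f$ from a group to $\mathcal P$ and commuting elements $a,b$, let $\mathrm{Comm}(f)(a,b)\in\pi_1(\mathcal P)$ be the element corresponding to the automorphism $$f(ab)\simeq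 f(a)+f(b)\simeq f(b)+f(a)\simeq f(ba)=f(ab)$$ of $f(ab)$. For pairwise commuting $g,g',g''\in G$ put $$C_3^{\mathcal L}(g,g',g'')=\mathrm{Comm}(C_g^{\mathcal L})(g',g'')\in\pi_1(\mathcal P).$$ Then: (i) if two central extensions $\mathcal L$ and $\mathcal L'$ of $G$ by $\mathcal P$ are isomorphic, then $C_3^{\mathcal L}=C_3^{\mathcal L'}$; (ii) if $\mathcal L$ is the trivial central extension of $G$ by $\mathcal P$, then $C_3^{\mathcal L}(g,g',g'')$ is the identity of $e$ for all pairwise commuting $g,g',g''$. -/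

import Mathlib

open CategoryTheory MonoidalCategory

set_option linter.unusedSectionVars false


universe w v u

namespace PicExt

open scoped MonoidalLeftAction

/-- A Picard groupoid is a symmetric monoidal groupoid in which `y ↦ x ⊗ y` is an equivalence for
every object `x`. The symmetry is carried by a separate `SymmetricCategory` instance. -/
class IsPicardGroupoid (P : Type u) [Category.{v} P] [MonoidalCategory P] : Prop where
  isGroupoid : IsGroupoid P
  tensorLeft_isEquivalence : ∀ x : P, (tensorLeft x).IsEquivalence

attribute [instance] IsPicardGroupoid.isGroupoid IsPicardGroupoid.tensorLeft_isEquivalence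

/-- A module category `L` over `P` is a `P`-torsor if it is nonempty and `v ↦ x + v` and
`x ↦ x + v` are equivalences, for every object `x` of `P` and every object `v` of `L`. -/
class IsTorsor (P : Type u) [Category.{v} P] [MonoidalCategory P]
    (L : Type u) [Category.{max u v} L] [MonoidalLeftAction P L] : Prop where
  nonempty : Nonempty L
  actionLeft_isEquivalence : ∀ x : P,
    (MonoidalLeftAction.actionLeft L x).IsEquivalence
  actionRight_isEquivalence : ∀ v : L,
    (MonoidalLeftAction.actionRight (C := P) v).IsEquivalence

attribute [instance] IsTorsor.actionLeft_isEquivalence IsTorsor.actionRight_isEquivalence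

section Basic

variable {P : Type u} [Category.{v} P] [MonoidalCategory P] [IsPicardGroupoid P]

theorem exists_inverse (x : P) : ∃ y : P, Nonempty (x ⊗ y ≅ 𝟙_ P) :=
  ⟨(tensorLeft x).objPreimage (𝟙_ P), ⟨(tensorLeft x).objObjPreimageIso (𝟙_ P)⟩⟩

theorem isGroupoid_of_isTorsor (P : Type u) [Category.{v} P] [MonoidalCategory P]
    [IsPicardGroupoid P] (L : Type u) [Category.{max u v} L] [MonoidalLeftAction P L]
    [h : IsTorsor P L] : IsGroupoid L := by
  obtain ⟨v⟩ := h.nonempty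
  exact isGroupoid_of_reflects_iso (MonoidalLeftAction.actionRight (C := P) v).inv

/-- Acting by an object is always an equivalence, by the unit constraint of the action. -/
theorem actionLeft_isEquivalence_of_picard [SymmetricCategory P]
    (L : Type u) [Category.{max u v} L] [MonoidalLeftAction P L] (x : P) :
    (MonoidalLeftAction.actionLeft L x).IsEquivalence := by
  obtain ⟨y, ⟨e⟩⟩ := exists_inverse x
  let F (z : P) : L ⥤ L := MonoidalLeftAction.actionLeft L z
  let i (a b : P) (e : a ⊗ b ≅ 𝟙_ P) : F b ⋙ F a ≅ 𝟭 L :=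
    NatIso.ofComponents (fun d => (αₗ a b d).symm ≪≫
      ((MonoidalLeftAction.curriedAction P L).mapIso e).app d ≪≫
      λₗ d) (by
        intro d d' f
        have h := MonoidalLeftAction.actionAssocIso_inv_naturality (𝟙 a) (𝟙 b) f
        have h2 := MonoidalLeftAction.action_exchange e.hom f
        simp only [MonoidalLeftAction.id_actionHom, id_tensorHom_id] at h
        change a ⊴ₗ b ⊴ₗ f ≫ (αₗ a b d').inv ≫ e.hom ⊵ₗ d' ≫ (λₗ d').hom =
          ((αₗ a b d).inv ≫ e.hom ⊵ₗ d ≫ (λₗ d).hom) ≫ f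
        rw [reassoc_of% h, reassoc_of% h2, ← MonoidalLeftAction.actionUnitIso_hom_naturality]
        simp only [Category.assoc, MonoidalLeftAction.actionUnitIso_hom_naturality])
  exact (CategoryTheory.Equivalence.mk (F x) (F y) (i y x ((β_ y x) ≪≫ e)).symm
    (i x y e)).isEquivalence_functor

end Basic

section ActAssoc

variable {P : Type u} [Category.{v} P] [MonoidalCategory P]
variable {L : Type u} [Category.{max u v} L] [MonoidalLeftAction P L]

theorem act_assoc₁ (x y z : P) (v : L) :
    (αₗ (x ⊗ y) z v).inv ≫ (α_ x y z).hom ⊵ₗ v ≫ (αₗ x (y ⊗ z) v).hom =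
      (αₗ x y (z ⊙ₗ v)).hom ≫ x ⊴ₗ (αₗ y z v).inv := by
  rw [Iso.inv_comp_eq, ← cancel_mono (x ⊴ₗ (αₗ y z v).hom)]
  simp

theorem act_assoc₂ (x y z : P) (v : L) :
    x ⊴ₗ (αₗ y z v).hom ≫ (αₗ x y (z ⊙ₗ v)).inv =
      (αₗ x (y ⊗ z) v).inv ≫ (α_ x y z).inv ⊵ₗ v ≫ (αₗ (x ⊗ y) z v).hom := by
  rw [Iso.comp_inv_eq, Category.assoc, Category.assoc,
    ← MonoidalLeftAction.associator_actionHom, MonoidalLeftAction.inv_hom_actionHomLeft_assoc,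
    Iso.inv_hom_id_assoc]

end ActAssoc

section Swap

variable {P : Type u} [Category.{v} P] [MonoidalCategory P] [SymmetricCategory P]
variable {L : Type u} [Category.{max u v} L] [MonoidalLeftAction P L]

/-- The isomorphism `z + (x + v) ≅ x + (z + v)` given by the commutativity constraint of `P`. -/
def actSwap (z x : P) (v : L) : z ⊙ₗ x ⊙ₗ v ≅ x ⊙ₗ z ⊙ₗ v :=
  (αₗ z x v).symm ≪≫ ((MonoidalLeftAction.curriedAction P L).mapIso (β_ z x)).app v ≪≫ αₗ x z v

theorem actSwap_hom (z x : P) (v : L) :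
    (actSwap z x v).hom = (αₗ z x v).inv ≫ (β_ z x).hom ⊵ₗ v ≫ (αₗ x z v).hom := rfl

theorem actSwap_inv (z x : P) (v : L) : (actSwap z x v).inv = (actSwap x z v).hom := by
  have h : (β_ x z).hom = (β_ z x).inv := by
    rw [← cancel_epi (β_ z x).hom, SymmetricCategory.symmetry, Iso.hom_inv_id]
  rw [actSwap_hom, h]
  change (_ ≫ (β_ z x).inv ⊵ₗ v) ≫ _ = _
  exact Category.assoc _ _ _

theorem actSwap_natural (z x : P) {v v' : L} (f : v ⟶ v') :
    z ⊴ₗ x ⊴ₗ f ≫ (actSwap z x v').hom = (actSwap z x v).hom ≫ x ⊴ₗ z ⊴ₗ f := by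
  have h := MonoidalLeftAction.action_exchange (β_ z x).hom f
  simp only [MonoidalLeftAction.tensor_actionHomRight] at h
  rw [← cancel_epi (αₗ z x v).hom, ← cancel_mono (αₗ x z v').inv]
  simpa [actSwap_hom] using h

theorem actSwap_natural_left {z z' : P} (h : z ⟶ z') (x : P) (v : L) :
    h ⊵ₗ (x ⊙ₗ v) ≫ (actSwap z' x v).hom = (actSwap z x v).hom ≫ x ⊴ₗ h ⊵ₗ v := by
  have h1 := congrArg (fun k => k ⊵ₗ v) (BraidedCategory.braiding_naturality_left h x)
  simp only [MonoidalLeftAction.comp_actionHomLeft] at h1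
  simp only [MonoidalLeftAction.actionHomLeft_action, actSwap_hom, Category.assoc,
    Iso.hom_inv_id_assoc, reassoc_of% h1]
  simp

theorem actSwap_natural_right (z : P) {x x' : P} (h : x ⟶ x') (v : L) :
    z ⊴ₗ h ⊵ₗ v ≫ (actSwap z x' v).hom = (actSwap z x v).hom ≫ h ⊵ₗ (z ⊙ₗ v) := by
  rw [← actSwap_inv, ← actSwap_inv, Iso.comp_inv_eq, Category.assoc, actSwap_natural_left,
    Iso.inv_hom_id_assoc]

theorem actSwap_tensor_left (z z' x : P) (v : L) :
    (actSwap (z ⊗ z') x v).hom ≫ x ⊴ₗ (αₗ z z' v).hom =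
      (αₗ z z' (x ⊙ₗ v)).hom ≫ z ⊴ₗ (actSwap z' x v).hom ≫ (actSwap z x (z' ⊙ₗ v)).hom := by
  have h1 := act_assoc₁ z z' x v
  have h2 := act_assoc₂ z x z' v
  simp only [actSwap_hom, BraidedCategory.braiding_tensor_left_hom, Category.assoc,
    MonoidalLeftAction.comp_actionHomLeft, MonoidalLeftAction.whiskerLeft_actionHomLeft,
    MonoidalLeftAction.actionHomRight_comp, reassoc_of% h1, reassoc_of% h2,
    MonoidalLeftAction.whiskerRight_actionHomLeft, MonoidalLeftAction.associator_actionHom,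
    Iso.inv_hom_id_assoc]

theorem actSwap_tensor_right (z x y : P) (v : L) :
    (actSwap z (x ⊗ y) v).hom ≫ (αₗ x y (z ⊙ₗ v)).hom =
      z ⊴ₗ (αₗ x y v).hom ≫ (actSwap z x (y ⊙ₗ v)).hom ≫ x ⊴ₗ (actSwap z y v).hom := by
  have := actSwap_tensor_left x y z v
  have h := congrArg (fun f => z ⊴ₗ (αₗ x y v).hom ≫ (actSwap z x (y ⊙ₗ v)).hom ≫
    x ⊴ₗ (actSwap z y v).hom ≫ (αₗ x y (z ⊙ₗ v)).inv ≫ f ≫ z ⊴ₗ (αₗ x y v).inv ≫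
      (actSwap z (x ⊗ y) v).hom ≫ (αₗ x y (z ⊙ₗ v)).hom) this
  rw [← actSwap_inv z (x ⊗ y), ← actSwap_inv z x, ← actSwap_inv z y] at h
  simpa using h.symm

theorem actSwap_unit_left (x : P) (v : L) :
    (actSwap (𝟙_ P) x v).hom ≫ x ⊴ₗ (λₗ v).hom = (λₗ (x ⊙ₗ v)).hom := by
  have := MonoidalLeftAction.rightUnitor_actionHom x v
  rw [actSwap_hom, Category.assoc, Category.assoc, ← this, ← MonoidalLeftAction.comp_actionHomLeft,
    braiding_rightUnitor, MonoidalLeftAction.leftUnitor_actionHom, Iso.inv_hom_id_assoc]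

end Swap

section Sum

variable (P : Type u) [Category.{v} P] [MonoidalCategory P]

/-- Objects of the sum `L + M` of two torsors: pairs of objects. -/
structure TSum (P : Type u) (L M : Type u) : Type u where
  fst : L
  snd : M

variable {P}
variable {L M : Type u} [Category.{max u v} L] [Category.{max u v} M]
  [MonoidalLeftAction P L] [MonoidalLeftAction P M]

/-- Triples `(x, φ₁, φ₂)` representing morphisms `(v, w) ⟶ (v', w')` in `L + M`. -/
structure TSum.Triple (a b : TSum P L M) : Type (max u v) where
  x : P
  f : a.fst ⟶ x ⊙ₗ b.fst
  g : x ⊙ₗ a.snd ⟶ b.snd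

/-- `(x, φ₁, φ₂) ∼ (y, ψ₁, ψ₂)` if some `h : x ⟶ y` carries `φ₁` to `ψ₁` and `ψ₂` to `φ₂`. -/
def TSum.Triple.Rel {a b : TSum P L M} (p q : TSum.Triple a b) : Prop :=
  ∃ h : p.x ⟶ q.x, q.f = p.f ≫ h ⊵ₗ b.fst ∧ p.g = h ⊵ₗ a.snd ≫ q.g

variable [IsPicardGroupoid P]

theorem TSum.Triple.rel_equivalence (a b : TSum P L M) :
    Equivalence (TSum.Triple.Rel (a := a) (b := b)) where
  refl p := ⟨𝟙 _, by simp⟩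
  symm := by
    rintro p q ⟨h, h1, h2⟩
    exact ⟨inv h, by simp [h1], by simp [h2]⟩
  trans := by
    rintro p q r ⟨h, h1, h2⟩ ⟨k, k1, k2⟩
    exact ⟨h ≫ k, by simp [h1, k1], by simp [h2, k2]⟩

instance TSum.Triple.setoid (a b : TSum P L M) : Setoid (TSum.Triple a b) :=
  ⟨TSum.Triple.Rel, TSum.Triple.rel_equivalence a b⟩

/-- Identity triple. -/
def TSum.Triple.id (a : TSum P L M) : TSum.Triple a a :=
  ⟨𝟙_ P, (λₗ a.fst).inv,
    (λₗ a.snd).hom⟩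

variable [SymmetricCategory P]

/-- Composition of triples; the second component uses the commutativity constraint of `P`. -/
def TSum.Triple.comp {a b c : TSum P L M} (p : TSum.Triple a b) (q : TSum.Triple b c) :
    TSum.Triple a c :=
  ⟨p.x ⊗ q.x,
    p.f ≫ p.x ⊴ₗ q.f ≫ (αₗ p.x q.x c.fst).inv,
    (β_ p.x q.x).hom ⊵ₗ a.snd ≫ (αₗ q.x p.x a.snd).hom ≫
      q.x ⊴ₗ p.g ≫ q.g⟩

instance TSum.category : Category.{max u v} (TSum P L M) where
  Hom a b := Quotient (TSum.Triple.setoid a b)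
  id a := ⟦TSum.Triple.id a⟧
  comp {a b c} := Quotient.map₂ TSum.Triple.comp (by
    intro p p' ⟨h, h1, h2⟩ q q' ⟨k, k1, k2⟩
    refine ⟨h ⊗ₘ k, ?_, ?_⟩
    · have := MonoidalLeftAction.actionAssocIso_inv_naturality h k (𝟙 c.fst)
      simp only [MonoidalLeftAction.actionHom_id] at this
      simp only [TSum.Triple.comp, h1, k1, Category.assoc, ← this, MonoidalLeftAction.actionHom_def,
        MonoidalLeftAction.actionHomRight_comp]
      rw [MonoidalLeftAction.action_exchange_assoc]
    · have := MonoidalLeftAction.actionAssocIso_hom_naturality k h (𝟙 a.snd)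
      simp only [MonoidalLeftAction.actionHom_id] at this
      have h3 := congrArg (fun f => f ⊵ₗ a.snd) (BraidedCategory.braiding_naturality h k)
      simp only [MonoidalLeftAction.comp_actionHomLeft] at h3
      simp only [TSum.Triple.comp, h2, k2, Category.assoc, reassoc_of% this, reassoc_of% h3,
        MonoidalLeftAction.actionHom_def', MonoidalLeftAction.actionHomRight_comp]
      rw [MonoidalLeftAction.action_exchange_assoc])
  id_comp := by
    rintro a b ⟨p⟩
    refine Quotient.sound ⟨(λ_ p.x).hom, ?_, ?_⟩
    · simp [TSum.Triple.id, TSum.Triple.comp]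
    · have h := MonoidalLeftAction.rightUnitor_actionHom p.x a.snd
      rw [← cancel_epi ((ρ_ p.x).inv ⊵ₗ a.snd), MonoidalLeftAction.inv_hom_actionHomLeft] at h
      simp [TSum.Triple.id, TSum.Triple.comp, ← reassoc_of% h]
  comp_id := by
    rintro a b ⟨p⟩
    refine Quotient.sound ⟨(ρ_ p.x).hom, ?_, ?_⟩
    · simp [TSum.Triple.id, TSum.Triple.comp]
    · have h := MonoidalLeftAction.leftUnitor_actionHom p.x b.snd
      have h' := congrArg (fun f => f ⊵ₗ a.snd) (braiding_rightUnitor p.x)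
      have h2 := MonoidalLeftAction.actionUnitIso_hom_naturality (C := P) p.g
      have h3 := MonoidalLeftAction.leftUnitor_actionHom p.x a.snd
      simp only [MonoidalLeftAction.comp_actionHomLeft] at h'
      have h4 : (λ_ p.x).inv ⊵ₗ a.snd ≫ (αₗ (𝟙_ P) p.x a.snd).hom ≫ (λₗ (p.x ⊙ₗ a.snd)).hom =
          𝟙 _ := by
        rw [← h3, MonoidalLeftAction.inv_hom_actionHomLeft]
      simp [TSum.Triple.comp, TSum.Triple.id, reassoc_of% h4]
  assoc := by
    rintro a b c d ⟨p⟩ ⟨q⟩ ⟨r⟩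
    refine Quotient.sound ⟨(α_ p.x q.x r.x).hom, ?_, ?_⟩
    · have := MonoidalLeftAction.associator_actionHom p.x q.x r.x d.fst
      have h2 : (αₗ p.x q.x (r.x ⊙ₗ d.fst)).inv ≫ (αₗ (p.x ⊗ q.x) r.x d.fst).inv ≫
          (α_ p.x q.x r.x).hom ⊵ₗ d.fst =
          p.x ⊴ₗ (αₗ q.x r.x d.fst).inv ≫ (αₗ p.x (q.x ⊗ r.x) d.fst).inv := by
        simp [Iso.inv_comp_eq, ← reassoc_of% this]
      simp [TSum.Triple.comp, h2]
    · have yb := congrArg (fun f => f ⊵ₗ a.snd) (BraidedCategory.yang_baxter p.x q.x r.x)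
      have yb' := congrArg (fun f => f ≫ (αₗ r.x (q.x ⊗ p.x) a.snd).hom) yb
      simp at yb'
      have h1 := MonoidalLeftAction.associator_actionHom r.x q.x p.x a.snd
      have h2 := MonoidalLeftAction.action_exchange (β_ q.x r.x).hom p.g
      simp only [MonoidalLeftAction.actionHomLeft_action, MonoidalLeftAction.tensor_actionHomRight,
        Category.assoc] at h2
      rw [← cancel_epi (αₗ q.x r.x (p.x ⊙ₗ a.snd)).inv, ← cancel_mono (αₗ r.x q.x b.snd).hom] at h2
      simp only [Category.assoc, Iso.inv_hom_id_assoc, Iso.inv_hom_id, Category.comp_id] at h2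
      simp [TSum.Triple.comp, reassoc_of% h2, ← reassoc_of% yb', reassoc_of% h1]

namespace TSum

/-- The class of a triple. -/
def homMk {a b : TSum P L M} (x : P) (f : a.fst ⟶ x ⊙ₗ b.fst) (g : x ⊙ₗ a.snd ⟶ b.snd) : a ⟶ b :=
  Quotient.mk (Triple.setoid a b) ⟨x, f, g⟩

theorem homMk_comp_homMk {a b c : TSum P L M} (x : P) (f : a.fst ⟶ x ⊙ₗ b.fst) (g : x ⊙ₗ a.snd ⟶ b.snd)
    (y : P) (f' : b.fst ⟶ y ⊙ₗ c.fst) (g' : y ⊙ₗ b.snd ⟶ c.snd) :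
    homMk x f g ≫ homMk y f' g' = homMk (x ⊗ y) (f ≫ x ⊴ₗ f' ≫ (αₗ x y c.fst).inv)
      ((β_ x y).hom ⊵ₗ a.snd ≫ (αₗ y x a.snd).hom ≫ y ⊴ₗ g ≫ g') := rfl

theorem homMk_eq_homMk {a b : TSum P L M} {x : P} {f : a.fst ⟶ x ⊙ₗ b.fst} {g : x ⊙ₗ a.snd ⟶ b.snd}
    {y : P} {f' : a.fst ⟶ y ⊙ₗ b.fst} {g' : y ⊙ₗ a.snd ⟶ b.snd} (h : x ⟶ y)
    (h1 : f' = f ≫ h ⊵ₗ b.fst) (h2 : g = h ⊵ₗ a.snd ≫ g') :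
    homMk x f g = homMk y f' g' :=
  Quotient.sound ⟨h, h1, h2⟩

theorem id_eq (a : TSum P L M) : 𝟙 a = homMk (𝟙_ P) (λₗ a.fst).inv (λₗ a.snd).hom := rfl

theorem exists_homMk {a b : TSum P L M} (m : a ⟶ b) : ∃ x f g, m = homMk x f g := by
  obtain ⟨⟨x, f, g⟩⟩ := m
  exact ⟨x, f, g, rfl⟩

/-- A morphism in the first summand. -/
def inl {v v' : L} (f : v ⟶ v') (w : M) : (⟨v, w⟩ : TSum P L M) ⟶ ⟨v', w⟩ :=
  homMk (𝟙_ P) (f ≫ (λₗ v').inv) (λₗ w).hom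

/-- A morphism in the second summand. -/
def inr (v : L) {w w' : M} (g : w ⟶ w') : (⟨v, w⟩ : TSum P L M) ⟶ ⟨v, w'⟩ :=
  homMk (𝟙_ P) (λₗ v).inv ((λₗ w).hom ≫ g)

/-- The canonical isomorphism `(x + v, w) ≅ (v, x + w)`. -/
def move (x : P) (v : L) (w : M) : (⟨x ⊙ₗ v, w⟩ : TSum P L M) ⟶ ⟨v, x ⊙ₗ w⟩ :=
  homMk x (𝟙 _) (𝟙 _)

theorem homMk_comp_inr {a : TSum P L M} {v : L} {w w' : M} (x : P) (f : a.fst ⟶ x ⊙ₗ v)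
    (g : x ⊙ₗ a.snd ⟶ w) (k : w ⟶ w') :
    homMk (b := ⟨v, w⟩) x f g ≫ inr v k = homMk x f (g ≫ k) := by
  have h' := congrArg (fun f => f ⊵ₗ a.snd) (braiding_rightUnitor x)
  have h3 := MonoidalLeftAction.leftUnitor_actionHom x a.snd
  have h2 := MonoidalLeftAction.actionUnitIso_hom_naturality (C := P) g
  simp only [MonoidalLeftAction.comp_actionHomLeft] at h'
  have h5 : (β_ x (𝟙_ P)).hom ⊵ₗ a.snd ≫ (αₗ (𝟙_ P) x a.snd).hom ≫ (λₗ (x ⊙ₗ a.snd)).hom =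
    (ρ_ x).hom ⊵ₗ a.snd := by
    rw [← h3, ← MonoidalLeftAction.comp_actionHomLeft, braiding_leftUnitor]
  rw [inr, homMk_comp_homMk]
  refine homMk_eq_homMk (ρ_ x).hom ?_ ?_
  · simp
  · rw [← reassoc_of% h2, reassoc_of% h5]

theorem inl_comp_homMk {v v' : L} {w : M} {b : TSum P L M} (x : P) (k : v ⟶ v')
    (f : v' ⟶ x ⊙ₗ b.fst)
    (g : x ⊙ₗ w ⟶ b.snd) :
    inl k w ≫ homMk (a := ⟨v', w⟩) x f g = homMk (a := ⟨v, w⟩) x (k ≫ f) g := by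
  have h := MonoidalLeftAction.rightUnitor_actionHom x w
  rw [← cancel_epi ((ρ_ x).inv ⊵ₗ w), MonoidalLeftAction.inv_hom_actionHomLeft] at h
  rw [inl, homMk_comp_homMk]
  refine homMk_eq_homMk (λ_ x).hom ?_ ?_
  · simp
  · simp only [braiding_tensorUnit_left, MonoidalLeftAction.comp_actionHomLeft, Category.assoc,
      ← reassoc_of% h]

theorem homMk_comp_inl {a : TSum P L M} {v v' : L} {w : M} (x : P) (f : a.fst ⟶ x ⊙ₗ v)
    (g : x ⊙ₗ a.snd ⟶ w) (k : v ⟶ v') :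
    homMk (b := ⟨v, w⟩) x f g ≫ inl k w = homMk (b := ⟨v', w⟩) x (f ≫ x ⊴ₗ k) g := by
  have h3 := MonoidalLeftAction.leftUnitor_actionHom x a.snd
  have h2 := MonoidalLeftAction.actionUnitIso_hom_naturality (C := P) g
  have h5 : (β_ x (𝟙_ P)).hom ⊵ₗ a.snd ≫ (αₗ (𝟙_ P) x a.snd).hom ≫ (λₗ (x ⊙ₗ a.snd)).hom =
    (ρ_ x).hom ⊵ₗ a.snd := by
    rw [← h3, ← MonoidalLeftAction.comp_actionHomLeft, braiding_leftUnitor]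
  rw [inl, homMk_comp_homMk]
  refine homMk_eq_homMk (ρ_ x).hom ?_ ?_
  · simp
  · rw [← h2, reassoc_of% h5]

theorem inr_comp_homMk {v : L} {w w' : M} {b : TSum P L M} (x : P) (k : w ⟶ w')
    (f : v ⟶ x ⊙ₗ b.fst) (g : x ⊙ₗ w' ⟶ b.snd) :
    inr v k ≫ homMk (a := ⟨v, w'⟩) x f g = homMk (a := ⟨v, w⟩) x f (x ⊴ₗ k ≫ g) := by
  have h := MonoidalLeftAction.rightUnitor_actionHom x w
  rw [← cancel_epi ((ρ_ x).inv ⊵ₗ w), MonoidalLeftAction.inv_hom_actionHomLeft] at h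
  rw [inr, homMk_comp_homMk]
  refine homMk_eq_homMk (λ_ x).hom ?_ ?_
  · simp
  · simp only [braiding_tensorUnit_left, MonoidalLeftAction.comp_actionHomLeft, Category.assoc,
      ← reassoc_of% h, MonoidalLeftAction.actionHomRight_comp]

theorem homMk_eq {v v' : L} {w w' : M} (x : P) (f : v ⟶ x ⊙ₗ v') (g : x ⊙ₗ w ⟶ w') :
    (homMk x f g : (⟨v, w⟩ : TSum P L M) ⟶ ⟨v', w'⟩) = inl f w ≫ move x v' w ≫ inr v' g := by
  rw [move, homMk_comp_inr, inl_comp_homMk]; simp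

theorem inl_comp {v v' v'' : L} (f : v ⟶ v') (g : v' ⟶ v'') (w : M) :
    (inl f w : (⟨v, w⟩ : TSum P L M) ⟶ _) ≫ inl g w = inl (f ≫ g) w := by
  conv_lhs => rw [inl.eq_def g, inl_comp_homMk]
  simp [inl]

theorem inl_id (v : L) (w : M) : (inl (𝟙 v) w : (⟨v, w⟩ : TSum P L M) ⟶ _) = 𝟙 _ := by
  simp [inl, id_eq]

theorem inr_comp (v : L) {w w' w'' : M} (f : w ⟶ w') (g : w' ⟶ w'') :
    (inr v f : (⟨v, w⟩ : TSum P L M) ⟶ _) ≫ inr v g = inr v (f ≫ g) := by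
  conv_lhs => rw [inr.eq_def v f, homMk_comp_inr]
  simp [inr]

theorem inr_id (v : L) (w : M) : (inr v (𝟙 w) : (⟨v, w⟩ : TSum P L M) ⟶ _) = 𝟙 _ := by
  simp [inr, id_eq]

theorem inl_inr {v v' : L} (f : v ⟶ v') {w w' : M} (g : w ⟶ w') :
    (inl f w : (⟨v, w⟩ : TSum P L M) ⟶ _) ≫ inr v' g = inr v g ≫ inl f w' := by
  conv_lhs => rw [inl.eq_def f, homMk_comp_inr]
  conv_rhs => rw [inr.eq_def v, homMk_comp_inl]
  simp

theorem move_natural {x y : P} (h : x ⟶ y) (v : L) (w : M) :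
    (inl (h ⊵ₗ v) w : (⟨x ⊙ₗ v, w⟩ : TSum P L M) ⟶ _) ≫ move y v w =
      move x v w ≫ inr v (h ⊵ₗ w) := by
  rw [move, inl_comp_homMk, move, homMk_comp_inr]
  refine (homMk_eq_homMk h ?_ ?_).symm <;> simp

theorem move_left (x : P) {v v' : L} (f : v ⟶ v') (w : M) :
    (inl (x ⊴ₗ f) w : (⟨x ⊙ₗ v, w⟩ : TSum P L M) ⟶ _) ≫ move x v' w =
      move x v w ≫ inl f (x ⊙ₗ w) := by
  rw [move, inl_comp_homMk, move, homMk_comp_inl]; simp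

theorem move_right (x : P) (v : L) {w w' : M} (g : w ⟶ w') :
    (inr (x ⊙ₗ v) g : (⟨x ⊙ₗ v, w⟩ : TSum P L M) ⟶ _) ≫ move x v w' =
      move x v w ≫ inr v (x ⊴ₗ g) := by
  rw [move, inr_comp_homMk, move, homMk_comp_inr]; simp

theorem move_tensor (x y : P) (v : L) (w : M) :
    move (x ⊗ y) v w = inl (αₗ x y v).hom w ≫ move x (y ⊙ₗ v) w ≫ move y v (x ⊙ₗ w) ≫
      inr v ((αₗ y x w).inv ≫ (β_ y x).hom ⊵ₗ w) := by
  have h : move x (y ⊙ₗ v) w ≫ move y v (x ⊙ₗ w) =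
      (homMk (x ⊗ y) (αₗ x y v).inv ((β_ x y).hom ⊵ₗ w ≫ (αₗ y x w).hom) :
        (⟨x ⊙ₗ y ⊙ₗ v, w⟩ : TSum P L M) ⟶ ⟨v, y ⊙ₗ x ⊙ₗ w⟩) := by
    rw [move, move, homMk_comp_homMk]
    congr 1 <;> simp
  rw [reassoc_of% h, homMk_comp_inr, inl_comp_homMk, move]
  congr 1
  · simp
  · simp [← MonoidalLeftAction.comp_actionHomLeft]

theorem exists_move_right_inv (x : P) (v : L) (w : M) :
    ∃ m, (move x v w : (⟨x ⊙ₗ v, w⟩ : TSum P L M) ⟶ _) ≫ m = 𝟙 _ := by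
  obtain ⟨y, ⟨k⟩⟩ := exists_inverse x
  have hx := actionLeft_isEquivalence_of_picard L x
  let u : x ⊙ₗ v ⟶ x ⊙ₗ (y ⊙ₗ (x ⊙ₗ v)) :=
    (λₗ (x ⊙ₗ v)).inv ≫ k.inv ⊵ₗ (x ⊙ₗ v) ≫ (αₗ x y (x ⊙ₗ v)).hom
  obtain ⟨p, hp⟩ : ∃ p : v ⟶ y ⊙ₗ (x ⊙ₗ v), x ⊴ₗ p = u :=
    (MonoidalLeftAction.actionLeft L x).map_surjective (X := v) (Y := y ⊙ₗ (x ⊙ₗ v)) u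
  refine ⟨homMk y p ((αₗ y x w).inv ≫ (β_ y x).hom ⊵ₗ w ≫ k.hom ⊵ₗ w ≫ (λₗ w).hom), ?_⟩
  rw [move, homMk_comp_homMk, id_eq]
  refine homMk_eq_homMk k.hom ?_ ?_
  · simp only [hp, u]
    rw [Category.id_comp, Category.assoc, Category.assoc, Category.assoc,
      Iso.hom_inv_id_assoc, MonoidalLeftAction.inv_hom_actionHomLeft, Category.comp_id]
  · simp only [MonoidalLeftAction.actionHomRight_id, Category.id_comp, Iso.hom_inv_id_assoc]
    rw [← MonoidalLeftAction.comp_actionHomLeft_assoc, SymmetricCategory.symmetry,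
      MonoidalLeftAction.id_actionHomLeft, Category.id_comp]

theorem exists_gen {a b : TSum P L M} (m : a ⟶ b) :
    ∃ (x : P) (f : a.fst ⟶ x ⊙ₗ b.fst) (g : x ⊙ₗ a.snd ⟶ b.snd),
      m = inl f a.snd ≫ move x b.fst a.snd ≫ inr b.fst g := by
  obtain ⟨x, f, g, rfl⟩ := exists_homMk m
  exact ⟨x, f, g, homMk_eq x f g⟩

instance isGroupoid [IsGroupoid L] [IsGroupoid M] : IsGroupoid (TSum P L M) := by
  have key : ∀ {a b : TSum P L M} (m : a ⟶ b), ∃ m' : b ⟶ a, m ≫ m' = 𝟙 a := by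
    intro a b m
    obtain ⟨x, f, g, rfl⟩ := exists_gen m
    obtain ⟨m', hm'⟩ := exists_move_right_inv x b.fst a.snd
    refine ⟨inr b.fst (inv g) ≫ m' ≫ inl (inv f) a.snd, ?_⟩
    have h1 : (inr b.fst g : (⟨b.fst, x ⊙ₗ a.snd⟩ : TSum P L M) ⟶ _) ≫ inr b.fst (inv g) =
      𝟙 _ := by rw [inr_comp, IsIso.hom_inv_id, inr_id]
    have h2 : (inl f a.snd : (⟨a.fst, a.snd⟩ : TSum P L M) ⟶ _) ≫ inl (inv f) a.snd =
      𝟙 _ := by rw [inl_comp, IsIso.hom_inv_id, inl_id]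
    simp only [Category.assoc]
    rw [reassoc_of% h1, reassoc_of% hm']
    exact h2
  refine ⟨fun {a b} m => ?_⟩
  obtain ⟨m', h⟩ := key m
  obtain ⟨m'', h'⟩ := key m'
  have : m = m'' := by rw [← Category.comp_id m, ← h', reassoc_of% h]
  exact ⟨m', h, by rw [this, h']⟩

/-- A balanced bifunctor on `L × M` with values in a category `D`. -/
structure Balanced (P : Type u) [Category.{v} P] [MonoidalCategory P] [SymmetricCategory P]
    (L M : Type u) [Category.{max u v} L] [Category.{max u v} M]
    [MonoidalLeftAction P L] [MonoidalLeftAction P M] (D : Type u) [Category.{max u v} D] where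
  obj : L → M → D
  mapL {v v' : L} (f : v ⟶ v') (w : M) : obj v w ⟶ obj v' w
  mapR (v : L) {w w' : M} (g : w ⟶ w') : obj v w ⟶ obj v w'
  bal (x : P) (v : L) (w : M) : obj (x ⊙ₗ v) w ⟶ obj v (x ⊙ₗ w)
  mapL_id : ∀ v w, mapL (𝟙 v) w = 𝟙 _
  mapR_id : ∀ v w, mapR v (𝟙 w) = 𝟙 _
  mapL_comp : ∀ {v v' v''} (f : v ⟶ v') (g : v' ⟶ v'') w, mapL (f ≫ g) w = mapL f w ≫ mapL g w
  mapR_comp : ∀ v {w w' w''} (f : w ⟶ w') (g : w' ⟶ w''), mapR v (f ≫ g) = mapR v f ≫ mapR v g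
  comm : ∀ {v v'} (f : v ⟶ v') {w w'} (g : w ⟶ w'),
    mapL f w ≫ mapR v' g = mapR v g ≫ mapL f w'
  bal_natural : ∀ {x y : P} (h : x ⟶ y) v w,
    mapL (h ⊵ₗ v) w ≫ bal y v w = bal x v w ≫ mapR v (h ⊵ₗ w)
  bal_left : ∀ x {v v'} (f : v ⟶ v') w,
    mapL (x ⊴ₗ f) w ≫ bal x v' w = bal x v w ≫ mapL f (x ⊙ₗ w)
  bal_right : ∀ x v {w w'} (g : w ⟶ w'),
    mapR (x ⊙ₗ v) g ≫ bal x v w' = bal x v w ≫ mapR v (x ⊴ₗ g)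
  bal_tensor : ∀ x y v w, bal (x ⊗ y) v w =
    mapL (αₗ x y v).hom w ≫ bal x (y ⊙ₗ v) w ≫ bal y v (x ⊙ₗ w) ≫
      mapR v ((αₗ y x w).inv ≫ (β_ y x).hom ⊵ₗ w)

section Lift

variable {D : Type u} [Category.{max u v} D]

/-- The action on morphisms of the functor on `L + M` induced by a balanced bifunctor. -/
def Balanced.map (B : Balanced P L M D) {a b : TSum P L M} (m : a ⟶ b) :
    B.obj a.fst a.snd ⟶ B.obj b.fst b.snd :=
  Quotient.lift
    (fun p : Triple a b => B.mapL p.f a.snd ≫ B.bal p.x b.fst a.snd ≫ B.mapR b.fst p.g)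
    (by
      rintro p q ⟨h, h1, h2⟩
      simp only [h1, h2, B.mapL_comp, B.mapR_comp, Category.assoc]
      rw [reassoc_of% B.bal_natural]) m

theorem Balanced.map_homMk (B : Balanced P L M D) {a b : TSum P L M} (x : P)
    (f : a.fst ⟶ x ⊙ₗ b.fst) (g : x ⊙ₗ a.snd ⟶ b.snd) :
    B.map (homMk x f g) = B.mapL f a.snd ≫ B.bal x b.fst a.snd ≫ B.mapR b.fst g := rfl

theorem Balanced.map_comp (B : Balanced P L M D) {a b c : TSum P L M} (m : a ⟶ b) (n : b ⟶ c) :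
    B.map (m ≫ n) = B.map m ≫ B.map n := by
  obtain ⟨x, f, g, rfl⟩ := exists_homMk m
  obtain ⟨y, f', g', rfl⟩ := exists_homMk n
  rw [homMk_comp_homMk, Balanced.map_homMk, Balanced.map_homMk, Balanced.map_homMk]
  simp only [B.bal_tensor, B.mapL_comp, Category.assoc]
  rw [← reassoc_of% B.comm, reassoc_of% B.bal_right, ← reassoc_of% B.bal_left]
  have h : B.mapL (αₗ x y c.fst).inv a.snd ≫ B.mapL (αₗ x y c.fst).hom a.snd = 𝟙 _ := by
    rw [← B.mapL_comp, Iso.inv_hom_id, B.mapL_id]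
  rw [reassoc_of% h]
  simp only [← B.mapR_comp, Category.assoc]
  rw [← MonoidalLeftAction.comp_actionHomLeft_assoc, SymmetricCategory.symmetry,
      MonoidalLeftAction.id_actionHomLeft, Category.id_comp, Iso.inv_hom_id_assoc]

theorem Balanced.map_id [IsGroupoid D] (B : Balanced P L M D) (a : TSum P L M) :
    B.map (𝟙 a) = 𝟙 _ := by
  have h := B.map_comp (𝟙 a) (𝟙 a)
  rw [Category.comp_id] at h
  rw [← cancel_epi (B.map (𝟙 a)), ← h, Category.comp_id]

/-- The functor on `L + M` induced by a balanced bifunctor. -/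
def lift [IsGroupoid D] (B : Balanced P L M D) : TSum P L M ⥤ D where
  obj a := B.obj a.fst a.snd
  map := B.map
  map_id := B.map_id
  map_comp := B.map_comp

variable [IsGroupoid D] (B : Balanced P L M D)

theorem lift_map {a b : TSum P L M} (m : a ⟶ b) : (lift B).map m = B.map m := rfl

theorem lift_map_inl {v v' : L} (f : v ⟶ v') (w : M) :
    (lift B).map (inl f w) = B.mapL f w := by
  have h := B.map_id ⟨v', w⟩
  rw [id_eq, B.map_homMk] at h
  rw [lift_map, inl, B.map_homMk, B.mapL_comp, Category.assoc, h, Category.comp_id]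

theorem lift_map_inr (v : L) {w w' : M} (g : w ⟶ w') :
    (lift B).map (inr v g) = B.mapR v g := by
  have h := B.map_id ⟨v, w⟩
  rw [id_eq, B.map_homMk] at h
  rw [lift_map, inr, B.map_homMk, B.mapR_comp, reassoc_of% h]

theorem lift_map_move (x : P) (v : L) (w : M) :
    (lift B).map (move x v w) = B.bal x v w := by
  rw [lift_map, move, B.map_homMk, B.mapL_id, B.mapR_id, Category.id_comp, Category.comp_id]

end Lift

theorem inl_comp' {v v' v'' : L} (f : v ⟶ v') (g : v' ⟶ v'') (w : M) {b : TSum P L M}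
    (m : (⟨v'', w⟩ : TSum P L M) ⟶ b) :
    (inl f w : (⟨v, w⟩ : TSum P L M) ⟶ _) ≫ inl g w ≫ m = inl (f ≫ g) w ≫ m := by
  rw [← Category.assoc, inl_comp]

theorem inr_comp' (v : L) {w w' w'' : M} (f : w ⟶ w') (g : w' ⟶ w'') {b : TSum P L M}
    (m : (⟨v, w''⟩ : TSum P L M) ⟶ b) :
    (inr v f : (⟨v, w⟩ : TSum P L M) ⟶ _) ≫ inr v g ≫ m = inr v (f ≫ g) ≫ m := by
  rw [← Category.assoc, inr_comp]

/-- Induction principle: every morphism of `L + M` is composed of three basic kinds. -/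
theorem hom_induction {motive : ∀ {a b : TSum P L M}, (a ⟶ b) → Prop}
    (comp : ∀ {a b c : TSum P L M} (m : a ⟶ b) (n : b ⟶ c), motive m → motive n → motive (m ≫ n))
    (inl : ∀ {v v' : L} (f : v ⟶ v') (w : M), motive (inl f w))
    (inr : ∀ (v : L) {w w' : M} (g : w ⟶ w'), motive (inr v g))
    (move : ∀ (x : P) (v : L) (w : M), motive (move x v w))
    {a b : TSum P L M} (m : a ⟶ b) : motive m := by
  obtain ⟨x, f, g, rfl⟩ := exists_gen m
  exact comp _ _ (inl f a.snd) (comp _ _ (move x b.fst a.snd) (inr b.fst g))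

theorem move_left' (x : P) {v v' : L} (f : v ⟶ v') (w : M) {b : TSum P L M}
    (m : (⟨v', x ⊙ₗ w⟩ : TSum P L M) ⟶ b) :
    (move x v w : (⟨x ⊙ₗ v, w⟩ : TSum P L M) ⟶ _) ≫ inl f (x ⊙ₗ w) ≫ m =
      inl (x ⊴ₗ f) w ≫ move x v' w ≫ m := by
  rw [← Category.assoc, ← move_left, Category.assoc]

/-- An isomorphism in the first summand. -/
def inlIso {v v' : L} (e : v ≅ v') (w : M) : (⟨v, w⟩ : TSum P L M) ≅ ⟨v', w⟩ where
  hom := inl e.hom w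
  inv := inl e.inv w
  hom_inv_id := by rw [inl_comp, Iso.hom_inv_id, inl_id]
  inv_hom_id := by rw [inl_comp, Iso.inv_hom_id, inl_id]

section Action

variable [IsGroupoid L] [IsGroupoid M]

/-- The balanced bifunctor `(v, w) ↦ (z + v, w)`. -/
def actBalanced (z : P) : Balanced P L M (TSum P L M) where
  obj v w := ⟨z ⊙ₗ v, w⟩
  mapL f w := inl (z ⊴ₗ f) w
  mapR v _ _ g := inr (z ⊙ₗ v) g
  bal x v w := inl (actSwap z x v).hom w ≫ move x (z ⊙ₗ v) w
  mapL_id v w := by rw [MonoidalLeftAction.actionHomRight_id, inl_id]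
  mapR_id v w := inr_id _ _
  mapL_comp f g w := by rw [MonoidalLeftAction.actionHomRight_comp, inl_comp]
  mapR_comp v _ _ _ f g := (inr_comp _ _ _).symm
  comm f _ _ g := inl_inr _ _
  bal_natural h v w := by
    rw [inl_comp', actSwap_natural_right, Category.assoc, ← move_natural, inl_comp']
  bal_left x _ _ f w := by
    rw [inl_comp', actSwap_natural, Category.assoc, ← move_left, inl_comp']
  bal_right x v _ _ g := by
    rw [← reassoc_of% inl_inr, move_right, Category.assoc]
  bal_tensor x y v w := by
    rw [move_tensor]
    simp only [Category.assoc]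
    rw [move_left', inl_comp', inl_comp', inl_comp', actSwap_tensor_right]
    simp only [Category.assoc]

/-- The action of an object of `P` on a morphism of `L + M`. -/
def actR (z : P) {a b : TSum P L M} (m : a ⟶ b) :
    (⟨z ⊙ₗ a.fst, a.snd⟩ : TSum P L M) ⟶ ⟨z ⊙ₗ b.fst, b.snd⟩ :=
  (actBalanced z).map m

theorem actR_inl (z : P) {v v' : L} (f : v ⟶ v') (w : M) :
    actR z (inl f w : (⟨v, w⟩ : TSum P L M) ⟶ ⟨v', w⟩) = inl (z ⊴ₗ f) w :=
  lift_map_inl (actBalanced z) f w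

theorem actR_inr (z : P) (v : L) {w w' : M} (g : w ⟶ w') :
    actR z (inr v g : (⟨v, w⟩ : TSum P L M) ⟶ ⟨v, w'⟩) = inr (z ⊙ₗ v) g :=
  lift_map_inr (actBalanced z) v g

theorem actR_move (z x : P) (v : L) (w : M) :
    actR z (move x v w : (⟨x ⊙ₗ v, w⟩ : TSum P L M) ⟶ ⟨v, x ⊙ₗ w⟩) =
      inl (actSwap z x v).hom w ≫ move x (z ⊙ₗ v) w :=
  lift_map_move (actBalanced z) x v w

theorem actR_id (z : P) (a : TSum P L M) : actR z (𝟙 a) = 𝟙 (⟨z ⊙ₗ a.fst, a.snd⟩ : TSum P L M) :=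
  (actBalanced z).map_id a

theorem actR_comp (z : P) {a b c : TSum P L M} (m : a ⟶ b) (n : b ⟶ c) :
    actR z (m ≫ n) = actR z m ≫ actR z n :=
  (actBalanced z).map_comp m n

theorem actR_exchange {z z' : P} (g : z ⟶ z') {a b : TSum P L M} (m : a ⟶ b) :
    actR z m ≫ inl (g ⊵ₗ b.fst) b.snd = inl (g ⊵ₗ a.fst) a.snd ≫ actR z' m := by
  induction m using hom_induction with
  | comp m n hm hn =>
    rw [actR_comp, actR_comp, Category.assoc, hn, reassoc_of% hm]
  | inl f w =>
    rw [actR_inl, actR_inl, inl_comp, inl_comp, MonoidalLeftAction.action_exchange]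
  | inr v f =>
    rw [actR_inr, actR_inr, inl_inr]
  | move x v w =>
    rw [actR_move, actR_move, inl_comp', actSwap_natural_left, Category.assoc, ← move_left,
      inl_comp']

theorem actR_tensor (z z' : P) {a b : TSum P L M} (m : a ⟶ b) :
    actR (z ⊗ z') m ≫ inl (αₗ z z' b.fst).hom b.snd =
      inl (αₗ z z' a.fst).hom a.snd ≫ actR z (actR z' m) := by
  induction m using hom_induction with
  | comp m n hm hn =>
    rw [actR_comp, actR_comp, actR_comp, Category.assoc, hn, reassoc_of% hm]
  | inl f w =>
    rw [actR_inl, actR_inl, actR_inl, inl_comp, inl_comp]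
    simp
  | inr v f =>
    rw [actR_inr, actR_inr, actR_inr, inl_inr]
  | move x v w =>
    rw [actR_move, actR_move, actR_comp, actR_inl, actR_move, inl_comp', inl_comp', Category.assoc,
      ← move_left, inl_comp', actSwap_tensor_left, Category.assoc]

theorem actR_unit {a b : TSum P L M} (m : a ⟶ b) :
    actR (𝟙_ P) m ≫ inl (λₗ b.fst).hom b.snd = inl (λₗ a.fst).hom a.snd ≫ m := by
  induction m using hom_induction with
  | comp m n hm hn =>
    rw [actR_comp, Category.assoc, hn, reassoc_of% hm]
  | inl f w =>
    rw [actR_inl, inl_comp, inl_comp, MonoidalLeftAction.actionUnitIso_hom_naturality]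
  | inr v f =>
    rw [actR_inr, inl_inr]
  | move x v w =>
    rw [actR_move, Category.assoc, ← move_left, inl_comp', actSwap_unit_left]

instance action : MonoidalLeftAction P (TSum P L M) where
  actionObj z a := ⟨z ⊙ₗ a.fst, a.snd⟩
  actionHomLeft f a := inl (f ⊵ₗ a.fst) a.snd
  actionHomRight z _ _ m := actR z m
  actionAssocIso z z' a := inlIso (αₗ z z' a.fst) a.snd
  actionUnitIso a := inlIso (λₗ a.fst) a.snd
  actionHom_def _ _ := rfl
  actionHomRight_id z a := actR_id z a
  id_actionHomLeft _ _ := by rw [MonoidalLeftAction.id_actionHomLeft, inl_id]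
  actionHom_comp := by
    intro z z' z'' a b c f g m n
    rw [MonoidalLeftAction.comp_actionHomLeft, ← inl_comp, actR_comp]
    simp only [Category.assoc]
    rw [reassoc_of% (actR_exchange g m)]
  actionAssocIso_hom_naturality := by
    intro z z' x x' a b f g m
    change (inl ((f ⊗ₘ g) ⊵ₗ a.fst) a.snd ≫ actR (z' ⊗ x') m) ≫ inl (αₗ z' x' b.fst).hom b.snd =
      inl (αₗ z x a.fst).hom a.snd ≫ inl (f ⊵ₗ (x ⊙ₗ a.fst)) a.snd ≫
        actR z' (inl (g ⊵ₗ a.fst) a.snd ≫ actR x' m)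
    have h := MonoidalLeftAction.actionAssocIso_hom_naturality f g (𝟙 a.fst)
    simp only [MonoidalLeftAction.actionHom_def, MonoidalLeftAction.actionHomRight_id,
      Category.comp_id] at h
    rw [Category.assoc, actR_tensor, actR_comp, actR_inl, inl_comp', inl_comp', inl_comp', h,
      Category.assoc]
  actionUnitIso_hom_naturality m := (actR_unit m).symm
  whiskerLeft_actionHomLeft z x x' f a := by
    change inl ((z ◁ f) ⊵ₗ a.fst) a.snd = inl (αₗ z x a.fst).hom a.snd ≫
      actR z (inl (f ⊵ₗ a.fst) a.snd) ≫ inl (αₗ z x' a.fst).inv a.snd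
    rw [actR_inl, inl_comp, inl_comp, MonoidalLeftAction.whiskerLeft_actionHomLeft]
  whiskerRight_actionHomLeft {x x'} z f a := by
    change inl ((f ▷ z) ⊵ₗ a.fst) a.snd = inl (αₗ x z a.fst).hom a.snd ≫
      inl (f ⊵ₗ (z ⊙ₗ a.fst)) a.snd ≫ inl (αₗ x' z a.fst).inv a.snd
    rw [inl_comp, inl_comp, MonoidalLeftAction.whiskerRight_actionHomLeft]
  associator_actionHom x y z a := by
    change inl ((α_ x y z).hom ⊵ₗ a.fst) a.snd ≫ inl (αₗ x (y ⊗ z) a.fst).hom a.snd ≫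
      actR x (inl (αₗ y z a.fst).hom a.snd) =
      inl (αₗ (x ⊗ y) z a.fst).hom a.snd ≫ inl (αₗ x y (z ⊙ₗ a.fst)).hom a.snd
    rw [actR_inl, inl_comp, inl_comp, inl_comp, MonoidalLeftAction.associator_actionHom]
  leftUnitor_actionHom x a := by
    change inl ((λ_ x).hom ⊵ₗ a.fst) a.snd =
      inl (αₗ (𝟙_ P) x a.fst).hom a.snd ≫ inl (λₗ (x ⊙ₗ a.fst)).hom a.snd
    rw [inl_comp, MonoidalLeftAction.leftUnitor_actionHom]
  rightUnitor_actionHom x a := by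
    change inl ((ρ_ x).hom ⊵ₗ a.fst) a.snd =
      inl (αₗ x (𝟙_ P) a.fst).hom a.snd ≫ actR x (inl (λₗ a.fst).hom a.snd)
    rw [actR_inl, inl_comp, MonoidalLeftAction.rightUnitor_actionHom]

end Action

theorem inl_injective (h𝒯 : IsTorsor P M) {v v' : L} {f g : v ⟶ v'} {w : M}
    (e : (inl f w : (⟨v, w⟩ : TSum P L M) ⟶ ⟨v', w⟩) = inl g w) : f = g := by
  obtain ⟨h, h1, h2⟩ := Quotient.exact e
  have h3 : h = 𝟙 _ := by
    apply (MonoidalLeftAction.actionRight (C := P) w).map_injective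
    change h ⊵ₗ w = 𝟙 (𝟙_ P) ⊵ₗ w
    dsimp only at h2
    rw [MonoidalLeftAction.id_actionHomLeft, ← cancel_mono (λₗ w).hom, ← h2, Category.id_comp]
  dsimp only at h1
  rw [h3, MonoidalLeftAction.id_actionHomLeft, Category.comp_id, cancel_mono] at h1
  exact h1.symm

theorem exists_inl (h𝒯 : IsTorsor P M) {v v' : L} {w : M}
    (m : (⟨v, w⟩ : TSum P L M) ⟶ ⟨v', w⟩) : ∃ f, m = inl f w := by
  obtain ⟨y, f, g, rfl⟩ := exists_homMk m
  obtain ⟨k, hk⟩ : ∃ k : y ⟶ 𝟙_ P, k ⊵ₗ w = g ≫ (λₗ w).inv :=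
    (MonoidalLeftAction.actionRight (C := P) w).map_surjective (X := y) (Y := 𝟙_ P) _
  refine ⟨f ≫ k ⊵ₗ v' ≫ (λₗ v').hom, homMk_eq_homMk k ?_ ?_⟩
  · simp
  · simp [hk]

instance isTorsor [IsGroupoid L] [IsGroupoid M] [hL : IsTorsor P L] [hM : IsTorsor P M] :
    IsTorsor P (TSum P L M) where
  nonempty := by
    obtain ⟨v⟩ := hL.nonempty
    obtain ⟨w⟩ := hM.nonempty
    exact ⟨⟨v, w⟩⟩
  actionLeft_isEquivalence := actionLeft_isEquivalence_of_picard _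
  actionRight_isEquivalence a :=
    { faithful := ⟨fun {x y} f g e => by
        apply (MonoidalLeftAction.actionRight (C := P) a.fst).map_injective
        exact inl_injective hM e⟩
      full := ⟨fun {x y} m => by
        obtain ⟨f, hf⟩ := exists_inl hM (w := a.snd) m
        obtain ⟨k, hk⟩ := (MonoidalLeftAction.actionRight (C := P) a.fst).map_surjective
          (X := x) (Y := y) f
        refine ⟨k, ?_⟩
        rw [hf, ← hk]
        rfl⟩
      essSurj := ⟨fun b => by
        let F := MonoidalLeftAction.actionRight (C := P) a.fst
        let G := MonoidalLeftAction.actionRight (C := P) a.snd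
        let y := G.objPreimage b.snd
        let i2 : y ⊙ₗ a.snd ≅ b.snd := G.objObjPreimageIso b.snd
        let x := F.objPreimage (y ⊙ₗ b.fst)
        let i1 : x ⊙ₗ a.fst ≅ y ⊙ₗ b.fst := F.objObjPreimageIso (y ⊙ₗ b.fst)
        let m : (⟨x ⊙ₗ a.fst, a.snd⟩ : TSum P L M) ⟶ b := homMk y i1.hom i2.hom
        exact ⟨x, ⟨@asIso _ _ _ _ m (isGroupoid.all_isIso m)⟩⟩⟩ }

end TSum
end Sum

section Linear

variable (P : Type u) [Category.{v} P] [MonoidalCategory P]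
variable (L M N : Type u) [Category.{max u v} L] [Category.{max u v} M] [Category.{max u v} N]
  [MonoidalLeftAction P L] [MonoidalLeftAction P M] [MonoidalLeftAction P N]

/-- A `1`-morphism of `P`-torsors: a functor with isomorphisms `F (x + v) ≅ x + F v`, natural
in `x` and `v` and compatible with the associativity constraints. Between torsors such a functor
is automatically an equivalence, see `LinFun.isEquivalence`. -/
structure LinFun where
  functor : L ⥤ M
  lam (x : P) (v : L) : functor.obj (x ⊙ₗ v) ≅ x ⊙ₗ functor.obj v
  lam_natural_left : ∀ {x y : P} (h : x ⟶ y) (v : L),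
    functor.map (h ⊵ₗ v) ≫ (lam y v).hom = (lam x v).hom ≫ h ⊵ₗ functor.obj v
  lam_natural_right : ∀ (x : P) {v w : L} (f : v ⟶ w),
    functor.map (x ⊴ₗ f) ≫ (lam x w).hom = (lam x v).hom ≫ x ⊴ₗ functor.map f
  lam_assoc : ∀ (x y : P) (v : L),
    (lam (x ⊗ y) v).hom ≫ (αₗ x y (functor.obj v)).hom =
      functor.map (αₗ x y v).hom ≫ (lam x (y ⊙ₗ v)).hom ≫ x ⊴ₗ (lam y v).hom

variable {P L M N}

namespace LinFun

/-- The value of a `1`-morphism on an object. -/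
abbrev obj (F : LinFun P L M) (v : L) : M := F.functor.obj v

/-- The value of a `1`-morphism on a morphism. -/
abbrev map (F : LinFun P L M) {v w : L} (f : v ⟶ w) : F.obj v ⟶ F.obj w := F.functor.map f

/-- The identity `1`-morphism. -/
def id : LinFun P L L where
  functor := 𝟭 L
  lam x v := Iso.refl _
  lam_natural_left _ _ := by simp
  lam_natural_right _ _ _ _ := by simp
  lam_assoc _ _ _ := by simp

/-- The composite of `1`-morphisms: first `F`, then `G`. -/
def comp (F : LinFun P L M) (G : LinFun P M N) : LinFun P L N where
  functor := F.functor ⋙ G.functor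
  lam x v := G.functor.mapIso (F.lam x v) ≪≫ G.lam x (F.obj v)
  lam_natural_left h v := by
    simp only [Functor.comp_map, Iso.trans_hom, Functor.mapIso_hom, Category.assoc]
    rw [← G.functor.map_comp_assoc, F.lam_natural_left, G.functor.map_comp, Category.assoc,
      G.lam_natural_left]
    rfl
  lam_natural_right x _ _ f := by
    simp only [Functor.comp_map, Iso.trans_hom, Functor.mapIso_hom, Category.assoc]
    rw [← G.functor.map_comp_assoc, F.lam_natural_right, G.functor.map_comp, Category.assoc,
      G.lam_natural_right]
  lam_assoc x y v := by
    simp only [Functor.comp_map, Iso.trans_hom, Functor.mapIso_hom, Category.assoc,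
      MonoidalLeftAction.actionHomRight_comp]
    have h := congrArg G.functor.map (F.lam_assoc x y v)
    simp only [Functor.map_comp] at h
    have h2 := G.lam_natural_right x (F.lam y v).hom
    have h3 := G.lam_assoc x y (F.obj v)
    erw [h3, reassoc_of% h, reassoc_of% h2]

theorem isEquivalence [hL : IsTorsor P L] [IsTorsor P M] (F : LinFun P L M) :
    F.functor.IsEquivalence := by
  obtain ⟨v⟩ := hL.nonempty
  let i : MonoidalLeftAction.actionRight (C := P) v ⋙ F.functor ≅
      MonoidalLeftAction.actionRight (C := P) (F.obj v) :=
    NatIso.ofComponents (fun x => F.lam x v) (fun {x y} f => F.lam_natural_left f v)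
  have := Functor.isEquivalence_of_iso i.symm
  exact Functor.isEquivalence_of_comp_left (MonoidalLeftAction.actionRight (C := P) v) F.functor

/-- A `2`-morphism: a natural transformation compatible with the actions. -/
@[ext]
structure Hom (F G : LinFun P L M) where
  app (v : L) : F.obj v ⟶ G.obj v
  naturality : ∀ {v w : L} (f : v ⟶ w), F.map f ≫ app w = app v ≫ G.map f
  lam_comp : ∀ (x : P) (v : L),
    app (x ⊙ₗ v) ≫ (G.lam x v).hom = (F.lam x v).hom ≫ x ⊴ₗ app v

instance : Category (LinFun P L M) where
  Hom := Hom
  id F := ⟨fun v => 𝟙 _, by simp, by simp⟩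
  comp η θ := ⟨fun v => η.app v ≫ θ.app v,
    fun f => by rw [reassoc_of% η.naturality, θ.naturality, Category.assoc],
    fun x v => by rw [Category.assoc, θ.lam_comp, reassoc_of% η.lam_comp,
      MonoidalLeftAction.actionHomRight_comp]⟩
  id_comp η := Hom.ext (by funext; exact Category.id_comp _)
  comp_id η := Hom.ext (by funext; exact Category.comp_id _)
  assoc η θ κ := Hom.ext (by funext; exact Category.assoc _ _ _)

theorem map_comp (F : LinFun P L M) {u v w : L} (f : u ⟶ v) (g : v ⟶ w) :
    F.map (f ≫ g) = F.map f ≫ F.map g := Functor.map_comp F.functor f g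

theorem map_lam (F : LinFun P L M) {x y : P} (h : x ⟶ y) (v : L) :
    F.map (h ⊵ₗ v) ≫ (F.lam y v).hom = (F.lam x v).hom ≫ h ⊵ₗ F.obj v := F.lam_natural_left h v

theorem map_lam' (F : LinFun P L M) (x : P) {v w : L} (f : v ⟶ w) :
    F.map (x ⊴ₗ f) ≫ (F.lam x w).hom = (F.lam x v).hom ≫ x ⊴ₗ F.map f := F.lam_natural_right x f

theorem lam_tensor (F : LinFun P L M) (x y : P) (v : L) :
    (F.lam (x ⊗ y) v).hom ≫ (αₗ x y (F.obj v)).hom =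
      F.map (αₗ x y v).hom ≫ (F.lam x (y ⊙ₗ v)).hom ≫ x ⊴ₗ (F.lam y v).hom := F.lam_assoc x y v

theorem map_id (F : LinFun P L M) (v : L) : F.map (𝟙 v) = 𝟙 (F.obj v) := F.functor.map_id v

theorem unit_faithful (P : Type u) [Category.{v} P] [MonoidalCategory P] [MonoidalLeftAction P L] {v w : L} {f g : v ⟶ w} (h : 𝟙_ P ⊴ₗ f = 𝟙_ P ⊴ₗ g) : f = g := by
  have h1 := MonoidalLeftAction.actionUnitIso_hom_naturality (C := P) f
  have h2 := MonoidalLeftAction.actionUnitIso_hom_naturality (C := P) g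
  rw [← cancel_epi (MonoidalLeftAction.actionUnitIso (C := P) v).hom, h1, h2, h]

theorem lam_unit (F : LinFun P L M) (v : L) :
    (F.lam (𝟙_ P) v).hom ≫ (λₗ (F.obj v)).hom = F.map (λₗ v).hom := by
  refine unit_faithful P ?_
  have h := F.lam_tensor (𝟙_ P) (𝟙_ P) v
  have h1 : F.map (αₗ (𝟙_ P) (𝟙_ P) v).hom ≫ F.map (𝟙_ P ⊴ₗ (λₗ v).hom) =
      F.map ((ρ_ (𝟙_ P)).hom ⊵ₗ v) := by
    rw [← F.map_comp, MonoidalLeftAction.rightUnitor_actionHom (𝟙_ P) v]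
  have h2 := F.map_lam (ρ_ (𝟙_ P)).hom v
  have h3 := F.map_lam' (𝟙_ P) (MonoidalLeftAction.actionUnitIso (C := P) v).hom
  have h4 := MonoidalLeftAction.rightUnitor_actionHom (𝟙_ P) (F.obj v)
  rw [MonoidalLeftAction.actionHomRight_comp, ← cancel_epi (F.lam (𝟙_ P) (𝟙_ P ⊙ₗ v)).hom,
    ← cancel_epi (F.map (αₗ (𝟙_ P) (𝟙_ P) v).hom), ← h3, reassoc_of% h1, h2, h4, reassoc_of% h]

section Eval

/-- A `2`-morphism between torsors is determined by its value on one object. -/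
theorem hom_ext_of_app_eq [IsTorsor P L] {F G : LinFun P L M} (η θ : F ⟶ G) (v₀ : L)
    (h : η.app v₀ = θ.app v₀) : η = θ := by
  apply Hom.ext
  funext w
  let A := MonoidalLeftAction.actionRight (C := P) v₀
  let y := A.objPreimage w
  let e : y ⊙ₗ v₀ ≅ w := A.objObjPreimageIso w
  rw [← cancel_epi (F.map e.hom), η.naturality, θ.naturality]
  congr 1
  rw [← cancel_mono (G.lam y v₀).hom, η.lam_comp, θ.lam_comp, h]

/-- Any morphism `F v₀ ⟶ G v₀` extends to a `2`-morphism `F ⟶ G`. -/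
theorem exists_hom_app_eq [IsTorsor P L] (F G : LinFun P L M) (v₀ : L)
    (m : F.obj v₀ ⟶ G.obj v₀) : ∃ η : F ⟶ G, η.app v₀ = m := by
  let A := MonoidalLeftAction.actionRight (C := P) v₀
  let y (w : L) : P := A.objPreimage w
  let e (w : L) : y w ⊙ₗ v₀ ≅ w := A.objObjPreimageIso w
  let app (w : L) : F.obj w ⟶ G.obj w :=
    F.map (e w).inv ≫ (F.lam (y w) v₀).hom ≫ y w ⊴ₗ m ≫ (G.lam (y w) v₀).inv ≫ G.map (e w).hom
  have key : ∀ {x : P} {w : L} (f : x ⊙ₗ v₀ ⟶ w),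
      F.map f ≫ app w = (F.lam x v₀).hom ≫ x ⊴ₗ m ≫ (G.lam x v₀).inv ≫ G.map f := by
    intro x w f
    obtain ⟨k, hk⟩ := A.map_surjective (X := x) (Y := y w) (f ≫ (e w).inv)
    have hk' : k ⊵ₗ v₀ = f ≫ (e w).inv := hk
    have hf : f = k ⊵ₗ v₀ ≫ (e w).hom := by rw [hk', Category.assoc, Iso.inv_hom_id,
      Category.comp_id]
    have h1 : F.map f ≫ F.map (e w).inv = F.map (k ⊵ₗ v₀) := by
      rw [hk', map_comp]
    have h2 : (G.lam x v₀).inv ≫ G.map (k ⊵ₗ v₀) = k ⊵ₗ G.obj v₀ ≫ (G.lam (y w) v₀).inv := by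
      rw [Iso.inv_comp_eq, ← reassoc_of% G.map_lam, Iso.hom_inv_id, Category.comp_id]
    have h3 : G.map f = G.map (k ⊵ₗ v₀) ≫ G.map (e w).hom := by
      rw [← map_comp, ← hf]
    have h4 := MonoidalLeftAction.action_exchange k m
    rw [h3, reassoc_of% h2, reassoc_of% h4, ← reassoc_of% F.map_lam, ← h1]
    simp only [app, Category.assoc]
  refine ⟨⟨app, ?_, ?_⟩, ?_⟩
  · intro w w' f
    rw [← cancel_epi (F.map (e w).hom), reassoc_of% key, ← map_comp, ← reassoc_of% map_comp, key]
  · intro x w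
    have h1 := F.lam_tensor x (y w) v₀
    have h2 := G.lam_tensor x (y w) v₀
    have h3 := F.map_lam' x (e w).hom
    have h4 := G.map_lam' x (e w).hom
    have h5 : x ⊴ₗ F.map (e w).hom ≫ x ⊴ₗ app w = x ⊴ₗ ((F.lam (y w) v₀).hom ≫ y w ⊴ₗ m ≫
        (G.lam (y w) v₀).inv ≫ G.map (e w).hom) := by
      rw [← MonoidalLeftAction.actionHomRight_comp, key]
    have h6 := MonoidalLeftAction.tensor_actionHomRight x (y w) m
    have h7 : (G.lam (x ⊗ y w) v₀).inv ≫ G.map (αₗ x (y w) v₀).hom ≫ (G.lam x (y w ⊙ₗ v₀)).hom =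
        (αₗ x (y w) (G.obj v₀)).hom ≫ x ⊴ₗ (G.lam (y w) v₀).inv := by
      rw [Iso.inv_comp_eq, reassoc_of% h2, ← MonoidalLeftAction.actionHomRight_comp,
        Iso.hom_inv_id, MonoidalLeftAction.actionHomRight_id, Category.comp_id]
    rw [← cancel_epi (F.map ((αₗ x (y w) v₀).hom ≫ x ⊴ₗ (e w).hom)), reassoc_of% key]
    rw [map_comp, map_comp, Category.assoc, Category.assoc, h4, reassoc_of% h7, reassoc_of% h3,
      h5, h6]
    simp only [MonoidalLeftAction.actionHomRight_comp, Category.assoc]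
    rw [Iso.inv_hom_id_assoc, reassoc_of% h1]
  · have h := key (x := 𝟙_ P) (λₗ v₀).hom
    have h1 : (G.lam (𝟙_ P) v₀).inv ≫ G.map (λₗ v₀).hom = (λₗ (G.obj v₀)).hom := by
      rw [Iso.inv_comp_eq, lam_unit]
    have h2 := MonoidalLeftAction.actionUnitIso_hom_naturality (C := P) m
    rw [h1, ← h2, reassoc_of% lam_unit] at h
    change app v₀ = m
    exact (cancel_epi (F.map (λₗ v₀).hom)).1 h

end Eval

section Translation

variable [SymmetricCategory P]

variable (P L) in
/-- The functor `Z : P ⥤ Hom_P(L, L)`, `z ↦ z + id`. -/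
def Z : P ⥤ LinFun P L L where
  obj z :=
    { functor := MonoidalLeftAction.actionLeft L z
      lam := fun x v => actSwap z x v
      lam_natural_left := fun h v => actSwap_natural_right z h v
      lam_natural_right := fun x _ _ f => actSwap_natural z x f
      lam_assoc := fun x y v => actSwap_tensor_right z x y v }
  map f :=
    { app := fun v => f ⊵ₗ v
      naturality := fun g => MonoidalLeftAction.action_exchange f g
      lam_comp := fun x v => actSwap_natural_left f x v }
  map_id z := Hom.ext (by funext v; exact MonoidalLeftAction.id_actionHomLeft z v)
  map_comp f g := Hom.ext (by funext v; exact MonoidalLeftAction.comp_actionHomLeft f g v)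

instance Z_isEquivalence [hL : IsTorsor P L] : (Z P L).IsEquivalence := by
  obtain ⟨v⟩ := hL.nonempty
  let A := MonoidalLeftAction.actionRight (C := P) v
  exact
    { faithful := ⟨fun {x y} f g e => A.map_injective (congrArg (fun η => Hom.app η v) e)⟩
      full := ⟨fun {x y} η => by
        obtain ⟨k, hk⟩ := A.map_surjective (X := x) (Y := y) (η.app v)
        exact ⟨k, hom_ext_of_app_eq _ _ v hk⟩⟩
      essSurj := ⟨fun F => by
        let z := A.objPreimage (F.obj v)
        let e : z ⊙ₗ v ≅ F.obj v := A.objObjPreimageIso (F.obj v)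
        obtain ⟨η, hη⟩ := exists_hom_app_eq ((Z P L).obj z) F v e.hom
        obtain ⟨θ, hθ⟩ := exists_hom_app_eq F ((Z P L).obj z) v e.inv
        refine ⟨z, ⟨⟨η, θ, hom_ext_of_app_eq _ _ v ?_, hom_ext_of_app_eq _ _ v ?_⟩⟩⟩
        · change η.app v ≫ θ.app v = 𝟙 _
          rw [hη, hθ]; exact e.hom_inv_id
        · change θ.app v ≫ η.app v = 𝟙 _
          rw [hη, hθ]; exact e.inv_hom_id⟩ }

end Translation

section Inverse

variable [IsTorsor P L] [IsTorsor P M]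

/-- The chosen quasi-inverse functor. -/
noncomputable def invFunctor (F : LinFun P L M) : M ⥤ L :=
  letI := F.isEquivalence
  F.functor.inv

/-- The counit `F (F⁻¹ m) ≅ m`. -/
noncomputable def counit (F : LinFun P L M) (m : M) : F.obj (F.invFunctor.obj m) ≅ m :=
  letI := F.isEquivalence
  F.functor.asEquivalence.counitIso.app m

theorem counit_natural (F : LinFun P L M) {m n : M} (f : m ⟶ n) :
    F.map (F.invFunctor.map f) ≫ (F.counit n).hom = (F.counit m).hom ≫ f :=
  letI := F.isEquivalence
  F.functor.asEquivalence.counitIso.hom.naturality f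

theorem map_injective (F : LinFun P L M) {v w : L} {f g : v ⟶ w} (h : F.map f = F.map g) :
    f = g :=
  have := F.isEquivalence
  F.functor.map_injective h

/-- The constraint of the quasi-inverse. -/
noncomputable def inverseLam (F : LinFun P L M) (x : P) (m : M) :
    F.invFunctor.obj (x ⊙ₗ m) ≅ x ⊙ₗ F.invFunctor.obj m :=
  letI := F.isEquivalence
  F.functor.preimageIso
    (F.counit (x ⊙ₗ m) ≪≫ (MonoidalLeftAction.actionLeft M x).mapIso (F.counit m).symm ≪≫
      (F.lam x (F.invFunctor.obj m)).symm)

theorem map_inverseLam (F : LinFun P L M) (x : P) (m : M) :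
    F.map (F.inverseLam x m).hom ≫ (F.lam x (F.invFunctor.obj m)).hom ≫ x ⊴ₗ (F.counit m).hom =
      (F.counit (x ⊙ₗ m)).hom := by
  have := F.isEquivalence
  have h : F.map (F.inverseLam x m).hom = (F.counit (x ⊙ₗ m)).hom ≫ x ⊴ₗ (F.counit m).inv ≫
      (F.lam x (F.invFunctor.obj m)).inv := F.functor.map_preimage _
  rw [h, Category.assoc, Category.assoc, Iso.inv_hom_id_assoc,
    ← MonoidalLeftAction.actionHomRight_comp, Iso.inv_hom_id,
    MonoidalLeftAction.actionHomRight_id, Category.comp_id]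

theorem inverse_ext (F : LinFun P L M) {v : L} {x : P} {m : M}
    {f g : v ⟶ x ⊙ₗ F.invFunctor.obj m}
    (h : F.map f ≫ (F.lam x (F.invFunctor.obj m)).hom ≫ x ⊴ₗ (F.counit m).hom =
      F.map g ≫ (F.lam x (F.invFunctor.obj m)).hom ≫ x ⊴ₗ (F.counit m).hom) : f = g := by
  apply F.map_injective
  have : x ⊴ₗ (F.counit m).hom ≫ x ⊴ₗ (F.counit m).inv = 𝟙 _ := by
    rw [← MonoidalLeftAction.actionHomRight_comp, Iso.hom_inv_id,
      MonoidalLeftAction.actionHomRight_id]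
  have h' := congrArg (fun k => k ≫ x ⊴ₗ (F.counit m).inv ≫
    (F.lam x (F.invFunctor.obj m)).inv) h
  simpa [reassoc_of% this] using h'

/-- The chosen quasi-inverse of a `1`-morphism of torsors. -/
noncomputable def inverse (F : LinFun P L M) : LinFun P M L where
  functor := F.invFunctor
  lam := F.inverseLam
  lam_natural_left {x y} h m := by
    apply F.inverse_ext
    have h1 := F.map_lam h (F.invFunctor.obj m)
    have h2 := MonoidalLeftAction.action_exchange h (F.counit m).hom
    have h3 := F.counit_natural (h ⊵ₗ m)
    rw [map_comp, map_comp, Category.assoc, Category.assoc, map_inverseLam, reassoc_of% h1, ← h2,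
      reassoc_of% map_inverseLam, h3]
  lam_natural_right x m n f := by
    apply F.inverse_ext
    have h1 := F.map_lam' x (F.invFunctor.map f)
    have h3 := F.counit_natural (x ⊴ₗ f)
    rw [map_comp, map_comp, Category.assoc, Category.assoc, map_inverseLam, reassoc_of% h1,
      ← MonoidalLeftAction.actionHomRight_comp, F.counit_natural f,
      MonoidalLeftAction.actionHomRight_comp, reassoc_of% map_inverseLam, h3]
  lam_assoc x y m := by
    have a1 := MonoidalLeftAction.tensor_actionHomRight x y (F.counit m).hom
    have a2 := F.lam_tensor x y (F.invFunctor.obj m)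
    have a3 := F.map_lam' x (F.inverseLam y m).hom
    have a4 := F.counit_natural (αₗ x y m).hom
    have a5 : F.map (F.inverseLam (x ⊗ y) m).hom ≫
        (F.lam (x ⊗ y) (F.invFunctor.obj m)).hom ≫ (αₗ x y _).hom ≫ x ⊴ₗ y ⊴ₗ (F.counit m).hom =
        (F.counit ((x ⊗ y) ⊙ₗ m)).hom ≫ (αₗ x y m).hom := by
      rw [← map_inverseLam F (x ⊗ y) m, a1]
      simp only [Category.assoc, Iso.inv_hom_id, Category.comp_id]
    have a6 : F.map (F.inverseLam x (y ⊙ₗ m)).hom ≫ (F.lam x (F.invFunctor.obj (y ⊙ₗ m))).hom ≫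
        x ⊴ₗ F.map (F.inverseLam y m).hom ≫ x ⊴ₗ (F.lam y (F.invFunctor.obj m)).hom ≫
        x ⊴ₗ y ⊴ₗ (F.counit m).hom = (F.counit (x ⊙ₗ y ⊙ₗ m)).hom := by
      rw [← MonoidalLeftAction.actionHomRight_comp, ← MonoidalLeftAction.actionHomRight_comp,
        map_inverseLam, map_inverseLam]
    have a7 : F.map ((F.inverseLam (x ⊗ y) m).hom ≫ (αₗ x y (F.invFunctor.obj m)).hom) =
        F.map (F.invFunctor.map (αₗ x y m).hom ≫ (F.inverseLam x (y ⊙ₗ m)).hom ≫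
          x ⊴ₗ (F.inverseLam y m).hom) := by
      rw [← cancel_mono (F.lam x (y ⊙ₗ F.invFunctor.obj m)).hom,
        ← cancel_mono (x ⊴ₗ (F.lam y (F.invFunctor.obj m)).hom)]
      have : IsIso (x ⊴ₗ y ⊴ₗ (F.counit m).hom) :=
        ((MonoidalLeftAction.actionLeft M x).mapIso
          ((MonoidalLeftAction.actionLeft M y).mapIso (F.counit m))).isIso_hom
      rw [← cancel_mono (x ⊴ₗ y ⊴ₗ (F.counit m).hom)]
      simp only [map_comp, Category.assoc]
      rw [← reassoc_of% a2, a5, reassoc_of% a3, a6, a4]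
    exact F.map_injective a7

end Inverse
end LinFun

end Linear
end PicExt

namespace PicExt

open scoped MonoidalLeftAction

section Sums

variable {P : Type u} [Category.{v} P] [MonoidalCategory P] [SymmetricCategory P]
  [IsPicardGroupoid P]
variable {L M N K D : Type u} [Category.{max u v} L] [Category.{max u v} M]
  [Category.{max u v} N] [Category.{max u v} K] [Category.{max u v} D]
  [MonoidalLeftAction P L] [MonoidalLeftAction P M] [MonoidalLeftAction P N]
  [MonoidalLeftAction P K] [MonoidalLeftAction P D]
  [IsGroupoid L] [IsGroupoid M] [IsGroupoid N] [IsGroupoid K] [IsGroupoid D]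

namespace TSum

theorem Balanced.map_inl (B : Balanced P L M D) {v v' : L} (f : v ⟶ v') (w : M) :
    B.map (inl f w) = B.mapL f w := lift_map_inl B f w

theorem Balanced.map_inr (B : Balanced P L M D) (v : L) {w w' : M} (g : w ⟶ w') :
    B.map (inr v g) = B.mapR v g := lift_map_inr B v g

theorem Balanced.map_move (B : Balanced P L M D) (x : P) (v : L) (w : M) :
    B.map (move x v w) = B.bal x v w := lift_map_move B x v w

/-- Isomorphisms making the functor induced by a balanced bifunctor into a `1`-morphism. -/
structure Balanced.Lam (B : Balanced P L M D) where
  lam (z : P) (v : L) (w : M) : B.obj (z ⊙ₗ v) w ≅ z ⊙ₗ B.obj v w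
  natural : ∀ {z z' : P} (h : z ⟶ z') (v : L) (w : M),
    B.mapL (h ⊵ₗ v) w ≫ (lam z' v w).hom = (lam z v w).hom ≫ h ⊵ₗ B.obj v w
  left : ∀ (z : P) {v v' : L} (f : v ⟶ v') (w : M),
    B.mapL (z ⊴ₗ f) w ≫ (lam z v' w).hom = (lam z v w).hom ≫ z ⊴ₗ B.mapL f w
  right : ∀ (z : P) (v : L) {w w' : M} (g : w ⟶ w'),
    B.mapR (z ⊙ₗ v) g ≫ (lam z v w').hom = (lam z v w).hom ≫ z ⊴ₗ B.mapR v g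
  swap : ∀ (z x : P) (v : L) (w : M),
    B.mapL (actSwap z x v).hom w ≫ B.bal x (z ⊙ₗ v) w ≫ (lam z v (x ⊙ₗ w)).hom =
      (lam z (x ⊙ₗ v) w).hom ≫ z ⊴ₗ B.bal x v w
  tensor : ∀ (z z' : P) (v : L) (w : M),
    (lam (z ⊗ z') v w).hom ≫ (αₗ z z' (B.obj v w)).hom =
      B.mapL (αₗ z z' v).hom w ≫ (lam z (z' ⊙ₗ v) w).hom ≫ z ⊴ₗ (lam z' v w).hom

theorem Balanced.Lam.map_actR {B : Balanced P L M D} (Λ : B.Lam) (z : P) {a b : TSum P L M}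
    (m : a ⟶ b) : B.map (actR z m) ≫ (Λ.lam z b.fst b.snd).hom =
      (Λ.lam z a.fst a.snd).hom ≫ z ⊴ₗ B.map m := by
  induction m using hom_induction with
  | comp m n hm hn =>
    rw [actR_comp, B.map_comp, B.map_comp, Category.assoc, hn, reassoc_of% hm,
      MonoidalLeftAction.actionHomRight_comp]
  | inl f w =>
    rw [actR_inl, B.map_inl, B.map_inl]
    exact Λ.left z f w
  | inr v f =>
    rw [actR_inr, B.map_inr, B.map_inr]
    exact Λ.right z v f
  | move x v w =>
    rw [actR_move, B.map_comp, B.map_inl, B.map_move, B.map_move, Category.assoc]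
    exact Λ.swap z x v w

/-- The `1`-morphism on `L + M` induced by a balanced bifunctor. -/
def liftLin (B : Balanced P L M D) (Λ : B.Lam) : LinFun P (TSum P L M) D where
  functor := lift B
  lam z a := Λ.lam z a.fst a.snd
  lam_natural_left h a := by
    change (lift B).map (inl (h ⊵ₗ a.fst) a.snd) ≫ _ = _
    rw [lift_map_inl]
    exact Λ.natural h a.fst a.snd
  lam_natural_right z _ _ m := Λ.map_actR z m
  lam_assoc z z' a := by
    change (Λ.lam (z ⊗ z') a.fst a.snd).hom ≫ _ = (lift B).map (inl (αₗ z z' a.fst).hom a.snd) ≫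
      (Λ.lam z (z' ⊙ₗ a.fst) a.snd).hom ≫ _
    rw [lift_map_inl]
    exact Λ.tensor z z' a.fst a.snd

theorem move_tensor' (x y : P) (v : L) (w : M) :
    move (x ⊗ y) v w = inl ((β_ x y).hom ⊵ₗ v ≫ (αₗ y x v).hom) w ≫ move y (x ⊙ₗ v) w ≫
      move x v (y ⊙ₗ w) ≫ inr v (αₗ x y w).inv := by
  have h := move_natural (β_ x y).hom v w
  have h1 : (inr v ((β_ x y).hom ⊵ₗ w) : (⟨v, (x ⊗ y) ⊙ₗ w⟩ : TSum P L M) ⟶ _) ≫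
      inr v ((β_ y x).hom ⊵ₗ w) = 𝟙 _ := by
    rw [inr_comp, ← MonoidalLeftAction.comp_actionHomLeft, SymmetricCategory.symmetry,
      MonoidalLeftAction.id_actionHomLeft, inr_id]
  rw [← Category.comp_id (move (x ⊗ y) v w), ← h1, ← reassoc_of% h, move_tensor y x]
  simp only [Category.assoc]
  rw [inl_comp', inr_comp, Category.assoc, ← MonoidalLeftAction.comp_actionHomLeft,
    SymmetricCategory.symmetry, MonoidalLeftAction.id_actionHomLeft, Category.comp_id]

theorem move_move (z x : P) (v : L) (w : M) :
    inl (actSwap z x v).hom w ≫ move x (z ⊙ₗ v) w ≫ move z v (x ⊙ₗ w) ≫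
      inr v (actSwap z x w).hom = move z (x ⊙ₗ v) w ≫ move x v (z ⊙ₗ w) := by
  have h := (move_tensor z x v w).symm.trans (move_tensor' z x v w)
  have h2 := congrArg (fun m => inl (αₗ z x v).inv w ≫ m ≫
    inr v ((β_ z x).hom ⊵ₗ w ≫ (αₗ x z w).hom)) h
  simp only [Category.assoc] at h2
  rw [inl_comp', inl_comp', Iso.inv_hom_id, inl_id, Category.id_comp, inr_comp, inr_comp] at h2
  have h3 : ((αₗ x z w).inv ≫ (β_ x z).hom ⊵ₗ w) ≫ (β_ z x).hom ⊵ₗ w ≫ (αₗ x z w).hom = 𝟙 _ := by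
    rw [Category.assoc, ← MonoidalLeftAction.comp_actionHomLeft_assoc, SymmetricCategory.symmetry,
      MonoidalLeftAction.id_actionHomLeft, Category.id_comp, Iso.inv_hom_id]
  rw [h3, inr_id, Category.comp_id] at h2
  rw [h2]
  rfl

theorem actSwap_inl (z x : P) (a : TSum P L M) :
    (actSwap z x a).hom = inl (actSwap z x a.fst).hom a.snd := by
  change inl (αₗ z x a.fst).inv a.snd ≫ inl ((β_ z x).hom ⊵ₗ a.fst) a.snd ≫
    inl (αₗ x z a.fst).hom a.snd = _
  rw [inl_comp, inl_comp]
  rfl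

end TSum

open TSum

/-- The balanced bifunctor `(v, w) ↦ (F v, G w)`. -/
def sumBalanced (F : LinFun P L N) (G : LinFun P M K) : Balanced P L M (TSum P N K) where
  obj v w := ⟨F.obj v, G.obj w⟩
  mapL f w := inl (F.map f) (G.obj w)
  mapR v _ _ g := inr (F.obj v) (G.map g)
  bal x v w := inl (F.lam x v).hom (G.obj w) ≫ move x (F.obj v) (G.obj w) ≫
    inr (F.obj v) (G.lam x w).inv
  mapL_id v w := by rw [F.map_id, inl_id]
  mapR_id v w := by rw [G.map_id, inr_id]
  mapL_comp f g w := by rw [F.map_comp, inl_comp]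
  mapR_comp v _ _ _ f g := by rw [G.map_comp, inr_comp]
  comm f _ _ g := inl_inr _ _
  bal_natural {x y} h v w := by
    have h1 := F.map_lam h v
    have h2 : (G.lam x w).inv ≫ G.map (h ⊵ₗ w) = h ⊵ₗ G.obj w ≫ (G.lam y w).inv := by
      rw [Iso.inv_comp_eq, ← reassoc_of% G.map_lam, Iso.hom_inv_id, Category.comp_id]
    have h3 := move_natural h (F.obj v) (G.obj w)
    simp only [Category.assoc]
    rw [inl_comp', h1, inr_comp, h2, ← inl_comp, ← inr_comp, Category.assoc, reassoc_of% h3]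
  bal_left x v v' f w := by
    have h1 := F.map_lam' x f
    have h3 := move_left x (F.map f) (G.obj w)
    simp only [Category.assoc]
    rw [← inl_inr, inl_comp', h1, ← inl_comp, Category.assoc, reassoc_of% h3]
  bal_right x v w w' g := by
    have h1 := G.map_lam' x g
    have h2 : (G.lam x w).inv ≫ G.map (x ⊴ₗ g) = x ⊴ₗ G.map g ≫ (G.lam x w').inv := by
      rw [Iso.inv_comp_eq, ← reassoc_of% h1, Iso.hom_inv_id, Category.comp_id]
    have h3 := move_right x (F.obj v) (G.map g)
    simp only [Category.assoc]
    rw [inr_comp, h2, ← reassoc_of% inl_inr, ← inr_comp, reassoc_of% h3]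
  bal_tensor x y v w := by
    have h1 := F.lam_tensor x y v
    have h2 : (αₗ y x (G.obj w)).inv ≫ (β_ y x).hom ⊵ₗ G.obj w ≫ (G.lam (x ⊗ y) w).inv =
        y ⊴ₗ (G.lam x w).inv ≫ (G.lam y (x ⊙ₗ w)).inv ≫ G.map ((αₗ y x w).inv ≫
          (β_ y x).hom ⊵ₗ w) := by
      have h3 := G.lam_tensor y x w
      have h4 := G.map_lam (β_ y x).hom w
      have h5 : y ⊴ₗ (G.lam x w).hom ≫ y ⊴ₗ (G.lam x w).inv = 𝟙 _ := by
        rw [← MonoidalLeftAction.actionHomRight_comp, Iso.hom_inv_id,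
          MonoidalLeftAction.actionHomRight_id]
      rw [← cancel_epi (αₗ y x (G.obj w)).hom, ← cancel_epi (G.lam (y ⊗ x) w).hom,
        ← cancel_mono (G.lam (x ⊗ y) w).hom]
      simp only [Category.assoc, Iso.hom_inv_id_assoc, Iso.inv_hom_id, Category.comp_id]
      have h6 : G.map (αₗ y x w).hom ≫ G.map ((αₗ y x w).inv ≫ (β_ y x).hom ⊵ₗ w) =
          G.map ((β_ y x).hom ⊵ₗ w) := by rw [← G.map_comp, Iso.hom_inv_id_assoc]
      rw [reassoc_of% h3, reassoc_of% h5, Iso.hom_inv_id_assoc, reassoc_of% h6, h4]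
    have h3 := move_right y (F.obj v) (G.lam x w).inv
    have h4 := move_left x (F.lam y v).hom (G.obj w)
    rw [move_tensor]
    simp only [Category.assoc]
    rw [inl_comp', h1, inr_comp, inr_comp, Category.assoc, h2, ← reassoc_of% inl_inr,
      reassoc_of% h3, ← reassoc_of% h4, inl_comp', inl_comp']
    simp only [Category.assoc]
    rw [inr_comp]

/-- The sum `F + G` of two `1`-morphisms. -/
def LinFun.sum (F : LinFun P L N) (G : LinFun P M K) :
    LinFun P (TSum P L M) (TSum P N K) :=
  liftLin (sumBalanced F G)
    { lam := fun z v w => (inlIso (F.lam z v) (G.obj w) :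
        (⟨F.obj (z ⊙ₗ v), G.obj w⟩ : TSum P N K) ≅ ⟨z ⊙ₗ F.obj v, G.obj w⟩)
      natural := fun {z z'} h v w => by
        change inl (F.map (h ⊵ₗ v)) (G.obj w) ≫ inl (F.lam z' v).hom (G.obj w) =
          inl (F.lam z v).hom (G.obj w) ≫ inl (h ⊵ₗ F.obj v) (G.obj w)
        rw [inl_comp, inl_comp, F.map_lam]
      left := fun z v v' f w => by
        change inl (F.map (z ⊴ₗ f)) (G.obj w) ≫ inl (F.lam z v').hom (G.obj w) =
          inl (F.lam z v).hom (G.obj w) ≫ actR z (inl (F.map f) (G.obj w))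
        rw [actR_inl, inl_comp, inl_comp, F.map_lam']
      right := fun z v w w' g => by
        change inr (F.obj (z ⊙ₗ v)) (G.map g) ≫ inl (F.lam z v).hom (G.obj w') =
          inl (F.lam z v).hom (G.obj w) ≫ actR z (inr (F.obj v) (G.map g))
        rw [actR_inr, inl_inr]
      swap := fun z x v w => by
        change inl (F.map (actSwap z x v).hom) (G.obj w) ≫ (inl (F.lam x (z ⊙ₗ v)).hom (G.obj w) ≫
          move x (F.obj (z ⊙ₗ v)) (G.obj w) ≫ inr (F.obj (z ⊙ₗ v)) (G.lam x w).inv) ≫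
            inl (F.lam z v).hom (G.obj (x ⊙ₗ w)) =
          inl (F.lam z (x ⊙ₗ v)).hom (G.obj w) ≫ actR z (inl (F.lam x v).hom (G.obj w) ≫
            move x (F.obj v) (G.obj w) ≫ inr (F.obj v) (G.lam x w).inv)
        have h := move_left x (F.lam z v).hom (G.obj w)
        have h2 : F.map (actSwap z x v).hom ≫ (F.lam x (z ⊙ₗ v)).hom ≫ x ⊴ₗ (F.lam z v).hom =
            (F.lam z (x ⊙ₗ v)).hom ≫ z ⊴ₗ (F.lam x v).hom ≫ (actSwap z x (F.obj v)).hom := by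
          have a1 := F.lam_tensor z x v
          have a2 := F.lam_tensor x z v
          have a3 := F.map_lam (β_ z x).hom v
          have a4 : F.map (αₗ z x v).hom ≫ F.map (actSwap z x v).hom =
              F.map ((β_ z x).hom ⊵ₗ v) ≫ F.map (αₗ x z v).hom := by
            rw [← F.map_comp, ← F.map_comp, actSwap_hom, Iso.hom_inv_id_assoc]
          rw [← cancel_epi (F.map (αₗ z x v).hom), reassoc_of% a4, ← a2, reassoc_of% a3,
            ← reassoc_of% a1, actSwap_hom, Iso.hom_inv_id_assoc]
        simp only [actR_comp, actR_inl, actR_move, actR_inr, Category.assoc]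
        rw [← inl_inr, ← reassoc_of% h, inl_comp', inl_comp', inl_comp', inl_comp']
        simp only [Category.assoc]
        rw [h2]
      tensor := fun z z' v w => by
        change inl (F.lam (z ⊗ z') v).hom (G.obj w) ≫ inl (αₗ z z' (F.obj v)).hom (G.obj w) =
          inl (F.map (αₗ z z' v).hom) (G.obj w) ≫ inl (F.lam z (z' ⊙ₗ v)).hom (G.obj w) ≫
            actR z (inl (F.lam z' v).hom (G.obj w))
        rw [actR_inl, inl_comp, inl_comp, inl_comp, F.lam_tensor] }

/-- The balanced bifunctor `(v, w) ↦ (w, v)`. It sends the isomorphism `(x + v, w) ≅ (v, x + w)` to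
the inverse of the isomorphism `(x + w, v) ≅ (w, x + v)`. -/
noncomputable def commBalanced : Balanced P L M (TSum P M L) where
  obj v w := ⟨w, v⟩
  mapL f w := inr w f
  mapR v _ _ g := inl g v
  bal x v w := CategoryTheory.inv (move x w v)
  mapL_id v w := inr_id _ _
  mapR_id v w := inl_id _ _
  mapL_comp f g w := (inr_comp _ _ _).symm
  mapR_comp v _ _ _ f g := (inl_comp _ _ _).symm
  comm f _ _ g := (inl_inr _ _).symm
  bal_natural {x y} h v w := by
    rw [IsIso.eq_inv_comp, ← reassoc_of% move_natural, IsIso.hom_inv_id, Category.comp_id]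
  bal_left x v v' f w := by
    rw [IsIso.eq_inv_comp, ← reassoc_of% move_right, IsIso.hom_inv_id, Category.comp_id]
  bal_right x v w w' g := by
    rw [IsIso.eq_inv_comp, ← reassoc_of% move_left, IsIso.hom_inv_id, Category.comp_id]
  bal_tensor x y v w := by
    have h := move_tensor' x y w v
    rw [← cancel_epi (move (x ⊗ y) w v), IsIso.hom_inv_id, h]
    simp only [Category.assoc]
    have h1 : (inr w (αₗ x y v).inv : (⟨w, x ⊙ₗ y ⊙ₗ v⟩ : TSum P M L) ⟶ _) ≫
        inr w (αₗ x y v).hom = 𝟙 _ := by rw [inr_comp, Iso.inv_hom_id, inr_id]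
    rw [reassoc_of% h1, IsIso.hom_inv_id_assoc, IsIso.hom_inv_id_assoc, inl_comp, Category.assoc,
      Iso.hom_inv_id_assoc, ← MonoidalLeftAction.comp_actionHomLeft, SymmetricCategory.symmetry,
      MonoidalLeftAction.id_actionHomLeft, inl_id]

/-- The commutativity constraint `L + M → M + L`, `(v, w) ↦ (w, v)`. -/
noncomputable def sumComm : LinFun P (TSum P L M) (TSum P M L) :=
  liftLin commBalanced
    { lam := fun z v w => ((asIso (move z w v : (⟨z ⊙ₗ w, v⟩ : TSum P M L) ⟶ _)).symm :
        (⟨w, z ⊙ₗ v⟩ : TSum P M L) ≅ ⟨z ⊙ₗ w, v⟩)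
      natural := fun {z z'} h v w => by
        change inr w (h ⊵ₗ v) ≫ CategoryTheory.inv (move z' w v) =
          CategoryTheory.inv (move z w v) ≫ inl (h ⊵ₗ w) v
        rw [IsIso.eq_inv_comp, ← reassoc_of% move_natural, IsIso.hom_inv_id, Category.comp_id]
      left := fun z v v' f w => by
        change inr w (z ⊴ₗ f) ≫ CategoryTheory.inv (move z w v') =
          CategoryTheory.inv (move z w v) ≫ actR z (inr w f)
        rw [actR_inr, IsIso.eq_inv_comp, ← reassoc_of% move_right, IsIso.hom_inv_id,
          Category.comp_id]
      right := fun z v w w' g => by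
        change inl g (z ⊙ₗ v) ≫ CategoryTheory.inv (move z w' v) =
          CategoryTheory.inv (move z w v) ≫ actR z (inl g v)
        rw [actR_inl, IsIso.eq_inv_comp, ← reassoc_of% move_left, IsIso.hom_inv_id,
          Category.comp_id]
      swap := fun z x v w => by
        change inr w (actSwap z x v).hom ≫ CategoryTheory.inv (move x w (z ⊙ₗ v)) ≫
            CategoryTheory.inv (move z (x ⊙ₗ w) v) =
          CategoryTheory.inv (move z w (x ⊙ₗ v)) ≫ actR z (CategoryTheory.inv (move x w v))
        have h : actR z (move x w v) ≫ actR z (CategoryTheory.inv (move x w v)) = 𝟙 _ := by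
          rw [← actR_comp, IsIso.hom_inv_id, actR_id]
        have h2 := move_move z x w v
        rw [actR_move, Category.assoc] at h
        rw [← cancel_epi (move z w (x ⊙ₗ v)), IsIso.hom_inv_id_assoc,
          ← cancel_epi (move x (z ⊙ₗ w) v), ← cancel_epi (inl (actSwap z x w).hom v), h,
          reassoc_of% h2, IsIso.hom_inv_id_assoc, IsIso.hom_inv_id]
      tensor := fun z z' v w => by
        change CategoryTheory.inv (move (z ⊗ z') w v) ≫ inl (αₗ z z' w).hom v =
          inr w (αₗ z z' v).hom ≫ CategoryTheory.inv (move z w (z' ⊙ₗ v)) ≫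
            actR z (CategoryTheory.inv (move z' w v))
        have h : actR z (move z' w v) ≫ actR z (CategoryTheory.inv (move z' w v)) = 𝟙 _ := by
          rw [← actR_comp, IsIso.hom_inv_id, actR_id]
        have h1 : (inr w (αₗ z z' v).inv : (⟨w, z ⊙ₗ z' ⊙ₗ v⟩ : TSum P M L) ⟶ _) ≫
            inr w (αₗ z z' v).hom = 𝟙 _ := by rw [inr_comp, Iso.inv_hom_id, inr_id]
        have h2 : (inl (αₗ z z' w).hom v : (⟨(z ⊗ z') ⊙ₗ w, v⟩ : TSum P M L) ⟶ _) ≫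
            inl (actSwap z z' w).hom v = inl ((β_ z z').hom ⊵ₗ w ≫ (αₗ z' z w).hom) v := by
          rw [inl_comp, actSwap_hom, Iso.hom_inv_id_assoc]
        rw [actR_move, Category.assoc] at h
        rw [IsIso.inv_comp_eq, move_tensor']
        simp only [Category.assoc]
        rw [reassoc_of% h1, IsIso.hom_inv_id_assoc, ← h2, Category.assoc, h, Category.comp_id] }

/-- The functor `(v₁, v₂) ↦ (v₁, (v₂, w))`, as a balanced bifunctor. -/
def assocBalancedLeft (w : N) : Balanced P L M (TSum P L (TSum P M N)) where
  obj v₁ v₂ := ⟨v₁, ⟨v₂, w⟩⟩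
  mapL {v₁ v₁'} f v₂ := (inl f (⟨v₂, w⟩ : TSum P M N) :
    (⟨v₁, ⟨v₂, w⟩⟩ : TSum P L (TSum P M N)) ⟶ ⟨v₁', ⟨v₂, w⟩⟩)
  mapR v₁ _ _ g := inr v₁ (inl g w)
  bal x v₁ v₂ := (move x v₁ (⟨v₂, w⟩ : TSum P M N))
  mapL_id _ _ := inl_id _ _
  mapR_id _ _ := by rw [inl_id, inr_id]
  mapL_comp _ _ _ := (inl_comp _ _ _).symm
  mapR_comp _ _ _ _ _ _ := by rw [inr_comp, inl_comp]
  comm _ _ _ _ := inl_inr _ _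
  bal_natural h v₁ v₂ := move_natural h v₁ (⟨v₂, w⟩ : TSum P M N)
  bal_left x _ _ f v₂ := move_left x f (⟨v₂, w⟩ : TSum P M N)
  bal_right x v₁ v₂ v₂' g := by
    have h := move_right x v₁ (inl g w : (⟨v₂, w⟩ : TSum P M N) ⟶ _)
    have h2 : x ⊴ₗ (inl g w : (⟨v₂, w⟩ : TSum P M N) ⟶ _) = inl (x ⊴ₗ g) w := actR_inl x g w
    rw [h2] at h
    exact h
  bal_tensor x y v₁ v₂ := by
    have h := move_tensor x y v₁ (⟨v₂, w⟩ : TSum P M N)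
    have h2 : (αₗ y x (⟨v₂, w⟩ : TSum P M N)).inv ≫ (β_ y x).hom ⊵ₗ (⟨v₂, w⟩ : TSum P M N) =
      inl ((αₗ y x v₂).inv ≫ (β_ y x).hom ⊵ₗ v₂) w := inl_comp _ _ _
    rw [h2] at h
    exact h

/-- The functor `(v₁, v₂) ↦ (v₁, (v₂, w))` on morphisms. -/
def assocMap {a b : TSum P L M} (m : a ⟶ b) (w : N) :
    (⟨a.fst, ⟨a.snd, w⟩⟩ : TSum P L (TSum P M N)) ⟶ ⟨b.fst, ⟨b.snd, w⟩⟩ :=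
  (assocBalancedLeft w).map m

theorem assocMap_id (a : TSum P L M) (w : N) :
    assocMap (𝟙 a) w = 𝟙 (⟨a.fst, ⟨a.snd, w⟩⟩ : TSum P L (TSum P M N)) :=
  Balanced.map_id _ _

theorem assocMap_comp {a b c : TSum P L M} (m : a ⟶ b) (n : b ⟶ c) (w : N) :
    assocMap (m ≫ n) w = assocMap m w ≫ assocMap n w := Balanced.map_comp _ _ _

theorem assocMap_inl {v v' : L} (f : v ⟶ v') (v₂ : M) (w : N) :
    assocMap (inl f v₂) w = inl f (⟨v₂, w⟩ : TSum P M N) :=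
  Balanced.map_inl (assocBalancedLeft w) f v₂

theorem assocMap_inr (v : L) {v₂ v₂' : M} (g : v₂ ⟶ v₂') (w : N) :
    assocMap (inr v g) w = inr v (inl g w : (⟨v₂, w⟩ : TSum P M N) ⟶ _) :=
  Balanced.map_inr (assocBalancedLeft w) v g

/-- The canonical isomorphism `(x + v, (v₂, w)) ≅ (v, (x + v₂, w))`. -/
def moveIn (x : P) (v : L) (a : TSum P M N) :
    (⟨x ⊙ₗ v, a⟩ : TSum P L (TSum P M N)) ⟶ ⟨v, ⟨x ⊙ₗ a.fst, a.snd⟩⟩ :=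
  move x v a

theorem moveIn_natural {x y : P} (h : x ⟶ y) (v : L) (a : TSum P M N) :
    inl (h ⊵ₗ v) a ≫ moveIn y v a = moveIn x v a ≫ inr v (inl (h ⊵ₗ a.fst) a.snd) :=
  move_natural h v a

theorem moveIn_left (x : P) {v v' : L} (f : v ⟶ v') (a : TSum P M N) :
    inl (x ⊴ₗ f) a ≫ moveIn x v' a = moveIn x v a ≫
      inl f (⟨x ⊙ₗ a.fst, a.snd⟩ : TSum P M N) :=
  move_left x f a

theorem moveIn_right (x : P) (v : L) {a b : TSum P M N} (m : a ⟶ b) :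
    inr (x ⊙ₗ v) m ≫ moveIn x v b = moveIn x v a ≫ inr v (actR x m) :=
  move_right x v m

theorem actR_moveIn (z x : P) (v : L) (a : TSum P M N) :
    actR z (moveIn x v a) = inl (actSwap z x v).hom a ≫ moveIn x (z ⊙ₗ v) a :=
  actR_move z x v a

theorem moveIn_tensor (x y : P) (v : L) (a : TSum P M N) :
    moveIn (x ⊗ y) v a = inl (αₗ x y v).hom a ≫ moveIn x (y ⊙ₗ v) a ≫
      moveIn y v ⟨x ⊙ₗ a.fst, a.snd⟩ ≫
        inr v (inl ((αₗ y x a.fst).inv ≫ (β_ y x).hom ⊵ₗ a.fst) a.snd) := by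
  have h := move_tensor x y v a
  have h2 : (αₗ y x a).inv ≫ (β_ y x).hom ⊵ₗ a =
      inl ((αₗ y x a.fst).inv ≫ (β_ y x).hom ⊵ₗ a.fst) a.snd := inl_comp _ _ _
  rw [h2] at h
  exact h

theorem moveIn_moveIn (z x : P) (v : L) (a : TSum P M N) :
    inl (actSwap z x v).hom a ≫ moveIn x (z ⊙ₗ v) a ≫ moveIn z v ⟨x ⊙ₗ a.fst, a.snd⟩ ≫
      inr v (inl (actSwap z x a.fst).hom a.snd) =
      moveIn z (x ⊙ₗ v) a ≫ moveIn x v ⟨z ⊙ₗ a.fst, a.snd⟩ := by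
  have h := move_move z x v a
  rw [actSwap_inl] at h
  exact h

theorem assocMap_move (x : P) (v : L) (v₂ : M) (w : N) :
    assocMap (move x v v₂) w = moveIn x v (⟨v₂, w⟩ : TSum P M N) :=
  Balanced.map_move (assocBalancedLeft w) x v v₂

theorem actR_assocMap (x : P) {a b : TSum P L M} (m : a ⟶ b) (w : N) :
    actR x (assocMap m w) = assocMap (actR x m) w := by
  induction m using hom_induction with
  | comp m n hm hn =>
    rw [actR_comp, assocMap_comp, actR_comp, assocMap_comp, hm, hn]
  | inl f v => rw [actR_inl, assocMap_inl, assocMap_inl, actR_inl]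
  | inr v f => rw [actR_inr, assocMap_inr, assocMap_inr, actR_inr]
  | move y v v' =>
    rw [actR_move, assocMap_comp, assocMap_inl, assocMap_move, assocMap_move, actR_moveIn]

theorem assocMap_inr_inr {a b : TSum P L M} (m : a ⟶ b) {w w' : N} (g : w ⟶ w') :
    assocMap m w ≫ inr b.fst (inr b.snd g : (⟨b.snd, w⟩ : TSum P M N) ⟶ _) =
      inr a.fst (inr a.snd g : (⟨a.snd, w⟩ : TSum P M N) ⟶ _) ≫ assocMap m w' := by
  induction m using hom_induction with
  | comp m n hm hn =>
    rw [assocMap_comp, assocMap_comp, Category.assoc, hn, reassoc_of% hm]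
  | inl f v => rw [assocMap_inl, assocMap_inl, inl_inr]
  | inr v f => rw [assocMap_inr, assocMap_inr, inr_comp, inr_comp, inl_inr]
  | move y v v' =>
    rw [assocMap_move, assocMap_move]
    have h := moveIn_right y v (inr v' g : (⟨v', w⟩ : TSum P M N) ⟶ _)
    rw [actR_inr] at h
    exact h.symm

/-- The isomorphism `((x + v₁, v₂), w) ≅ ((v₁, v₂), x + w)` after reassociation. -/
def assocMove (x : P) (a : TSum P L M) (w : N) :
    (⟨x ⊙ₗ a.fst, ⟨a.snd, w⟩⟩ : TSum P L (TSum P M N)) ⟶ ⟨a.fst, ⟨a.snd, x ⊙ₗ w⟩⟩ :=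
  moveIn x a.fst (⟨a.snd, w⟩ : TSum P M N) ≫ inr a.fst (move x a.snd w)

theorem assocMove_natural {x y : P} (h : x ⟶ y) (a : TSum P L M) (w : N) :
    inl (h ⊵ₗ a.fst) (⟨a.snd, w⟩ : TSum P M N) ≫ assocMove y a w =
      assocMove x a w ≫ inr a.fst (inr a.snd (h ⊵ₗ w) : (⟨a.snd, x ⊙ₗ w⟩ : TSum P M N) ⟶ _) := by
  rw [assocMove, assocMove, reassoc_of% moveIn_natural, inr_comp, move_natural, Category.assoc,
    inr_comp]

theorem assocMove_left (x : P) {a b : TSum P L M} (m : a ⟶ b) (w : N) :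
    assocMap (actR x m) w ≫ assocMove x b w = assocMove x a w ≫ assocMap m (x ⊙ₗ w) := by
  induction m using hom_induction with
  | comp m n hm hn =>
    rw [actR_comp, assocMap_comp, assocMap_comp, Category.assoc, hn, reassoc_of% hm]
  | inl f v =>
    rw [actR_inl, assocMap_inl, assocMap_inl, assocMove, assocMove, Category.assoc, ← inl_inr,
      reassoc_of% moveIn_left]
  | @inr v v₂ v₂' f =>
    have h1 := moveIn_right x v (inl f w : (⟨v₂, w⟩ : TSum P M N) ⟶ _)
    rw [actR_inl] at h1
    rw [actR_inr, assocMap_inr, assocMap_inr, assocMove, assocMove, Category.assoc,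
      reassoc_of% h1, inr_comp, inr_comp, move_left]
  | move y v v₂ =>
    have h1 := moveIn_moveIn x y v (⟨v₂, w⟩ : TSum P M N)
    have h2 := moveIn_right y v (move x v₂ w)
    have h3 : (inr v (inl (actSwap x y v₂).hom w : (⟨x ⊙ₗ y ⊙ₗ v₂, w⟩ : TSum P M N) ⟶ _) :
        (⟨v, ⟨x ⊙ₗ y ⊙ₗ v₂, w⟩⟩ : TSum P L (TSum P M N)) ⟶ _) ≫
        inr v (inl (actSwap y x v₂).hom w) = 𝟙 _ := by
      rw [inr_comp, inl_comp, ← actSwap_inv x y v₂, Iso.hom_inv_id, inl_id, inr_id]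
    dsimp only at h1
    rw [actR_move] at h2
    rw [actR_move, assocMap_comp, assocMap_inl, assocMap_move, assocMap_move, assocMove,
      assocMove, Category.assoc, Category.assoc, h2, ← reassoc_of% h1, ← inr_comp, reassoc_of% h3]

theorem assocMove_right (x : P) (a : TSum P L M) {w w' : N} (g : w ⟶ w') :
    inr (x ⊙ₗ a.fst) (inr a.snd g : (⟨a.snd, w⟩ : TSum P M N) ⟶ _) ≫ assocMove x a w' =
      assocMove x a w ≫ inr a.fst (inr a.snd (x ⊴ₗ g) : (⟨a.snd, x ⊙ₗ w⟩ : TSum P M N) ⟶ _) := by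
  have h1 := moveIn_right x a.fst (inr a.snd g : (⟨a.snd, w⟩ : TSum P M N) ⟶ _)
  rw [actR_inr] at h1
  rw [assocMove, assocMove, Category.assoc, reassoc_of% h1, inr_comp, inr_comp, move_right]

theorem assocMove_tensor (x y : P) (a : TSum P L M) (w : N) :
    assocMove (x ⊗ y) a w = inl (αₗ x y a.fst).hom (⟨a.snd, w⟩ : TSum P M N) ≫
      assocMove x (⟨y ⊙ₗ a.fst, a.snd⟩ : TSum P L M) w ≫ assocMove y a (x ⊙ₗ w) ≫
        inr a.fst (inr a.snd ((αₗ y x w).inv ≫ (β_ y x).hom ⊵ₗ w) :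
          (⟨a.snd, y ⊙ₗ x ⊙ₗ w⟩ : TSum P M N) ⟶ _) := by
  have h2 := moveIn_right y a.fst (move x a.snd w)
  rw [actR_move] at h2
  have h3 : ((αₗ y x a.snd).inv ≫ (β_ y x).hom ⊵ₗ a.snd) ≫ (αₗ x y a.snd).hom =
    (actSwap y x a.snd).hom := by rw [Category.assoc]; rfl
  rw [assocMove, assocMove, assocMove, moveIn_tensor, move_tensor]
  simp only [Category.assoc]
  rw [reassoc_of% h2]
  simp only [inr_comp]
  rw [inl_comp', h3]
  simp only [Category.assoc]

/-- The balanced bifunctor `((v₁, v₂), w) ↦ (v₁, (v₂, w))`. -/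
def assocBalanced : Balanced P (TSum P L M) N (TSum P L (TSum P M N)) where
  obj a w := ⟨a.fst, ⟨a.snd, w⟩⟩
  mapL f w := assocMap f w
  mapR a _ _ g := inr a.fst (inr a.snd g)
  bal x a w := assocMove x a w
  mapL_id a w := assocMap_id a w
  mapR_id a w := by rw [inr_id, inr_id]
  mapL_comp f g w := assocMap_comp f g w
  mapR_comp a _ _ _ f g := by rw [inr_comp, inr_comp]
  comm m _ _ g := assocMap_inr_inr m g
  bal_natural {x y} h a w := by
    change assocMap (inl (h ⊵ₗ a.fst) a.snd) w ≫ assocMove y a w = _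
    rw [assocMap_inl, assocMove_natural]
  bal_left x _ _ m w := assocMove_left x m w
  bal_right x a _ _ g := assocMove_right x a g
  bal_tensor x y a w := by
    change _ = assocMap (inl (αₗ x y a.fst).hom a.snd) w ≫ _
    rw [assocMap_inl, assocMove_tensor]
    rfl

/-- The associativity constraint `(L + M) + N → L + (M + N)`, `((v₁, v₂), w) ↦ (v₁, (v₂, w))`. -/
def sumAssoc : LinFun P (TSum P (TSum P L M) N) (TSum P L (TSum P M N)) :=
  liftLin assocBalanced
    { lam := fun z a w => Iso.refl (⟨z ⊙ₗ a.fst, ⟨a.snd, w⟩⟩ : TSum P L (TSum P M N))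
      natural := fun {z z'} h a w => by
        change assocMap (inl (h ⊵ₗ a.fst) a.snd) w ≫ 𝟙 _ =
          𝟙 _ ≫ inl (h ⊵ₗ a.fst) (⟨a.snd, w⟩ : TSum P M N)
        rw [Category.comp_id, Category.id_comp, assocMap_inl]
      left := fun z a b m w => by
        change assocMap (actR z m) w ≫ 𝟙 _ = 𝟙 _ ≫ actR z (assocMap m w)
        rw [Category.comp_id, Category.id_comp, actR_assocMap]
      right := fun z a w w' g => by
        change inr (z ⊙ₗ a.fst) (inr a.snd g) ≫ 𝟙 _ = 𝟙 _ ≫ actR z (inr a.fst (inr a.snd g))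
        rw [Category.comp_id, Category.id_comp, actR_inr]
      swap := fun z x a w => by
        change assocMap (actSwap z x a).hom w ≫
          assocMove x (⟨z ⊙ₗ a.fst, a.snd⟩ : TSum P L M) w ≫ 𝟙 _ = 𝟙 _ ≫ actR z (assocMove x a w)
        have h : actR z (assocMove x a w) = _ := actR_comp z _ _
        rw [Category.comp_id, Category.id_comp, h, actR_moveIn, actR_inr, assocMove, actSwap_inl,
          assocMap_inl, Category.assoc]
      tensor := fun z z' a w => by
        change 𝟙 _ ≫ inl (αₗ z z' a.fst).hom (⟨a.snd, w⟩ : TSum P M N) =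
          assocMap (inl (αₗ z z' a.fst).hom a.snd) w ≫ 𝟙 _ ≫
            actR z (𝟙 (⟨z' ⊙ₗ a.fst, ⟨a.snd, w⟩⟩ : TSum P L (TSum P M N)))
        rw [actR_id, Category.id_comp, assocMap_inl]
        exact ((Category.assoc _ _ _).symm.trans ((Category.comp_id _).trans
          (Category.comp_id _))).symm }

end Sums

end PicExt

namespace PicExt

open scoped MonoidalLeftAction

/-- A torsor under the Picard groupoid `P`, as a bundled object. -/
structure PTorsor (P : Type u) [Category.{v} P] [MonoidalCategory P] where
  carrier : Type u
  [category : Category.{max u v} carrier]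
  [action : MonoidalLeftAction P carrier]
  [isTorsor : IsTorsor P carrier]

namespace PTorsor

variable {P : Type u} [Category.{v} P] [MonoidalCategory P]

instance : CoeSort (PTorsor P) (Type u) := ⟨carrier⟩

attribute [instance] category action isTorsor

instance [IsPicardGroupoid P] (L : PTorsor P) : IsGroupoid L :=
  isGroupoid_of_isTorsor P L

end PTorsor

section Extension

variable (G : Type w) [Group G]
variable (P : Type u) [Category.{v} P] [MonoidalCategory P] [SymmetricCategory P]
  [IsPicardGroupoid P]

/-- The data of a central extension of `G` by `P`, without the compatibility condition: torsors
`L_g`, `1`-isomorphisms `L_{ab} → L_a + L_b`, and `2`-isomorphisms between the two composites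
`L_{abc} → L_a + (L_b + L_c)`. Equal elements of `G` are allowed to index the same torsor: the
products are named by additional variables together with equations. -/
structure ExtensionData where
  torsor : G → PTorsor P
  mul (a b ab : G) (h : a * b = ab) : LinFun P (torsor ab) (TSum P (torsor a) (torsor b))
  assoc (a b c ab bc abc : G) (h₁ : a * b = ab) (h₂ : ab * c = abc) (h₃ : b * c = bc)
    (h₄ : a * bc = abc) :
    ((mul ab c abc h₂).comp ((mul a b ab h₁).sum LinFun.id)).comp sumAssoc ⟶
      (mul a bc abc h₄).comp (LinFun.id.sum (mul b c bc h₃))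

variable {G P}

namespace ExtensionData

variable (E : ExtensionData G P)

/-- The composite `L_{abcd} → L_{abc} + L_d → (L_{ab} + L_c) + L_d → ((L_a + L_b) + L_c) + L_d →
L_a + (L_b + (L_c + L_d))`. -/
def cubeSource (a b c d ab abc abcd : G) (h₁ : a * b = ab) (h₂ : ab * c = abc)
    (h₃ : abc * d = abcd) :
    LinFun P (E.torsor abcd)
      (TSum P (E.torsor a) (TSum P (E.torsor b) (TSum P (E.torsor c) (E.torsor d)))) :=
  ((E.mul abc d abcd h₃).comp
    (((E.mul ab c abc h₂).comp ((E.mul a b ab h₁).sum LinFun.id)).sum LinFun.id)).comp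
      (sumAssoc.comp sumAssoc)

/-- The composite `L_{abcd} → L_a + L_{bcd} → L_a + (L_b + L_{cd}) → L_a + (L_b + (L_c + L_d))`. -/
def cubeTarget (a b c d cd bcd abcd : G) (h₁ : c * d = cd) (h₂ : b * cd = bcd)
    (h₃ : a * bcd = abcd) :
    LinFun P (E.torsor abcd)
      (TSum P (E.torsor a) (TSum P (E.torsor b) (TSum P (E.torsor c) (E.torsor d)))) :=
  (E.mul a bcd abcd h₃).comp
    (LinFun.id.sum ((E.mul b cd bcd h₂).comp (LinFun.id.sum (E.mul c d cd h₁))))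

variable (a b c d ab bc cd abc bcd abcd : G) (hab : a * b = ab) (hbc : b * c = bc) (hcd : c * d = cd)
  (hab_c : ab * c = abc) (ha_bc : a * bc = abc) (hbc_d : bc * d = bcd) (hb_cd : b * cd = bcd)
  (habc_d : abc * d = abcd) (hab_cd : ab * cd = abcd) (ha_bcd : a * bcd = abcd)

/-- One half of the boundary of the cube: the composite, at an object `v` of `L_{abcd}`, of the
`2`-isomorphisms attached to `(a, b, c)`, `(a, bc, d)` and `(b, c, d)`. -/
def cubeFront (v : E.torsor abcd) :
    (E.cubeSource a b c d ab abc abcd hab hab_c habc_d).obj v ⟶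
      (E.cubeTarget a b c d cd bcd abcd hcd hb_cd ha_bcd).obj v :=
  let p : E.torsor abc := ((E.mul abc d abcd habc_d).obj v).fst
  let q : E.torsor d := ((E.mul abc d abcd habc_d).obj v).snd
  let t : E.torsor a := ((E.mul a bcd abcd ha_bcd).obj v).fst
  let n : E.torsor bcd := ((E.mul a bcd abcd ha_bcd).obj v).snd
  (sumAssoc.comp (LinFun.id.sum sumAssoc)).map
      (TSum.inl ((E.assoc a b c ab bc abc hab hab_c hbc ha_bc).app p) q) ≫
    ((LinFun.id.sum ((E.mul b c bc hbc).sum LinFun.id)).comp (LinFun.id.sum sumAssoc)).map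
      ((E.assoc a bc d abc bcd abcd ha_bc habc_d hbc_d ha_bcd).app v) ≫
    TSum.inr t ((E.assoc b c d bc cd bcd hbc hbc_d hcd hb_cd).app n)

/-- The other half of the boundary of the cube: the composite, at an object `v` of `L_{abcd}`, of
the `2`-isomorphisms attached to `(ab, c, d)` and `(a, b, cd)`. -/
def cubeBack (v : E.torsor abcd) :
    (E.cubeSource a b c d ab abc abcd hab hab_c habc_d).obj v ⟶
      (E.cubeTarget a b c d cd bcd abcd hcd hb_cd ha_bcd).obj v :=
  (((E.mul a b ab hab).sum LinFun.id).comp sumAssoc).map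
      ((E.assoc ab c d abc cd abcd hab_c habc_d hcd hab_cd).app v) ≫
    (LinFun.id.sum (LinFun.id.sum (E.mul c d cd hcd))).map
      ((E.assoc a b cd ab bcd abcd hab hab_cd hb_cd ha_bcd).app v)

end ExtensionData

variable (G P) in
/-- A central extension of the group `G` by the Picard groupoid `P`. -/
structure CentralExtension extends ExtensionData G P where
  cube : ∀ (a b c d ab bc cd abc bcd abcd : G) (hab : a * b = ab) (hbc : b * c = bc)
    (hcd : c * d = cd) (hab_c : ab * c = abc) (ha_bc : a * bc = abc) (hbc_d : bc * d = bcd)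
    (hb_cd : b * cd = bcd) (habc_d : abc * d = abcd) (hab_cd : ab * cd = abcd)
    (ha_bcd : a * bcd = abcd) (v : torsor abcd),
    toExtensionData.cubeFront a b c d ab bc cd abc bcd abcd hab hbc hcd hab_c ha_bc hbc_d hb_cd
        habc_d ha_bcd v =
      toExtensionData.cubeBack a b c d ab cd abc bcd abcd hab hcd hab_c hb_cd habc_d hab_cd
        ha_bcd v

/-- An isomorphism of central extensions: `1`-isomorphisms `L_a → L'_a`, and `2`-isomorphisms
between the two composites `L_{ab} → L'_a + L'_b`, compatible with the `2`-isomorphisms `assoc`. -/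
structure CentralExtension.Isomorphism (E E' : CentralExtension G P) where
  toFun (a : G) : LinFun P (E.torsor a) (E'.torsor a)
  mul (a b ab : G) (h : a * b = ab) :
    (E.mul a b ab h).comp ((toFun a).sum (toFun b)) ⟶ (toFun ab).comp (E'.mul a b ab h)
  assoc : ∀ (a b c ab bc abc : G) (h₁ : a * b = ab) (h₂ : ab * c = abc) (h₃ : b * c = bc)
    (h₄ : a * bc = abc) (v : E.torsor abc),
    ((toFun a).sum ((toFun b).sum (toFun c))).map ((E.assoc a b c ab bc abc h₁ h₂ h₃ h₄).app v) ≫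
        TSum.inr ((toFun a).obj ((E.mul a bc abc h₄).obj v).fst)
          ((mul b c bc h₃).app ((E.mul a bc abc h₄).obj v).snd) ≫
        (LinFun.id.sum (E'.mul b c bc h₃)).map ((mul a bc abc h₄).app v) =
      sumAssoc.map (TSum.inl ((mul a b ab h₁).app ((E.mul ab c abc h₂).obj v).fst)
          ((toFun c).obj ((E.mul ab c abc h₂).obj v).snd)) ≫
        (((E'.mul a b ab h₁).sum LinFun.id).comp sumAssoc).map ((mul ab c abc h₂).app v) ≫
        (E'.assoc a b c ab bc abc h₁ h₂ h₃ h₄).app ((toFun abc).obj v)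

end Extension

end PicExt

namespace PicExt

open scoped MonoidalLeftAction

section Commutator

variable {H : Type w} [Group H]
variable {P : Type u} [Category.{v} P] [MonoidalCategory P] [SymmetricCategory P]
  [IsPicardGroupoid P]

/-- The identification of the endomorphisms of an object `x` of `P` with `π₁(P) = End(e)`: the
inverse of `φ ↦ x + φ`. -/
noncomputable def toPi (x : P) (φ : x ⟶ x) : End (𝟙_ P) :=
  (tensorLeft x).preimage (X := 𝟙_ P) (Y := 𝟙_ P) ((ρ_ x).hom ≫ φ ≫ (ρ_ x).inv)

/-- The commutator `Comm(f)(a, b)` of a homomorphism `f : H → P`, given by objects `f a` and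
isomorphisms `m a b : f (ab) ≅ f a + f b`, at a pair of commuting elements: it is the automorphism
`f (ab) ≅ f a + f b ≅ f b + f a ≅ f (ba) = f (ab)`, viewed as an element of `π₁(P)`.
The coherence of the isomorphisms `m` is not needed to define it. -/
noncomputable def commutator (f : H → P) (m : ∀ a b : H, f (a * b) ≅ f a ⊗ f b) (a b : H)
    (h : a * b = b * a) : End (𝟙_ P) :=
  toPi (f (a * b)) ((m a b).hom ≫ (β_ (f a) (f b)).hom ≫ (m b a).inv ≫
    eqToHom (congrArg f h.symm))

end Commutator

section C

variable {G : Type w} [Group G]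
variable {P : Type u} [Category.{v} P] [MonoidalCategory P] [SymmetricCategory P]
  [IsPicardGroupoid P]

namespace ExtensionData

variable (E : ExtensionData G P)

/-- The composite `L_{ab} → L_a + L_b → L_b + L_a → L_{ba} = L_{ab}` for commuting `a` and `b`. -/
noncomputable def commMap (a b ab : G) (h : a * b = ab) (h' : b * a = ab) :
    LinFun P (E.torsor ab) (E.torsor ab) :=
  (E.mul a b ab h).comp (sumComm.comp (E.mul b a ab h').inverse)

/-- The object `C₂(a, b)` of `P`: the image of `commMap` under the quasi-inverse of
`Z : P → Hom_P(L_{ab}, L_{ab})`. -/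
noncomputable def C2 (a b ab : G) (h : a * b = ab) (h' : b * a = ab) : P :=
  (LinFun.Z P (E.torsor ab)).inv.obj (E.commMap a b ab h h')

/-- The canonical `2`-isomorphism `Z(C₂(a, b)) ≅ commMap`. -/
noncomputable def commIso (a b ab : G) (h : a * b = ab) (h' : b * a = ab) :
    (LinFun.Z P (E.torsor ab)).obj (E.C2 a b ab h h') ≅ E.commMap a b ab h h' :=
  (LinFun.Z P (E.torsor ab)).asEquivalence.counitIso.app (E.commMap a b ab h h')

/-- The canonical isomorphism in `L_b + L_a` from `C₂(a, b) + w` to `C w'`, where `w` and `w'` are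
the images of `v` under `L_{ab} → L_b + L_a` and `L_{ab} → L_a + L_b`, and `C` is the commutativity
constraint. -/
noncomputable def theta (a b ab : G) (h : a * b = ab) (h' : b * a = ab) (v : E.torsor ab) :
    E.C2 a b ab h h' ⊙ₗ (E.mul b a ab h').obj v ⟶ sumComm.obj ((E.mul a b ab h).obj v) :=
  ((E.mul b a ab h').lam (E.C2 a b ab h h') v).inv ≫
    (E.mul b a ab h').map ((E.commIso a b ab h h').hom.app v) ≫
      ((E.mul b a ab h').counit (sumComm.obj ((E.mul a b ab h).obj v))).hom

/-- The inverse of `theta`. -/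
noncomputable def thetaInv (a b ab : G) (h : a * b = ab) (h' : b * a = ab) (v : E.torsor ab) :
    sumComm.obj ((E.mul a b ab h).obj v) ⟶ E.C2 a b ab h h' ⊙ₗ (E.mul b a ab h').obj v :=
  inv (E.theta a b ab h h' v)

section Zeta

variable (g b c gb gc bc t : G) (h_gb : g * b = gb) (h_bg : b * g = gb) (h_gc : g * c = gc)
  (h_cg : c * g = gc) (h_bc : b * c = bc) (h_g_bc : g * bc = t) (h_bc_g : bc * g = t)
  (h_gb_c : gb * c = t) (h_b_gc : b * gc = t)

/-- The composite `L_{bcg} → L_{bc} + L_g → (L_b + L_c) + L_g → L_b + (L_c + L_g)`. -/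
def triple : LinFun P (E.torsor t) (TSum P (E.torsor b) (TSum P (E.torsor c) (E.torsor g))) :=
  (E.mul bc g t h_bc_g).comp (((E.mul b c bc h_bc).sum LinFun.id).comp sumAssoc)

/-- The isomorphism from `C₂(g, bc) + w` to `(C₂(g, b) + C₂(g, c)) + w` in `L_b + (L_c + L_g)`,
where `w` is the image of an object `v` of `L_{gbc}`. It is the composite of: the definition of
`C₂(g, bc)`; the naturality of the commutativity constraint with respect to `L_{bc} → L_b + L_c`
(an identity); the structure `2`-isomorphism for `(g, b, c)`; the hexagon (an identity); the
definition of `C₂(g, b)`; the structure `2`-isomorphism for `(b, g, c)`; the definition of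
`C₂(g, c)`; and the structure `2`-isomorphism for `(b, c, g)`. -/
noncomputable def zetaChain (v : E.torsor t) :
    E.C2 g bc t h_g_bc h_bc_g ⊙ₗ (E.triple g b c bc t h_bc h_bc_g).obj v ⟶
      (E.C2 g b gb h_gb h_bg ⊗ E.C2 g c gc h_gc h_cg) ⊙ₗ
        (E.triple g b c bc t h_bc h_bc_g).obj v :=
  let z : P := E.C2 g bc t h_g_bc h_bc_g
  let x : P := E.C2 g b gb h_gb h_bg
  let y : P := E.C2 g c gc h_gc h_cg
  let K : LinFun P (TSum P (E.torsor bc) (E.torsor g))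
      (TSum P (E.torsor b) (TSum P (E.torsor c) (E.torsor g))) :=
    ((E.mul b c bc h_bc).sum LinFun.id).comp sumAssoc
  let H : LinFun P (TSum P (TSum P (E.torsor b) (E.torsor g)) (E.torsor c))
      (TSum P (E.torsor b) (TSum P (E.torsor c) (E.torsor g))) :=
    sumAssoc.comp (LinFun.id.sum sumComm)
  let R : LinFun P (TSum P (E.torsor g) (TSum P (E.torsor b) (E.torsor c)))
      (TSum P (E.torsor b) (TSum P (E.torsor c) (E.torsor g))) :=
    sumComm.comp sumAssoc
  let S : LinFun P (TSum P (E.torsor b) (TSum P (E.torsor g) (E.torsor c)))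
      (TSum P (E.torsor b) (TSum P (E.torsor c) (E.torsor g))) :=
    LinFun.id.sum sumComm
  let p : E.torsor gb := ((E.mul gb c t h_gb_c).obj v).fst
  let q : E.torsor c := ((E.mul gb c t h_gb_c).obj v).snd
  let r : E.torsor b := ((E.mul b gc t h_b_gc).obj v).fst
  let s : E.torsor gc := ((E.mul b gc t h_b_gc).obj v).snd
  (K.lam z ((E.mul bc g t h_bc_g).obj v)).inv ≫
    K.map (E.theta g bc t h_g_bc h_bc_g v) ≫
    R.map (inv ((E.assoc g b c gb bc t h_gb h_gb_c h_bc h_g_bc).app v)) ≫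
    H.map (TSum.inl (E.thetaInv g b gb h_gb h_bg p) q) ≫
    (H.lam x (⟨(E.mul b g gb h_bg).obj p, q⟩ :
      TSum P (TSum P (E.torsor b) (E.torsor g)) (E.torsor c))).hom ≫
    x ⊴ₗ (S.map ((E.assoc b g c gb gc t h_bg h_gb_c h_gc h_b_gc).app v) ≫
      TSum.inr r (E.thetaInv g c gc h_gc h_cg s) ≫
      inv (TSum.move y r ((E.mul c g gc h_cg).obj s)) ≫
      y ⊴ₗ inv ((E.assoc b c g bc gc t h_bc h_bc_g h_cg h_b_gc).app v)) ≫
    (αₗ x y ((E.triple g b c bc t h_bc h_bc_g).obj v)).inv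

/-- The canonical isomorphism `C₂(g, bc) ≅ C₂(g, b) + C₂(g, c)`, characterised by its action on an
object of the torsor `L_b + (L_c + L_g)`. -/
noncomputable def zeta :
    E.C2 g bc t h_g_bc h_bc_g ≅ E.C2 g b gb h_gb h_bg ⊗ E.C2 g c gc h_gc h_cg :=
  asIso ((MonoidalLeftAction.actionRight (C := P) ((E.triple g b c bc t h_bc h_bc_g).obj
    (E.torsor t).isTorsor.nonempty.some)).preimage
      (E.zetaChain g b c gb gc bc t h_gb h_bg h_gc h_cg h_bc h_g_bc h_bc_g h_gb_c h_b_gc _))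

end Zeta

end ExtensionData

namespace CentralExtension

variable (E : CentralExtension G P)

theorem centralizer_comm {g : G} (a : Subgroup.centralizer ({g} : Set G)) :
    (a : G) * g = g * a :=
  (Subgroup.mem_centralizer_singleton_iff.1 a.2)

/-- The homomorphism `C_g : Z_G(g) → P`, `a ↦ C₂(g, a)`, on objects. -/
noncomputable def Cg (g : G) (a : Subgroup.centralizer ({g} : Set G)) : P :=
  E.C2 g a (g * a) rfl (centralizer_comm a)

/-- The structure isomorphism `C_g(ab) ≅ C_g(a) + C_g(b)`. -/
noncomputable def CgMul (g : G) (a b : Subgroup.centralizer ({g} : Set G)) :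
    E.Cg g (a * b) ≅ E.Cg g a ⊗ E.Cg g b :=
  E.zeta g a b (g * a) (g * b) (a * b) (g * (a * b)) rfl (centralizer_comm a) rfl
    (centralizer_comm b) rfl rfl (centralizer_comm (a * b)) (mul_assoc _ _ _)
    (by rw [← mul_assoc, centralizer_comm a, mul_assoc])

end CentralExtension

variable (G) in
/-- The set of triples of pairwise commuting elements of `G`. -/
def CommTriple : Type w :=
  {t : G × G × G // Commute t.1 t.2.1 ∧ Commute t.1 t.2.2 ∧ Commute t.2.1 t.2.2}

/-- The map `C₃(g, a, b) = Comm(C_g)(a, b)` with values in `π₁(P)`. -/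
noncomputable def CentralExtension.C3 (E : CentralExtension G P) (t : CommTriple G) :
    End (𝟙_ P) :=
  commutator (E.Cg t.1.1) (E.CgMul t.1.1)
    ⟨t.1.2.1, Subgroup.mem_centralizer_singleton_iff.2 t.2.1.symm.eq⟩
    ⟨t.1.2.2, Subgroup.mem_centralizer_singleton_iff.2 t.2.2.1.symm.eq⟩
    (Subtype.ext t.2.2.2.eq)

end C

end PicExt

namespace PicExt

open scoped MonoidalLeftAction

section SumLemmas

variable {P : Type u} [Category.{v} P] [MonoidalCategory P] [SymmetricCategory P]
  [IsPicardGroupoid P]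
variable {L M N K : Type u} [Category.{max u v} L] [Category.{max u v} M]
  [Category.{max u v} N] [Category.{max u v} K]
  [MonoidalLeftAction P L] [MonoidalLeftAction P M] [MonoidalLeftAction P N]
  [MonoidalLeftAction P K]
  [IsGroupoid L] [IsGroupoid M] [IsGroupoid N] [IsGroupoid K]

theorem LinFun.sum_map_inl (F : LinFun P L N) (G : LinFun P M K) {v v' : L} (f : v ⟶ v') (w : M) :
    (F.sum G).map (TSum.inl f w) =
      (TSum.inl (F.map f) (G.obj w) : (⟨F.obj v, G.obj w⟩ : TSum P N K) ⟶ _) :=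
  TSum.lift_map_inl (sumBalanced F G) f w

theorem sumAssoc_map_inl_inl {v v' : L} (f : v ⟶ v') (w : M) (k : N) :
    sumAssoc.map (TSum.inl (TSum.inl f w : (⟨v, w⟩ : TSum P L M) ⟶ ⟨v', w⟩) k) =
      (TSum.inl f (⟨w, k⟩ : TSum P M N) : (⟨v, ⟨w, k⟩⟩ : TSum P L (TSum P M N)) ⟶ _) :=
  (TSum.lift_map_inl assocBalanced _ k).trans (assocMap_inl f w k)

end SumLemmas

section Trivial

/-- The Picard groupoid `P` regarded as a torsor over itself. The morphisms are lifted to a larger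
`Type`, in which the morphisms of torsors live. -/
structure SelfTorsor (P : Type u) : Type u where
  val : P

variable {P : Type u} [Category.{v} P] [MonoidalCategory P]

instance : Category.{max u v} (SelfTorsor P) where
  Hom x y := ULift.{u} (x.val ⟶ y.val)
  id x := ⟨𝟙 x.val⟩
  comp f g := ⟨f.down ≫ g.down⟩
  id_comp f := congrArg ULift.up (Category.id_comp f.down)
  comp_id f := congrArg ULift.up (Category.comp_id f.down)
  assoc f g h := congrArg ULift.up (Category.assoc f.down g.down h.down)

/-- An isomorphism of `P` as an isomorphism of the torsor `P`. -/
def SelfTorsor.upIso {x y : SelfTorsor P} (e : x.val ≅ y.val) : x ≅ y where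
  hom := ⟨e.hom⟩
  inv := ⟨e.inv⟩
  hom_inv_id := congrArg ULift.up e.hom_inv_id
  inv_hom_id := congrArg ULift.up e.inv_hom_id

/-- The action of `P` on itself, `x + y = x ⊗ y`. -/
instance : MonoidalLeftAction P (SelfTorsor P) where
  actionObj x y := ⟨x ⊗ y.val⟩
  actionHomLeft f y := ⟨f ▷ y.val⟩
  actionHomRight x _ _ g := ⟨x ◁ g.down⟩
  actionHom f g := ⟨f ⊗ₘ g.down⟩
  actionAssocIso x y z := SelfTorsor.upIso (α_ x y z.val)
  actionUnitIso x := SelfTorsor.upIso (λ_ x.val)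
  actionHom_def f g := congrArg ULift.up (MonoidalCategory.tensorHom_def f g.down)
  actionHomRight_id x y := congrArg ULift.up (MonoidalCategory.whiskerLeft_id x y.val)
  id_actionHomLeft x y := congrArg ULift.up (MonoidalCategory.id_whiskerRight x y.val)
  actionHom_comp f₁ f₂ g₁ g₂ :=
    congrArg ULift.up (MonoidalCategory.tensorHom_comp_tensorHom f₁ g₁.down f₂ g₂.down).symm
  actionAssocIso_hom_naturality f g h :=
    congrArg ULift.up (MonoidalCategory.associator_naturality f g h.down)
  actionUnitIso_hom_naturality f :=
    congrArg ULift.up (MonoidalCategory.leftUnitor_naturality f.down).symm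
  whiskerLeft_actionHomLeft x _ _ f y :=
    congrArg ULift.up (MonoidalCategory.whisker_assoc x f y.val)
  whiskerRight_actionHomLeft {c c'} x f y := congrArg ULift.up (by
    change (f ▷ x) ▷ y.val = (α_ c x y.val).hom ≫ f ▷ (x ⊗ y.val) ≫ (α_ c' x y.val).inv
    simp)
  associator_actionHom x y z w := congrArg ULift.up (MonoidalCategory.pentagon x y z w.val)
  leftUnitor_actionHom x y := congrArg ULift.up (MonoidalCategory.leftUnitor_whiskerRight x y.val)
  rightUnitor_actionHom x y := congrArg ULift.up (MonoidalCategory.triangle x y.val).symm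

variable [SymmetricCategory P] [IsPicardGroupoid P]

instance : IsTorsor P (SelfTorsor P) where
  nonempty := ⟨⟨𝟙_ P⟩⟩
  actionLeft_isEquivalence := actionLeft_isEquivalence_of_picard (SelfTorsor P)
  actionRight_isEquivalence v := by
    have : (tensorRight v.val).IsEquivalence :=
      Functor.isEquivalence_of_iso (BraidedCategory.tensorLeftIsoTensorRight v.val)
    exact
      { faithful := ⟨fun {x y} f g e =>
          (tensorRight v.val).map_injective (congrArg ULift.down e)⟩
        full := ⟨fun {x y} f => by
          obtain ⟨k, hk⟩ := (tensorRight v.val).map_surjective (X := x) (Y := y) f.down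
          exact ⟨k, congrArg ULift.up hk⟩⟩
        essSurj := ⟨fun y => ⟨(tensorRight v.val).objPreimage y.val,
          ⟨SelfTorsor.upIso ((tensorRight v.val).objObjPreimageIso y.val)⟩⟩⟩ }

instance : IsGroupoid (SelfTorsor P) := isGroupoid_of_isTorsor P (SelfTorsor P)

variable (P) in
/-- The unit object, as an object of the torsor `P`. -/
def SelfTorsor.unit : SelfTorsor P := ⟨𝟙_ P⟩

open SelfTorsor (unit)

variable (P) in
/-- The trivial torsor. -/
def trivialTorsor : PTorsor P := ⟨SelfTorsor P⟩

variable (P) in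
/-- The `1`-isomorphism `P → P + P`, `x ↦ (x, e)`. -/
def trivialMul : LinFun P (SelfTorsor P) (TSum P (SelfTorsor P) (SelfTorsor P)) where
  functor :=
    { obj := fun x => ⟨x, unit P⟩
      map := fun f => TSum.inl f (unit P)
      map_id := fun x => TSum.inl_id _ _
      map_comp := fun f g => (TSum.inl_comp _ _ _).symm }
  lam x v := Iso.refl (⟨x ⊙ₗ v, unit P⟩ : TSum P (SelfTorsor P) (SelfTorsor P))
  lam_natural_left h v := (Category.comp_id _).trans (Category.id_comp _).symm
  lam_natural_right x _ _ f := by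
    change TSum.inl (x ⊴ₗ f) (unit P) ≫ 𝟙 _ = 𝟙 _ ≫ TSum.actR x (TSum.inl f (unit P))
    rw [Category.comp_id, Category.id_comp, TSum.actR_inl]
  lam_assoc x y v := by
    change 𝟙 _ ≫ TSum.inl (αₗ x y v).hom (unit P) =
      TSum.inl (αₗ x y v).hom (unit P) ≫ 𝟙 _ ≫
        TSum.actR x (𝟙 (⟨y ⊙ₗ v, unit P⟩ : TSum P (SelfTorsor P) (SelfTorsor P)))
    rw [TSum.actR_id, Category.id_comp, Category.id_comp]
    exact (Category.comp_id _).symm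

variable (P) in
/-- The natural `2`-isomorphism between the two composites `P → P + (P + P)`, both of which map
`x` to `(x, (e, e))`; its components are identities. -/
def trivialAssoc :
    ((trivialMul P).comp ((trivialMul P).sum LinFun.id)).comp sumAssoc ⟶
      (trivialMul P).comp (LinFun.id.sum (trivialMul P)) where
  app v := 𝟙 (⟨v, ⟨unit P, unit P⟩⟩ :
    TSum P (SelfTorsor P) (TSum P (SelfTorsor P) (SelfTorsor P)))
  naturality {x y} f := by
    have h1 : sumAssoc.map (((trivialMul P).sum LinFun.id).map (TSum.inl f (unit P))) =
        TSum.inl f (⟨unit P, unit P⟩ : TSum P (SelfTorsor P) (SelfTorsor P)) :=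
      (congrArg sumAssoc.map (LinFun.sum_map_inl (trivialMul P) LinFun.id f (unit P))).trans
        (sumAssoc_map_inl_inl f (unit P) (unit P))
    have h2 : (LinFun.id.sum (trivialMul P)).map (TSum.inl f (unit P)) =
        TSum.inl f (⟨unit P, unit P⟩ : TSum P (SelfTorsor P) (SelfTorsor P)) :=
      LinFun.sum_map_inl LinFun.id (trivialMul P) f (unit P)
    exact (Category.comp_id _).trans ((h1.trans h2.symm).trans (Category.id_comp _).symm)
  lam_comp x v := by
    let o : TSum P (SelfTorsor P) (TSum P (SelfTorsor P) (SelfTorsor P)) :=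
      ⟨x ⊙ₗ v, ⟨unit P, unit P⟩⟩
    have h1 : (((trivialMul P).comp ((trivialMul P).sum LinFun.id)).lam x v).hom =
        𝟙 (⟨⟨x ⊙ₗ v, unit P⟩, unit P⟩ :
          TSum P (TSum P (SelfTorsor P) (SelfTorsor P)) (SelfTorsor P)) := by
      have a1 : ((trivialMul P).sum LinFun.id).map (𝟙 (⟨x ⊙ₗ v, unit P⟩ :
          TSum P (SelfTorsor P) (SelfTorsor P))) = 𝟙 _ := LinFun.map_id _ _
      have a2 : TSum.inl (P := P) (𝟙 (⟨x ⊙ₗ v, unit P⟩ : TSum P (SelfTorsor P) (SelfTorsor P)))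
          (unit P) = 𝟙 _ := TSum.inl_id _ _
      exact (congr (congrArg CategoryStruct.comp a1) a2).trans (Category.id_comp _)
    have h2 : ((((trivialMul P).comp ((trivialMul P).sum LinFun.id)).comp sumAssoc).lam x v).hom =
        𝟙 o := by
      have a1 := (congrArg sumAssoc.map h1).trans (LinFun.map_id _ _)
      exact (congr (congrArg CategoryStruct.comp a1) (rfl : 𝟙 o = 𝟙 o)).trans (Category.id_comp _)
    have h3 : (((trivialMul P).comp (LinFun.id.sum (trivialMul P))).lam x v).hom = 𝟙 o := by
      have a1 : (LinFun.id.sum (trivialMul P)).map (𝟙 (⟨x ⊙ₗ v, unit P⟩ :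
          TSum P (SelfTorsor P) (SelfTorsor P))) = 𝟙 _ := LinFun.map_id _ _
      have a2 : TSum.inl (𝟙 (x ⊙ₗ v)) (⟨unit P, unit P⟩ :
          TSum P (SelfTorsor P) (SelfTorsor P)) = 𝟙 o := TSum.inl_id _ _
      exact (congr (congrArg CategoryStruct.comp a1) a2).trans (Category.id_comp _)
    have h4 : TSum.actR x (𝟙 (⟨v, ⟨unit P, unit P⟩⟩ :
        TSum P (SelfTorsor P) (TSum P (SelfTorsor P) (SelfTorsor P)))) = 𝟙 o := TSum.actR_id _ _
    exact (congrArg (fun k : o ⟶ o => 𝟙 o ≫ k) h3).trans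
      (congr (congrArg CategoryStruct.comp h2) h4).symm

variable (G : Type w) [Group G]

variable (P) in
/-- The trivial central extension of `G` by `P`: `L_g = P`, with the natural `1`-isomorphisms
`P ≅ P + P` and the natural `2`-isomorphisms. -/
def trivialExtension : CentralExtension G P where
  torsor _ := trivialTorsor P
  mul _ _ _ _ := trivialMul P
  assoc _ _ _ _ _ _ _ _ _ _ := trivialAssoc P
  cube a b c d ab bc cd abc bcd abcd _ _ _ _ _ _ _ _ _ _ v := by
    let S := SelfTorsor P
    let o : TSum P S (TSum P S (TSum P S S)) := ⟨v, ⟨unit P, ⟨unit P, unit P⟩⟩⟩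
    let o₃ : TSum P S (TSum P S S) := ⟨v, ⟨unit P, unit P⟩⟩
    let u₃ : TSum P S (TSum P S S) := ⟨unit P, ⟨unit P, unit P⟩⟩
    have h1 : (sumAssoc.comp (LinFun.id.sum sumAssoc)).map (TSum.inl (𝟙 o₃) (unit P)) = 𝟙 o :=
      (congrArg (sumAssoc.comp (LinFun.id.sum sumAssoc)).map (TSum.inl_id o₃ (unit P))).trans
        (LinFun.map_id _ _)
    have h2 : ((LinFun.id.sum ((trivialMul P).sum LinFun.id)).comp
        (LinFun.id.sum sumAssoc)).map (𝟙 o₃) = 𝟙 o := LinFun.map_id _ _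
    have h3 : TSum.inr v (𝟙 u₃) = 𝟙 o := TSum.inr_id v u₃
    have h4 : (((trivialMul P).sum LinFun.id).comp sumAssoc).map (𝟙 o₃) = 𝟙 o := LinFun.map_id _ _
    have h5 : (LinFun.id.sum (LinFun.id.sum (trivialMul P))).map (𝟙 o₃) = 𝟙 o :=
      LinFun.map_id _ _
    have h6 : 𝟙 o ≫ 𝟙 o = 𝟙 o := Category.id_comp _
    have h7 := (congr (congrArg CategoryStruct.comp h1)
      (congr (congrArg CategoryStruct.comp h2) h3)).trans ((congrArg (fun k => 𝟙 o ≫ k) h6).trans h6)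
    have h8 := (congr (congrArg CategoryStruct.comp h4) h5).trans h6
    exact h7.trans h8.symm

end Trivial

end PicExt

/-! The reason for (i) is that an isomorphism `Φ` of central extensions carries everything that
enters `C3` for `E` to its counterpart for `E'`. Torsors are rigid: a 2-morphism out of a torsor is
determined by one component (`LinFun.hom_ext_of_app_eq`), and in a sum of torsors every morphism (x
+ v, w) ⟶ (y + v, w) comes from a morphism x ⟶ y of `P` (`TSum.exists_inl_action`), which is unique
because the action is faithful. Hence there is a morphism κ from C₂(a, b) to C₂'(a, b) that
intertwines the two isomorphisms `theta` along `Φ` (`exists_C2_hom`). If these κ respect the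
isomorphisms `zeta`, that is C₂(g, bc) ≅ C₂(g, b) + C₂(g, c), they form an isomorphism between the
homomorphisms C_g of `E` and `E'`. The commutator cannot distinguish isomorphic homomorphisms
(`commutator_congr`): the symmetry of `P` is natural, and conjugate automorphisms give the same
element of π₁.

The work lies in the compatibility with `zeta` (`zeta_C2Hom`). The isomorphism `zeta` is read off
from a long composite in L_b + (L_c + L_g). Its ingredients are isolated in `ExchangeData`, and the
composite becomes `ExchangeData.chain`. An `ExchangeData.Map` consists of 1-morphisms between the
torsors involved, fillers for the decompositions, morphisms κx, κy, κz of `P`, and one compatibility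
for each ingredient. Naturality of the chain along such a map (`ExchangeData.Map.chain_base`) is
obtained by pasting one square for each factor. The inputs are the naturality of the commutativity
and associativity constraints of sums (`TSum.swap_sumMap`, `TSum.assoc_sumMap`) and the hexagon
(`TSum.hexagon`). Since the action of `P` on the threefold sum is faithful, this yields the equation
ζ ≫ (κx ⊗ κy) = κz ≫ ζ' in `P` (`ExchangeData.Map.comp_eq`).

The naturality is used twice. The definition of `zeta` refers to an arbitrarily chosen object of
L_{gbc}, and `Φ` need not send the chosen object for `E` to the one for `E'`. Any two objects v, v'
are related by some u + v ≅ v', and translation by u is a map of exchange data whose κ are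
identities; so the same `zeta` describes the chain at every object (`zeta_chain`). After that, `Φ`
itself gives a map of exchange data (`exchangeMap`), and the required equation follows.

For (ii) nothing about C₂ has to be computed. The structure of the trivial extension does not
mention the elements of `G`, so C_g is constant with some value c, and its structure isomorphism is
one fixed ζ : c ≅ c + c. Such a c is isomorphic to the unit, hence its symmetry with itself is the
identity (`braiding_eq_id_of_iso`), and the commutator is the class of an identity. -/

namespace PicExt

open scoped MonoidalLeftAction

/-! ### Sums of 1-morphisms and the constraints of sums, on morphisms. -/

section SumCalculus

variable {P : Type u} [Category.{v} P] [MonoidalCategory P] [SymmetricCategory P]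
  [IsPicardGroupoid P]
variable {L M N L' M' N' L'' M'' : Type u}
  [Category.{max u v} L] [Category.{max u v} M] [Category.{max u v} N]
  [Category.{max u v} L'] [Category.{max u v} M'] [Category.{max u v} N']
  [Category.{max u v} L''] [Category.{max u v} M'']
  [MonoidalLeftAction P L] [MonoidalLeftAction P M] [MonoidalLeftAction P N]
  [MonoidalLeftAction P L'] [MonoidalLeftAction P M'] [MonoidalLeftAction P N']
  [MonoidalLeftAction P L''] [MonoidalLeftAction P M'']
  [IsGroupoid L] [IsGroupoid M] [IsGroupoid N] [IsGroupoid L'] [IsGroupoid M'] [IsGroupoid N']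
  [IsGroupoid L''] [IsGroupoid M'']

open TSum (inl inr move actR)

/-- Serves to replace the factors of a composite whose objects agree only after unfolding, where
`rw` does not find its pattern. -/
theorem comp_congr {C : Type u} [Category.{max u v} C] {a b c : C} {f f' : a ⟶ b}
    {g g' : b ⟶ c} (hf : f = f') (hg : g = g') : f ≫ g = f' ≫ g' := by rw [hf, hg]

/-- The functor `F + G` on morphisms. -/
def LinFun.sumMap (F : LinFun P L L') (G : LinFun P M M') {a b : TSum P L M} (m : a ⟶ b) :
    (⟨F.obj a.fst, G.obj a.snd⟩ : TSum P L' M') ⟶ ⟨F.obj b.fst, G.obj b.snd⟩ :=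
  (sumBalanced F G).map m

theorem LinFun.sumMap_comp (F : LinFun P L L') (G : LinFun P M M') {a b c : TSum P L M}
    (m : a ⟶ b) (n : b ⟶ c) : F.sumMap G (m ≫ n) = F.sumMap G m ≫ F.sumMap G n :=
  (sumBalanced F G).map_comp m n

theorem LinFun.sumMap_id (F : LinFun P L L') (G : LinFun P M M') (a : TSum P L M) :
    F.sumMap G (𝟙 a) = 𝟙 _ :=
  (sumBalanced F G).map_id a

theorem LinFun.sumMap_inl (F : LinFun P L L') (G : LinFun P M M') {v v' : L} (f : v ⟶ v')
    (w : M) : F.sumMap G (inl f w) = inl (F.map f) (G.obj w) :=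
  (sumBalanced F G).map_inl f w

theorem LinFun.sumMap_inr (F : LinFun P L L') (G : LinFun P M M') (v : L) {w w' : M}
    (g : w ⟶ w') : F.sumMap G (inr v g) = inr (F.obj v) (G.map g) :=
  (sumBalanced F G).map_inr v g

theorem LinFun.sumMap_move (F : LinFun P L L') (G : LinFun P M M') (x : P) (v : L) (w : M) :
    F.sumMap G (move x v w) = inl (F.lam x v).hom (G.obj w) ≫ move x (F.obj v) (G.obj w) ≫
        inr (F.obj v) (G.lam x w).inv :=
  (sumBalanced F G).map_move x v w

theorem LinFun.sumMap_inv (F : LinFun P L L') (G : LinFun P M M') {a b : TSum P L M}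
    (m : a ⟶ b) : F.sumMap G (inv m) = inv (F.sumMap G m) := by
  apply IsIso.eq_inv_of_hom_inv_id
  rw [← F.sumMap_comp, IsIso.hom_inv_id, sumMap_id]

/-- The functor `(v, w) ↦ (w, v)` on morphisms. -/
noncomputable def TSum.swap {a b : TSum P L M} (m : a ⟶ b) :
    (⟨a.snd, a.fst⟩ : TSum P M L) ⟶ ⟨b.snd, b.fst⟩ :=
  commBalanced.map m

theorem TSum.swap_comp {a b c : TSum P L M} (m : a ⟶ b) (n : b ⟶ c) :
    swap (m ≫ n) = swap m ≫ swap n := commBalanced.map_comp m n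

theorem TSum.swap_id (a : TSum P L M) : swap (𝟙 a) = 𝟙 _ := commBalanced.map_id a

theorem TSum.swap_inl {v v' : L} (f : v ⟶ v') (w : M) :
    swap (inl f w : (⟨v, w⟩ : TSum P L M) ⟶ _) = inr w f := commBalanced.map_inl f w

theorem TSum.swap_inr (v : L) {w w' : M} (g : w ⟶ w') :
    swap (inr v g : (⟨v, w⟩ : TSum P L M) ⟶ _) = inl g v := commBalanced.map_inr v g

theorem TSum.swap_move (x : P) (v : L) (w : M) :
    swap (move x v w : (⟨x ⊙ₗ v, w⟩ : TSum P L M) ⟶ _) = inv (move x w v) :=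
  commBalanced.map_move x v w

/-- The functor `((v₁, v₂), w) ↦ (v₁, (v₂, w))` on morphisms. -/
def TSum.assoc {a b : TSum P (TSum P L M) N} (m : a ⟶ b) :
    (⟨a.fst.fst, ⟨a.fst.snd, a.snd⟩⟩ : TSum P L (TSum P M N)) ⟶
      ⟨b.fst.fst, ⟨b.fst.snd, b.snd⟩⟩ :=
  assocBalanced.map m

open TSum (swap)

theorem TSum.assoc_comp {a b c : TSum P (TSum P L M) N} (m : a ⟶ b) (n : b ⟶ c) :
    TSum.assoc (m ≫ n) = TSum.assoc m ≫ TSum.assoc n := assocBalanced.map_comp m n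

theorem TSum.assoc_id (a : TSum P (TSum P L M) N) : TSum.assoc (𝟙 a) = 𝟙 _ :=
  assocBalanced.map_id a

theorem TSum.assoc_inl {a b : TSum P L M} (m : a ⟶ b) (w : N) :
    TSum.assoc (inl m w : (⟨a, w⟩ : TSum P (TSum P L M) N) ⟶ _) = assocMap m w :=
  assocBalanced.map_inl m w

theorem TSum.assoc_inr (a : TSum P L M) {w w' : N} (g : w ⟶ w') :
    TSum.assoc (inr a g : (⟨a, w⟩ : TSum P (TSum P L M) N) ⟶ _) = inr a.fst (inr a.snd g) :=
  assocBalanced.map_inr a g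

theorem TSum.assoc_move (x : P) (a : TSum P L M) (w : N) :
    TSum.assoc (move x a w : (⟨x ⊙ₗ a, w⟩ : TSum P (TSum P L M) N) ⟶ _) = assocMove x a w :=
  assocBalanced.map_move x a w

/-- Naturality of the commutativity constraint, on morphisms. As with the other identities between
functors on a sum, it suffices to check the generators `inl`, `inr` and `move`. The only real case
is `move`: the commutativity constraint turns it into the inverse of the opposite `move`, so the two
sides are inverse to one and the same morphism once the constraints of `F` and `G` cancel. -/
theorem TSum.swap_sumMap (F : LinFun P L L') (G : LinFun P M M') {a b : TSum P L M} (m : a ⟶ b) :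
    swap (F.sumMap G m) = G.sumMap F (swap m) := by
  induction m using TSum.hom_induction with
  | comp m n hm hn =>
    rw [LinFun.sumMap_comp, TSum.swap_comp, TSum.swap_comp, LinFun.sumMap_comp, hm, hn]
  | inl f w => rw [LinFun.sumMap_inl, swap_inl, swap_inl, LinFun.sumMap_inr]
  | inr v g => rw [LinFun.sumMap_inr, swap_inr, swap_inr, LinFun.sumMap_inl]
  | move x v w =>
    have h1 : (inl (G.lam x w).inv (F.obj v) :
        (⟨x ⊙ₗ G.obj w, F.obj v⟩ : TSum P M' L') ⟶ _) ≫ inl (G.lam x w).hom (F.obj v) = 𝟙 _ := by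
      rw [TSum.inl_comp, Iso.inv_hom_id, TSum.inl_id]
    have h2 : (inr (G.obj w) (F.lam x v).inv :
        (⟨G.obj w, x ⊙ₗ F.obj v⟩ : TSum P M' L') ⟶ _) ≫ inr (G.obj w) (F.lam x v).hom = 𝟙 _ := by
      rw [TSum.inr_comp, Iso.inv_hom_id, TSum.inr_id]
    rw [LinFun.sumMap_move, TSum.swap_comp, TSum.swap_comp, swap_inl, swap_move,
      swap_inr, swap_move, LinFun.sumMap_inv]
    apply IsIso.eq_inv_of_hom_inv_id
    rw [LinFun.sumMap_move]
    simp only [Category.assoc]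
    rw [reassoc_of% h2, IsIso.hom_inv_id_assoc, TSum.inl_comp, Iso.hom_inv_id, TSum.inl_id]

theorem assocMap_sumMap (F : LinFun P L L') (G : LinFun P M M') (H : LinFun P N N')
    {a b : TSum P L M} (m : a ⟶ b) (w : N) :
    assocMap (F.sumMap G m) (H.obj w) = F.sumMap (G.sum H) (assocMap m w) := by
  induction m using TSum.hom_induction with
  | comp m n hm hn =>
    rw [LinFun.sumMap_comp, assocMap_comp, assocMap_comp, LinFun.sumMap_comp, hm, hn]; rfl
  | inl f w => rw [LinFun.sumMap_inl, assocMap_inl, assocMap_inl, LinFun.sumMap_inl]; rfl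
  | @inr v w₁ w₂ g =>
    rw [LinFun.sumMap_inr, assocMap_inr, assocMap_inr, LinFun.sumMap_inr]
    exact congrArg (inr (F.obj v)) (G.sumMap_inl H g w).symm
  | move x v v' =>
    rw [LinFun.sumMap_move, assocMap_comp, assocMap_comp, assocMap_inl, assocMap_move,
      assocMap_move, assocMap_inr]
    exact (F.sumMap_move (G.sum H) x v (⟨v', w⟩ : TSum P M N)).symm

/-- Naturality of the associativity constraint. On a `move` the object of `P` passes through the
middle summand, where the constraint of `G` appears once with its inverse and cancels. -/
theorem TSum.assoc_sumMap (F : LinFun P L L') (G : LinFun P M M') (H : LinFun P N N')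
    {a b : TSum P (TSum P L M) N} (m : a ⟶ b) :
    TSum.assoc ((F.sum G).sumMap H m) = F.sumMap (G.sum H) (TSum.assoc m) := by
  induction m using TSum.hom_induction with
  | comp m n hm hn =>
    rw [LinFun.sumMap_comp, TSum.assoc_comp, TSum.assoc_comp, LinFun.sumMap_comp, hm, hn]; rfl
  | inl f w =>
    rw [LinFun.sumMap_inl, TSum.assoc_inl, TSum.assoc_inl, ← assocMap_sumMap]; rfl
  | inr a g =>
    rw [LinFun.sumMap_inr, TSum.assoc_inr, TSum.assoc_inr, LinFun.sumMap_inr]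
    exact congrArg (inr (F.obj a.fst)) (G.sumMap_inr H a.snd g).symm
  | move x a w =>
    have h1 : F.sumMap (G.sum H) (moveIn x a.fst (⟨a.snd, w⟩ : TSum P M N)) =
        inl (F.lam x a.fst).hom (⟨G.obj a.snd, H.obj w⟩ : TSum P M' N') ≫
          moveIn x (F.obj a.fst) (⟨G.obj a.snd, H.obj w⟩ : TSum P M' N') ≫
            inr (F.obj a.fst) (inl (G.lam x a.snd).inv (H.obj w)) :=
      F.sumMap_move (G.sum H) x a.fst (⟨a.snd, w⟩ : TSum P M N)
    have h2 : F.sumMap (G.sum H) (inr a.fst (move x a.snd w)) =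
        inr (F.obj a.fst) (inl (G.lam x a.snd).hom (H.obj w) ≫ move x (G.obj a.snd) (H.obj w) ≫
          inr (G.obj a.snd) (H.lam x w).inv) :=
      (F.sumMap_inr (G.sum H) a.fst (move x a.snd w)).trans
        (congrArg (inr (F.obj a.fst)) (G.sumMap_move H x a.snd w))
    have h3 : TSum.assoc ((F.sum G).sumMap H (move x a w)) =
        inl (F.lam x a.fst).hom (⟨G.obj a.snd, H.obj w⟩ : TSum P M' N') ≫
          (moveIn x (F.obj a.fst) (⟨G.obj a.snd, H.obj w⟩ : TSum P M' N') ≫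
            inr (F.obj a.fst) (move x (G.obj a.snd) (H.obj w))) ≫
              inr (F.obj a.fst) (inr (G.obj a.snd) (H.lam x w).inv) := by
      rw [LinFun.sumMap_move, TSum.assoc_comp, TSum.assoc_comp, TSum.assoc_inl, TSum.assoc_move,
        TSum.assoc_inr]
      exact comp_congr (assocMap_inl _ _ _) rfl
    have h4 : (inl (G.lam x a.snd).inv (H.obj w) :
        (⟨x ⊙ₗ G.obj a.snd, H.obj w⟩ : TSum P M' N') ⟶ _) ≫
          inl (G.lam x a.snd).hom (H.obj w) = 𝟙 _ := by
      rw [TSum.inl_comp, Iso.inv_hom_id, TSum.inl_id]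
    rw [TSum.assoc_move, h3]
    refine Eq.trans ?_ ((F.sumMap_comp (G.sum H) _ _).trans (comp_congr h1 h2)).symm
    change _ = (inl (F.lam x a.fst).hom (⟨G.obj a.snd, H.obj w⟩ : TSum P M' N') ≫
      moveIn x (F.obj a.fst) (⟨G.obj a.snd, H.obj w⟩ : TSum P M' N') ≫
        inr (F.obj a.fst) (inl (G.lam x a.snd).inv (H.obj w))) ≫
      inr (F.obj a.fst) (inl (G.lam x a.snd).hom (H.obj w) ≫ move x (G.obj a.snd) (H.obj w) ≫
        inr (G.obj a.snd) (H.lam x w).inv)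
    have h5 : (inr (F.obj a.fst) (inl (G.lam x a.snd).inv (H.obj w)) :
        (_ : TSum P L' (TSum P M' N')) ⟶ _) ≫
        inr (F.obj a.fst) (inl (G.lam x a.snd).hom (H.obj w) ≫ move x (G.obj a.snd) (H.obj w) ≫
          inr (G.obj a.snd) (H.lam x w).inv) =
        inr (F.obj a.fst) (move x (G.obj a.snd) (H.obj w)) ≫
          inr (F.obj a.fst) (inr (G.obj a.snd) (H.lam x w).inv) := by
      rw [TSum.inr_comp, TSum.inr_comp, reassoc_of% h4]
    refine Eq.trans ?_ (Category.assoc _ _ _).symm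
    congr 1
    exact ((Category.assoc _ _ _).trans (congrArg _ h5.symm)).trans (Category.assoc _ _ _).symm

theorem LinFun.id_sumMap_id {a b : TSum P L M} (m : a ⟶ b) :
    (LinFun.id (P := P) (L := L)).sumMap (LinFun.id (P := P) (L := M)) m = m := by
  induction m using TSum.hom_induction with
  | comp m n hm hn => rw [LinFun.sumMap_comp, hm, hn]; rfl
  | inl f w => rw [LinFun.sumMap_inl]; rfl
  | inr a g => rw [LinFun.sumMap_inr]; rfl
  | move x v w =>
    rw [LinFun.sumMap_move]
    change inl (𝟙 _) w ≫ move x v w ≫ inr v (𝟙 _) = _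
    rw [TSum.inl_id, TSum.inr_id]
    exact (Category.id_comp _).trans (Category.comp_id _)

theorem LinFun.Z_sumMap_id (z : P) {a b : TSum P L M} (m : a ⟶ b) :
    ((LinFun.Z P L).obj z).sumMap (LinFun.id (P := P) (L := M)) m = actR z m := by
  induction m using TSum.hom_induction with
  | comp m n hm hn => rw [LinFun.sumMap_comp, TSum.actR_comp, hm, hn]; rfl
  | inl f w => rw [LinFun.sumMap_inl, TSum.actR_inl]; rfl
  | inr a g => rw [LinFun.sumMap_inr, TSum.actR_inr]; rfl
  | move x v w =>
    rw [LinFun.sumMap_move, TSum.actR_move]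
    change inl (actSwap z x v).hom w ≫ move x (z ⊙ₗ v) w ≫ inr (z ⊙ₗ v) (𝟙 (x ⊙ₗ w)) = _
    rw [TSum.inr_id, Category.comp_id]

/-- Translating the second summand is conjugate, through `move`, to translating the first. On the
generator `move` itself this is the interchange of two moves, `TSum.move_move`. -/
theorem LinFun.move_id_sumMap_Z (z : P) {a b : TSum P L M} (m : a ⟶ b) :
    move z a.fst a.snd ≫ (LinFun.id (P := P) (L := L)).sumMap ((LinFun.Z P M).obj z) m =
      actR z m ≫ move z b.fst b.snd := by
  induction m using TSum.hom_induction with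
  | comp m n hm hn =>
    have h := comp_congr (rfl : actR z m = _) hn
    have h' := congrArg (fun k => k ≫ LinFun.id.sumMap ((LinFun.Z P M).obj z) n) hm
    rw [LinFun.sumMap_comp, TSum.actR_comp, Category.assoc]
    exact (Category.assoc _ _ _).symm.trans (h'.trans ((Category.assoc _ _ _).trans h))
  | inl f w => rw [LinFun.sumMap_inl, TSum.actR_inl]; exact (TSum.move_left z f w).symm
  | inr a g => rw [LinFun.sumMap_inr, TSum.actR_inr]; exact (TSum.move_right z a g).symm
  | move x v w =>
    rw [LinFun.sumMap_move, TSum.actR_move]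
    change move z (x ⊙ₗ v) w ≫ inl (𝟙 (x ⊙ₗ v)) (z ⊙ₗ w) ≫ move x v (z ⊙ₗ w) ≫
      inr v (actSwap z x w).inv = _
    have h : (inr v (actSwap z x w).hom : (⟨v, z ⊙ₗ x ⊙ₗ w⟩ : TSum P L M) ⟶ _) ≫
      inr v (actSwap z x w).inv = 𝟙 _ := by rw [TSum.inr_comp, Iso.hom_inv_id, TSum.inr_id]
    rw [TSum.inl_id, Category.id_comp, ← reassoc_of% (TSum.move_move z x v w), h,
      Category.comp_id, Category.assoc]

open TSum (swap_comp swap_inl swap_inr swap_move assoc_comp assoc_inl assoc_inr assoc_move)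

theorem TSum.assoc_inv {a b : TSum P (TSum P L M) N} (m : a ⟶ b) :
    TSum.assoc (inv m) = inv (TSum.assoc m) := by
  apply IsIso.eq_inv_of_hom_inv_id
  rw [← assoc_comp, IsIso.hom_inv_id, assoc_id]

theorem TSum.swap_inv {a b : TSum P L M} (m : a ⟶ b) : swap (inv m) = inv (swap m) := by
  apply IsIso.eq_inv_of_hom_inv_id
  rw [← swap_comp, IsIso.hom_inv_id, swap_id]

theorem assocMap_inv {a b : TSum P L M} (m : a ⟶ b) (w : N) :
    assocMap (inv m) w = inv (assocMap m w) := by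
  apply IsIso.eq_inv_of_hom_inv_id
  rw [← assocMap_comp, IsIso.hom_inv_id, assocMap_id]

/-- The instances of `IsIso` are independent variables, so that it applies whichever way
invertibility was inferred on the two sides. -/
theorem inv_congr {C : Type u} [Category.{max u v} C] {a b : C} {f f' : a ⟶ b} {_ : IsIso f}
    {_ : IsIso f'} (h : f = f') : inv f = inv f' := by subst h; rfl

theorem sumComm_sumMap_id_move (x : P) (a : TSum P L M) (w : N) :
    (sumComm (P := P) (L := L) (M := M)).sumMap LinFun.id (move x a w) =
      inl (inv (move x a.snd a.fst)) w ≫ move x (⟨a.snd, a.fst⟩ : TSum P M L) w := by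
  rw [LinFun.sumMap_move]
  change _ ≫ move x (⟨a.snd, a.fst⟩ : TSum P M L) w ≫ inr _ (𝟙 _) = _
  rw [TSum.inr_id, Category.comp_id]
  rfl

theorem id_sumMap_sumComm_move (x : P) (v : L) (a : TSum P M N) :
    (LinFun.id (P := P) (L := L)).sumMap sumComm (move x v a) =
      move x v (⟨a.snd, a.fst⟩ : TSum P N M) ≫ inr v (move x a.snd a.fst) := by
  rw [LinFun.sumMap_move]
  change inl (𝟙 _) _ ≫ move x v (⟨a.snd, a.fst⟩ : TSum P N M) ≫ _ = _
  rw [TSum.inl_id, Category.id_comp]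
  congr 2

/-- The hexagon for morphisms of the inner sum of the first two summands, with the third object
fixed. A `move` from the first summand to the second is sent by both routes to the inverse of the
same `assocMove`. -/
theorem TSum.assoc_swap_assocMap {a b : TSum P L M} (m : a ⟶ b) (w : N) :
    TSum.assoc (swap (assocMap m w)) =
      (LinFun.id (P := P)).sumMap sumComm (assocMap (swap m) w) := by
  induction m using TSum.hom_induction with
  | comp m n hm hn =>
    rw [assocMap_comp, swap_comp, TSum.assoc_comp, swap_comp, assocMap_comp, LinFun.sumMap_comp]
    exact comp_congr hm hn
  | inl f v =>
    rw [assocMap_inl, swap_inl, swap_inl, assocMap_inr, LinFun.sumMap_inr, assoc_inr]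
    exact congrArg (inr v) (swap_inl f w).symm
  | inr v f => 
    rw [assocMap_inr, swap_inr, swap_inr, assocMap_inl, LinFun.sumMap_inl, assoc_inl, assocMap_inl]
    rfl
  | move x v w' =>
    have h1 : TSum.assoc (inv (move x (⟨w', w⟩ : TSum P M N) v)) =
        inv (assocMove x (⟨w', w⟩ : TSum P M N) v) := by rw [assoc_inv, assoc_move]
    have h2 : (LinFun.id (P := P)).sumMap sumComm (inv (moveIn x w' (⟨v, w⟩ : TSum P L N))) =
        inv (assocMove x (⟨w', w⟩ : TSum P M N) v) := by
      rw [LinFun.sumMap_inv]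
      exact inv_congr (id_sumMap_sumComm_move x w' (⟨v, w⟩ : TSum P L N))
    rw [assocMap_move, swap_move, assocMap_inv, assocMap_move]
    exact ((congrArg TSum.assoc (swap_move x v (⟨w', w⟩ : TSum P M N))).trans h1).trans h2.symm

/-- On objects both routes send ((v₁, v₂), w) to (v₂, (w, v₁)), so the hexagon asserts an equality
of two functors on morphisms, and generators suffice. -/
theorem TSum.hexagon {a b : TSum P (TSum P L M) N} (m : a ⟶ b) :
    TSum.assoc (swap (TSum.assoc m)) =
      (LinFun.id (P := P)).sumMap sumComm (TSum.assoc (sumComm.sumMap LinFun.id m)) := by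
  induction m using TSum.hom_induction with
  | comp m n hm hn =>
    rw [TSum.assoc_comp, swap_comp, TSum.assoc_comp, LinFun.sumMap_comp, TSum.assoc_comp,
      LinFun.sumMap_comp]
    exact comp_congr hm hn
  | inl f w =>
    rw [assoc_inl, LinFun.sumMap_inl, assoc_inl]
    exact assoc_swap_assocMap f w
  | inr a g =>
    rw [assoc_inr, swap_inr, assoc_inl, assocMap_inr, LinFun.sumMap_inr, assoc_inr,
      LinFun.sumMap_inr]
    exact congrArg (inr a.snd) (swap_inr a.fst g).symm
  | move x a w =>
    have h1 : TSum.assoc (swap (moveIn x a.fst (⟨a.snd, w⟩ : TSum P M N))) =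
        inv (assocMove x (⟨a.snd, w⟩ : TSum P M N) a.fst) := by
      refine (congrArg TSum.assoc (swap_move x a.fst (⟨a.snd, w⟩ : TSum P M N))).trans ?_
      rw [assoc_inv]
      exact inv_congr (assoc_move x _ _)
    have h2 : TSum.assoc (swap (inr a.fst (move x a.snd w))) =
        moveIn x a.snd (⟨w, a.fst⟩ : TSum P N L) := by
      rw [swap_inr, assoc_inl, assocMap_move]
    -- Reassociated, the move from the first to the third summand passes through the second. The
    -- exchange inverts the whole passage to the third summand up to its first leg, so only the
    -- inverse of the move between the first and the third summand survives.
    have h3 : TSum.assoc (swap (TSum.assoc (move x a w))) =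
        inr a.snd (inv (move x w a.fst)) := by
      rw [assoc_move, assocMove, swap_comp, assoc_comp]
      refine (comp_congr h1 h2).trans ?_
      rw [IsIso.inv_comp_eq]
      change _ = (_ ≫ _) ≫ _
      rw [Category.assoc, TSum.inr_comp, IsIso.hom_inv_id, TSum.inr_id]
      exact (Category.comp_id _).symm
    have h4 : TSum.assoc (sumComm.sumMap LinFun.id (move x a w)) =
        inr a.snd (move x a.fst w) := by
      refine (congrArg TSum.assoc (sumComm_sumMap_id_move x a w)).trans ?_
      refine (assoc_comp (inl (inv (move x a.snd a.fst)) w)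
        (move x (⟨a.snd, a.fst⟩ : TSum P M L) w)).trans ?_
      rw [assoc_inl, assoc_move, assocMap_inv, assocMap_move, IsIso.inv_comp_eq]
      rfl
    have h5 : (LinFun.id (P := P)).sumMap sumComm (inr a.snd (move x a.fst w)) =
        inr a.snd (inv (move x w a.fst)) :=
      (LinFun.sumMap_inr _ _ _ _).trans (congrArg (inr a.snd) (swap_move x a.fst w))
    rw [h3]
    exact h5.symm.trans (congrArg (LinFun.id.sumMap sumComm) h4).symm

end SumCalculus

end PicExt

/-! ### Functors acting on one summand, and 2-morphisms on sums. -/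

namespace PicExt

open scoped MonoidalLeftAction

section SumCalculus

variable {P : Type u} [Category.{v} P] [MonoidalCategory P] [SymmetricCategory P]
  [IsPicardGroupoid P]
variable {L M N L' M' N' L'' M'' : Type u}
  [Category.{max u v} L] [Category.{max u v} M] [Category.{max u v} N]
  [Category.{max u v} L'] [Category.{max u v} M'] [Category.{max u v} N']
  [Category.{max u v} L''] [Category.{max u v} M'']
  [MonoidalLeftAction P L] [MonoidalLeftAction P M] [MonoidalLeftAction P N]
  [MonoidalLeftAction P L'] [MonoidalLeftAction P M'] [MonoidalLeftAction P N']
  [MonoidalLeftAction P L''] [MonoidalLeftAction P M'']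
  [IsGroupoid L] [IsGroupoid M] [IsGroupoid N] [IsGroupoid L'] [IsGroupoid M'] [IsGroupoid N']
  [IsGroupoid L''] [IsGroupoid M'']

open TSum (inl inr move actR swap swap_comp swap_inl swap_inr swap_move assoc_comp assoc_inl
  assoc_inr assoc_move)

/-- The functor `F + id` on morphisms. -/
def LinFun.mapL (F : LinFun P L L') {a b : TSum P L M} (m : a ⟶ b) :
    (⟨F.obj a.fst, a.snd⟩ : TSum P L' M) ⟶ ⟨F.obj b.fst, b.snd⟩ :=
  F.sumMap LinFun.id m

/-- The functor `id + G` on morphisms. -/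
def LinFun.mapR (G : LinFun P M M') {a b : TSum P L M} (m : a ⟶ b) :
    (⟨a.fst, G.obj a.snd⟩ : TSum P L M') ⟶ ⟨b.fst, G.obj b.snd⟩ :=
  LinFun.id.sumMap G m

/-- The functor `F + (G + H)` on morphisms. -/
def LinFun.sumMap₃ (F : LinFun P L L') (G : LinFun P M M') (H : LinFun P N N')
    {a b : TSum P L (TSum P M N)} (m : a ⟶ b) :
    (⟨F.obj a.fst, ⟨G.obj a.snd.fst, H.obj a.snd.snd⟩⟩ : TSum P L' (TSum P M' N')) ⟶
      ⟨F.obj b.fst, ⟨G.obj b.snd.fst, H.obj b.snd.snd⟩⟩ :=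
  F.sumMap (G.sum H) m

/-- The functor `((v₁, v₂), w) ↦ ((v₂, v₁), w)` on morphisms. -/
noncomputable def TSum.swapL {a b : TSum P (TSum P L M) N} (m : a ⟶ b) :
    (⟨⟨a.fst.snd, a.fst.fst⟩, a.snd⟩ : TSum P (TSum P M L) N) ⟶
      ⟨⟨b.fst.snd, b.fst.fst⟩, b.snd⟩ :=
  sumComm.sumMap LinFun.id m

/-- The functor `(v, (w₁, w₂)) ↦ (v, (w₂, w₁))` on morphisms. -/
noncomputable def TSum.swapR {a b : TSum P L (TSum P M N)} (m : a ⟶ b) :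
    (⟨a.fst, ⟨a.snd.snd, a.snd.fst⟩⟩ : TSum P L (TSum P N M)) ⟶
      ⟨b.fst, ⟨b.snd.snd, b.snd.fst⟩⟩ :=
  LinFun.id.sumMap sumComm m

open TSum (swapL swapR)

theorem LinFun.mapL_comp (F : LinFun P L L') {a b c : TSum P L M} (m : a ⟶ b) (n : b ⟶ c) :
    F.mapL (m ≫ n) = F.mapL m ≫ F.mapL n := F.sumMap_comp LinFun.id m n

theorem LinFun.mapL_inl (F : LinFun P L L') {v v' : L} (f : v ⟶ v') (w : M) :
    F.mapL (inl f w) = inl (F.map f) w := F.sumMap_inl LinFun.id f w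

theorem LinFun.mapL_inr (F : LinFun P L L') (v : L) {w w' : M} (g : w ⟶ w') :
    F.mapL (inr v g) = inr (F.obj v) g := F.sumMap_inr LinFun.id v g

theorem LinFun.mapL_move (F : LinFun P L L') (x : P) (v : L) (w : M) :
    F.mapL (move x v w) = inl (F.lam x v).hom w ≫ move x (F.obj v) w := by
  refine (F.sumMap_move LinFun.id x v w).trans ?_
  change inl (F.lam x v).hom w ≫ move x (F.obj v) w ≫ inr (F.obj v) (𝟙 (x ⊙ₗ w)) = _
  rw [TSum.inr_id, Category.comp_id]

theorem LinFun.mapR_comp (G : LinFun P M M') {a b c : TSum P L M} (m : a ⟶ b) (n : b ⟶ c) :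
    G.mapR (m ≫ n) = G.mapR m ≫ G.mapR n := LinFun.id.sumMap_comp G m n

theorem LinFun.mapR_inl (G : LinFun P M M') {v v' : L} (f : v ⟶ v') (w : M) :
    G.mapR (inl f w) = inl f (G.obj w) := LinFun.id.sumMap_inl G f w

theorem LinFun.mapR_inr (G : LinFun P M M') (v : L) {w w' : M} (g : w ⟶ w') :
    G.mapR (inr v g) = inr v (G.map g) := LinFun.id.sumMap_inr G v g

theorem LinFun.mapR_move (G : LinFun P M M') (x : P) (v : L) (w : M) :
    G.mapR (move x v w) = move x v (G.obj w) ≫ inr v (G.lam x w).inv := by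
  refine (LinFun.id.sumMap_move G x v w).trans ?_
  change inl (𝟙 (x ⊙ₗ v)) (G.obj w) ≫ move x v (G.obj w) ≫ inr v (G.lam x w).inv = _
  rw [TSum.inl_id, Category.id_comp]

/-- Functoriality of F ↦ F + id. On a `move` the two constraints compose to the constraint of the
composite. -/
theorem LinFun.mapL_mapL (F : LinFun P L L') (F' : LinFun P L' L'') {a b : TSum P L M}
    (m : a ⟶ b) : F'.mapL (F.mapL m) = (F.comp F').mapL m := by
  induction m using TSum.hom_induction with
  | comp m n hm hn => rw [mapL_comp, mapL_comp, mapL_comp, hm, hn]; rfl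
  | inl f w => rw [mapL_inl, mapL_inl, mapL_inl]; rfl
  | inr a g => rw [mapL_inr, mapL_inr, mapL_inr]; rfl
  | move x v w =>
    rw [mapL_move, mapL_comp, mapL_inl, mapL_move, mapL_move, TSum.inl_comp']
    rfl

theorem LinFun.mapR_mapR (G : LinFun P M M') (G' : LinFun P M' M'') {a b : TSum P L M}
    (m : a ⟶ b) : G'.mapR (G.mapR m) = (G.comp G').mapR m := by
  induction m using TSum.hom_induction with
  | comp m n hm hn => rw [mapR_comp, mapR_comp, mapR_comp, hm, hn]; rfl
  | inl f w => rw [mapR_inl, mapR_inl, mapR_inl]; rfl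
  | inr a g => rw [mapR_inr, mapR_inr, mapR_inr]; rfl
  | move x v w =>
    rw [mapR_move, mapR_comp, mapR_inr, mapR_move, mapR_move, Category.assoc, TSum.inr_comp]
    rfl

theorem LinFun.sumMap_eq (F : LinFun P L L') (G : LinFun P M M') {a b : TSum P L M}
    (m : a ⟶ b) : F.sumMap G m = G.mapR (F.mapL m) := by
  induction m using TSum.hom_induction with
  | comp m n hm hn => rw [mapL_comp, mapR_comp, sumMap_comp, hm, hn]
  | inl f w => rw [mapL_inl, mapR_inl, sumMap_inl]
  | inr a g => rw [mapL_inr, mapR_inr, sumMap_inr]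
  | move x v w => rw [mapL_move, mapR_comp, mapR_inl, mapR_move, sumMap_move]

/-- A 2-morphism F ⟶ F' induces a natural transformation from F + G to F' + G. Naturality on `inl`
is that of `η`; naturality on `move` is exactly the compatibility of `η` with the action. -/
theorem LinFun.Hom.sumMap_inl {F F' : LinFun P L L'} (η : F.Hom F') (G : LinFun P M M')
    {a b : TSum P L M} (m : a ⟶ b) :
    F.sumMap G m ≫ inl (η.app b.fst) (G.obj b.snd) =
      inl (η.app a.fst) (G.obj a.snd) ≫ F'.sumMap G m := by
  induction m using TSum.hom_induction with
  | comp m n hm hn =>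
    rw [LinFun.sumMap_comp, LinFun.sumMap_comp, Category.assoc, hn, reassoc_of% hm]
  | inl f w => rw [LinFun.sumMap_inl, LinFun.sumMap_inl, TSum.inl_comp, TSum.inl_comp, η.naturality]
  | inr a g => rw [LinFun.sumMap_inr, LinFun.sumMap_inr, TSum.inl_inr]
  | move x v w =>
    rw [LinFun.sumMap_move, LinFun.sumMap_move]
    simp only [Category.assoc]
    rw [TSum.inl_comp', η.lam_comp, ← TSum.inl_comp', ← TSum.move_left', ← TSum.inl_inr]

theorem LinFun.Hom.sumMap_inr {G G' : LinFun P M M'} (η : G.Hom G') (F : LinFun P L L')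
    {a b : TSum P L M} (m : a ⟶ b) :
    F.sumMap G m ≫ inr (F.obj b.fst) (η.app b.snd) =
      inr (F.obj a.fst) (η.app a.snd) ≫ F.sumMap G' m := by
  induction m using TSum.hom_induction with
  | comp m n hm hn =>
    rw [LinFun.sumMap_comp, LinFun.sumMap_comp, Category.assoc, hn, reassoc_of% hm]
  | inl f w => rw [LinFun.sumMap_inl, LinFun.sumMap_inl, TSum.inl_inr]
  | inr a g => rw [LinFun.sumMap_inr, LinFun.sumMap_inr, TSum.inr_comp, TSum.inr_comp, η.naturality]
  | move x v w =>
    have h := TSum.move_right x (F.obj v) (η.app w)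
    have h2 : (G.lam x w).inv ≫ η.app (x ⊙ₗ w) = x ⊴ₗ η.app w ≫ (G'.lam x w).inv := by
      rw [Iso.inv_comp_eq, ← reassoc_of% η.lam_comp, Iso.hom_inv_id, Category.comp_id]
    rw [LinFun.sumMap_move, LinFun.sumMap_move]
    simp only [Category.assoc]
    rw [TSum.inr_comp, h2, ← reassoc_of% TSum.inl_inr, reassoc_of% h, TSum.inr_comp]

theorem LinFun.Hom.mapL_inl {F F' : LinFun P L L'} (η : F.Hom F')
    {a b : TSum P L M} (m : a ⟶ b) :
    F.mapL m ≫ inl (η.app b.fst) b.snd = inl (η.app a.fst) a.snd ≫ F'.mapL m :=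
  η.sumMap_inl LinFun.id m

theorem LinFun.Hom.mapR_inr {G G' : LinFun P M M'} (η : G.Hom G') {a b : TSum P L M} (m : a ⟶ b) :
    G.mapR m ≫ inr b.fst (η.app b.snd) = inr a.fst (η.app a.snd) ≫ G'.mapR m :=
  η.sumMap_inr LinFun.id m

theorem TSum.swap_mapR (G : LinFun P M M') {a b : TSum P L M} (m : a ⟶ b) :
    swap (G.mapR m) = G.mapL (swap m) := TSum.swap_sumMap LinFun.id G m

theorem TSum.assoc_swap_assoc {a b : TSum P (TSum P L M) N} (m : a ⟶ b) :
    TSum.assoc (swap (TSum.assoc m)) = swapR (TSum.assoc (swapL m)) := TSum.hexagon m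

theorem TSum.swapL_comp {a b c : TSum P (TSum P L M) N} (m : a ⟶ b) (n : b ⟶ c) :
    swapL (m ≫ n) = swapL m ≫ swapL n := LinFun.sumMap_comp _ _ m n

theorem TSum.swapR_comp {a b c : TSum P L (TSum P M N)} (m : a ⟶ b) (n : b ⟶ c) :
    swapR (m ≫ n) = swapR m ≫ swapR n := LinFun.sumMap_comp _ _ m n

theorem TSum.swapL_inl {a b : TSum P L M} (m : a ⟶ b) (w : N) :
    swapL (inl m w) = inl (swap m) w := LinFun.sumMap_inl _ _ m w

theorem TSum.swapR_inl {v v' : L} (f : v ⟶ v') (w : TSum P M N) :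
    swapR (inl f w) = inl f (⟨w.snd, w.fst⟩ : TSum P N M) := LinFun.sumMap_inl _ _ f w

theorem TSum.swapR_inr (v : L) {a b : TSum P M N} (m : a ⟶ b) :
    swapR (inr v m) = inr v (swap m) := LinFun.sumMap_inr _ _ v m

theorem TSum.swapL_mapL (F : LinFun P L'' (TSum P L M)) {a b : TSum P L'' N} (m : a ⟶ b) :
    swapL (F.mapL m) = (F.comp sumComm).mapL m := LinFun.mapL_mapL F sumComm m

theorem TSum.swapR_mapR (G : LinFun P L'' (TSum P M N)) {a b : TSum P L L''} (m : a ⟶ b) :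
    swapR (G.mapR m) = (G.comp sumComm).mapR m := LinFun.mapR_mapR G sumComm m

theorem TSum.mapL_Z (z : P) {a b : TSum P L M} (m : a ⟶ b) :
    ((LinFun.Z P L).obj z).mapL m = actR z m := LinFun.Z_sumMap_id z m

/-- The constraint of `sumAssoc` consists of identities, so its linearity is a strict equality on
morphisms. The same happens for id + C in `TSum.actR_swapR`, since the constraint of a sum of
1-morphisms comes from the first of them. -/
theorem TSum.actR_assoc (z : P) {a b : TSum P (TSum P L M) N} (m : a ⟶ b) :
    actR z (TSum.assoc m) = TSum.assoc (actR z m) := by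
  refine (Category.id_comp _).symm.trans ?_
  refine (sumAssoc.lam_natural_right z m).symm.trans ?_
  exact Category.comp_id _

theorem TSum.actR_swapR (z : P) {a b : TSum P L (TSum P M N)} (m : a ⟶ b) :
    actR z (swapR m) = swapR (actR z m) := by
  have h : ∀ c : TSum P L (TSum P M N),
      ((LinFun.id (P := P)).sum sumComm).lam z c = Iso.refl _ := fun c => Iso.ext (TSum.inl_id _ _)
  have h1 := ((LinFun.id (P := P)).sum sumComm).lam_natural_right z m
  rw [h, h] at h1
  exact (Category.id_comp _).symm.trans (h1.symm.trans (Category.comp_id _))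

end SumCalculus

end PicExt

/-! ### Threefold sums, 1-morphisms into sums, and the data of an exchange. -/

namespace PicExt

open scoped MonoidalLeftAction

section SumCalculus

variable {P : Type u} [Category.{v} P] [MonoidalCategory P] [SymmetricCategory P]
  [IsPicardGroupoid P]
variable {L M N L' M' N' L'' M'' : Type u}
  [Category.{max u v} L] [Category.{max u v} M] [Category.{max u v} N]
  [Category.{max u v} L'] [Category.{max u v} M'] [Category.{max u v} N']
  [Category.{max u v} L''] [Category.{max u v} M'']
  [MonoidalLeftAction P L] [MonoidalLeftAction P M] [MonoidalLeftAction P N]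
  [MonoidalLeftAction P L'] [MonoidalLeftAction P M'] [MonoidalLeftAction P N']
  [MonoidalLeftAction P L''] [MonoidalLeftAction P M'']
  [IsGroupoid L] [IsGroupoid M] [IsGroupoid N] [IsGroupoid L'] [IsGroupoid M'] [IsGroupoid N']
  [IsGroupoid L''] [IsGroupoid M'']

open TSum (inl inr move actR swap swapL swapR swap_comp swap_inl swap_inr swap_move assoc_comp
  assoc_inl
  assoc_inr assoc_move)

theorem LinFun.sumMap₃_comp (F : LinFun P L L') (G : LinFun P M M') (H : LinFun P N N')
    {a b c : TSum P L (TSum P M N)} (m : a ⟶ b) (n : b ⟶ c) :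
    F.sumMap₃ G H (m ≫ n) = F.sumMap₃ G H m ≫ F.sumMap₃ G H n := F.sumMap_comp (G.sum H) m n

theorem LinFun.sumMap₃_id (F : LinFun P L L') (G : LinFun P M M') (H : LinFun P N N')
    (a : TSum P L (TSum P M N)) : F.sumMap₃ G H (𝟙 a) = 𝟙 _ := F.sumMap_id (G.sum H) a

theorem LinFun.sumMap₃_inv (F : LinFun P L L') (G : LinFun P M M') (H : LinFun P N N')
    {a b : TSum P L (TSum P M N)} (m : a ⟶ b) :
    F.sumMap₃ G H (inv m) = inv (F.sumMap₃ G H m) := F.sumMap_inv (G.sum H) m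

theorem LinFun.sumMap₃_inl (F : LinFun P L L') (G : LinFun P M M') (H : LinFun P N N')
    {v v' : L} (f : v ⟶ v') (a : TSum P M N) :
    F.sumMap₃ G H (inl f a) = inl (F.map f) (⟨G.obj a.fst, H.obj a.snd⟩ : TSum P M' N') :=
  F.sumMap_inl (G.sum H) f a

theorem LinFun.sumMap₃_inr (F : LinFun P L L') (G : LinFun P M M') (H : LinFun P N N')
    (v : L) {a b : TSum P M N} (m : a ⟶ b) :
    F.sumMap₃ G H (inr v m) = inr (F.obj v) (G.sumMap H m) := F.sumMap_inr (G.sum H) v m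

theorem LinFun.sumMap₃_move (F : LinFun P L L') (G : LinFun P M M') (H : LinFun P N N')
    (x : P) (v : L) (a : TSum P M N) :
    F.sumMap₃ G H (moveIn x v a) =
      inl (F.lam x v).hom (⟨G.obj a.fst, H.obj a.snd⟩ : TSum P M' N') ≫
        moveIn x (F.obj v) (⟨G.obj a.fst, H.obj a.snd⟩ : TSum P M' N') ≫
          inr (F.obj v) (inl (G.lam x a.fst).inv (H.obj a.snd)) :=
  F.sumMap_move (G.sum H) x v a

theorem LinFun.sumMap₃_assocMap (F : LinFun P L L') (G : LinFun P M M') (H : LinFun P N N')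
    {a b : TSum P L M} (m : a ⟶ b) (w : N) :
    F.sumMap₃ G H (assocMap m w) = assocMap (F.sumMap G m) (H.obj w) :=
  (assocMap_sumMap F G H m w).symm

theorem LinFun.sumMap₃_assoc (F : LinFun P L L') (G : LinFun P M M') (H : LinFun P N N')
    {a b : TSum P (TSum P L M) N} (m : a ⟶ b) :
    F.sumMap₃ G H (TSum.assoc m) = TSum.assoc ((F.sum G).sumMap H m) :=
  (TSum.assoc_sumMap F G H m).symm

/-- Combines the naturality of the two constraints of sums, for the cyclic rotation (w, (v₁, v₂)) ↦
(v₁, (v₂, w)). -/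
theorem LinFun.sumMap₃_assoc_swap (F : LinFun P L L') (G : LinFun P M M') (H : LinFun P N N')
    {a b : TSum P N (TSum P L M)} (m : a ⟶ b) :
    F.sumMap₃ G H (TSum.assoc (swap m)) = TSum.assoc (swap (H.sumMap₃ F G m)) :=
  (F.sumMap₃_assoc G H (swap m)).trans
    (congrArg TSum.assoc (TSum.swap_sumMap H (F.sum G) m).symm)

theorem TSum.swapR_move (x : P) (v : L) (a : TSum P M N) :
    swapR (move x v a) = move x v (⟨a.snd, a.fst⟩ : TSum P N M) ≫ inr v (move x a.snd a.fst) :=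
  id_sumMap_sumComm_move x v a

theorem LinFun.sumMap₃_swapR (F : LinFun P L L') (G : LinFun P M M') (H : LinFun P N N')
    {a b : TSum P L (TSum P M N)} (m : a ⟶ b) :
    F.sumMap₃ H G (swapR m) = swapR (F.sumMap₃ G H m) := by
  induction m using TSum.hom_induction with
  | comp m n hm hn =>
    rw [TSum.swapR_comp, sumMap₃_comp, sumMap₃_comp, TSum.swapR_comp, hm, hn]
  | inl f w => rw [TSum.swapR_inl, sumMap₃_inl, sumMap₃_inl, TSum.swapR_inl]
  | inr v m => rw [TSum.swapR_inr, sumMap₃_inr, sumMap₃_inr, TSum.swapR_inr, TSum.swap_sumMap]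
  | move x v a =>
    have h1 : swapR (moveIn x v a) =
        moveIn x v (⟨a.snd, a.fst⟩ : TSum P N M) ≫ inr v (move x a.snd a.fst) :=
      TSum.swapR_move x v a
    have h2 : swapR (moveIn x (F.obj v) (⟨G.obj a.fst, H.obj a.snd⟩ : TSum P M' N')) =
        moveIn x (F.obj v) (⟨H.obj a.snd, G.obj a.fst⟩ : TSum P N' M') ≫
          inr (F.obj v) (move x (H.obj a.snd) (G.obj a.fst)) :=
      TSum.swapR_move x (F.obj v) (⟨G.obj a.fst, H.obj a.snd⟩ : TSum P M' N')
    have h4 : (inl (H.lam x a.snd).inv (G.obj a.fst) :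
        (⟨x ⊙ₗ H.obj a.snd, G.obj a.fst⟩ : TSum P N' M') ⟶ _) ≫
          inl (H.lam x a.snd).hom (G.obj a.fst) = 𝟙 _ := by
      rw [TSum.inl_comp, Iso.inv_hom_id, TSum.inl_id]
    have h3 : F.sumMap₃ H G (swapR (moveIn x v a)) = swapR (F.sumMap₃ G H (moveIn x v a)) := by
      rw [h1, sumMap₃_comp, sumMap₃_move, sumMap₃_inr, sumMap_move, sumMap₃_move,
        TSum.swapR_comp, TSum.swapR_comp, h2, TSum.swapR_inl, TSum.swapR_inr, swap_inl]
      simp only [Category.assoc]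
      rw [TSum.inr_comp, reassoc_of% h4, TSum.inr_comp]
    exact h3

theorem LinFun.sumMap_actR (F : LinFun P L L') (G : LinFun P M M') (z : P) {a b : TSum P L M}
    (m : a ⟶ b) : F.sumMap G (actR z m) ≫ inl (F.lam z b.fst).hom (G.obj b.snd) =
      inl (F.lam z a.fst).hom (G.obj a.snd) ≫ actR z (F.sumMap G m) :=
  (F.sum G).lam_natural_right z m

theorem LinFun.mapL_actR (F : LinFun P L L') (z : P) {a b : TSum P L M}
    (m : a ⟶ b) : F.mapL (actR z m) ≫ inl (F.lam z b.fst).hom b.snd =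
      inl (F.lam z a.fst).hom a.snd ≫ actR z (F.mapL m) :=
  F.sumMap_actR LinFun.id z m

/-- The inverse of `moveIn`. -/
noncomputable def moveInv (x : P) (v : L) (a : TSum P M N) :
    (⟨v, ⟨x ⊙ₗ a.fst, a.snd⟩⟩ : TSum P L (TSum P M N)) ⟶ ⟨x ⊙ₗ v, a⟩ :=
  inv (moveIn x v a)

theorem moveIn_moveInv (x : P) (v : L) (a : TSum P M N) :
    moveIn x v a ≫ moveInv x v a = 𝟙 _ := IsIso.hom_inv_id _

theorem moveInv_moveIn (x : P) (v : L) (a : TSum P M N) :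
    moveInv x v a ≫ moveIn x v a = 𝟙 _ := IsIso.inv_hom_id _

/-- The constraint of a `1`-morphism to a sum. -/
def LinFun.lamHom (F : LinFun P L'' (TSum P L M)) (z : P) (v : L'') :
    F.obj (z ⊙ₗ v) ⟶ (⟨z ⊙ₗ (F.obj v).fst, (F.obj v).snd⟩ : TSum P L M) :=
  (F.lam z v).hom

/-- The inverse of `LinFun.lamHom`. -/
def LinFun.lamInv (F : LinFun P L'' (TSum P L M)) (z : P) (v : L'') :
    (⟨z ⊙ₗ (F.obj v).fst, (F.obj v).snd⟩ : TSum P L M) ⟶ F.obj (z ⊙ₗ v) :=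
  (F.lam z v).inv

theorem LinFun.lamHom_lamInv (F : LinFun P L'' (TSum P L M)) (z : P) (v : L'') :
    F.lamHom z v ≫ F.lamInv z v = 𝟙 _ := (F.lam z v).hom_inv_id

theorem LinFun.lamInv_lamHom (F : LinFun P L'' (TSum P L M)) (z : P) (v : L'') :
    F.lamInv z v ≫ F.lamHom z v = 𝟙 _ := (F.lam z v).inv_hom_id

/-- The components of a `2`-morphism between `1`-morphisms to a sum. -/
def LinFun.Hom.app₂ {A A' : Type u} [Category.{max u v} A] [Category.{max u v} A']
    [MonoidalLeftAction P A] [MonoidalLeftAction P A'] {μ : LinFun P A (TSum P L M)}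
    {μ' : LinFun P A' (TSum P L' M')} {F : LinFun P L L'} {G : LinFun P M M'}
    {Φ : LinFun P A A'} (η : (μ.comp (F.sum G)).Hom (Φ.comp μ')) (v : A) :
    (⟨F.obj (μ.obj v).fst, G.obj (μ.obj v).snd⟩ : TSum P L' M') ⟶ μ'.obj (Φ.obj v) :=
  η.app v

theorem LinFun.mapL_sumMap (F : LinFun P L L') (G : LinFun P M M') (F' : LinFun P L' L'')
    {a b : TSum P L M} (m : a ⟶ b) :
    F'.mapL (F.sumMap G m) = (F.comp F').sumMap G m := by
  induction m using TSum.hom_induction with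
  | comp m n hm hn => rw [sumMap_comp, mapL_comp, sumMap_comp, hm, hn]; rfl
  | inl f w => rw [sumMap_inl, mapL_inl, sumMap_inl]; rfl
  | inr a g => rw [sumMap_inr, mapL_inr, sumMap_inr]; rfl
  | move x v w =>
    rw [sumMap_move, mapL_comp, mapL_comp, mapL_inl, mapL_move, mapL_inr, sumMap_move,
      Category.assoc, TSum.inl_comp']
    rfl

theorem LinFun.sumMap_mapL (F : LinFun P L' L'') (G : LinFun P M M') (F' : LinFun P L L')
    {a b : TSum P L M} (m : a ⟶ b) :
    F.sumMap G (F'.mapL m) = (F'.comp F).sumMap G m := by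
  rw [sumMap_eq, mapL_mapL, sumMap_eq]
  rfl

section

variable {A A' : Type u} [Category.{max u v} A] [Category.{max u v} A']
  [MonoidalLeftAction P A] [MonoidalLeftAction P A'] [IsGroupoid A] [IsGroupoid A']
  {μ : LinFun P A (TSum P L M)}
  {μ' : LinFun P A' (TSum P L' M')} {F : LinFun P L L'} {G : LinFun P M M'}
  {Φ : LinFun P A A'} (η : (μ.comp (F.sum G)).Hom (Φ.comp μ'))

theorem LinFun.Hom.app₂_lam (z : P) (v : A) :
    η.app₂ (z ⊙ₗ v) ≫ μ'.map (Φ.lam z v).hom ≫ μ'.lamHom z (Φ.obj v) =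
      F.sumMap G (μ.lamHom z v) ≫ inl (F.lam z (μ.obj v).fst).hom (G.obj (μ.obj v).snd) ≫
        actR z (η.app₂ v) :=
  (η.lam_comp z v).trans (Category.assoc _ _ _)

/-- The compatibility of a 2-morphism with the action, solved for the inverse constraints; this is
the direction in which constraints occur in `ExchangeData.chain`. -/
theorem LinFun.Hom.app₂_lamInv (z : P) (v : A) :
    F.sumMap G (μ.lamInv z v) ≫ η.app₂ (z ⊙ₗ v) ≫ μ'.map (Φ.lam z v).hom =
      inl (F.lam z (μ.obj v).fst).hom (G.obj (μ.obj v).snd) ≫ actR z (η.app₂ v) ≫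
        μ'.lamInv z (Φ.obj v) := by
  have h := η.app₂_lam z v
  have h1 : F.sumMap G (μ.lamInv z v) ≫ F.sumMap G (μ.lamHom z v) = 𝟙 _ := by
    rw [← LinFun.sumMap_comp, LinFun.lamInv_lamHom, LinFun.sumMap_id]
  have h2 := congrArg (fun k => F.sumMap G (μ.lamInv z v) ≫ k ≫ μ'.lamInv z (Φ.obj v)) h
  simp only [Category.assoc, reassoc_of% h1, LinFun.lamHom_lamInv, Category.comp_id] at h2
  exact h2

theorem LinFun.Hom.assocMap_app₂_lamInv (H : LinFun P N N') (z : P) (v : A) (w : N) :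
    F.sumMap₃ G H (assocMap (μ.lamInv z v) w) ≫ assocMap (η.app₂ (z ⊙ₗ v)) (H.obj w) ≫
        TSum.assoc (μ'.mapL (inl (Φ.lam z v).hom (H.obj w))) =
      inl (F.lam z (μ.obj v).fst).hom (⟨G.obj (μ.obj v).snd, H.obj w⟩ : TSum P M' N') ≫
        actR z (assocMap (η.app₂ v) (H.obj w)) ≫ assocMap (μ'.lamInv z (Φ.obj v)) (H.obj w) := by
  have h := congrArg (fun k => assocMap k (H.obj w)) (η.app₂_lamInv z v)
  dsimp only at h
  rw [assocMap_comp, assocMap_comp, assocMap_comp, assocMap_comp, assocMap_inl] at h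
  rw [LinFun.sumMap₃_assocMap, LinFun.mapL_inl, assoc_inl, h, actR_assocMap]

/-- The component of `η` at an object of `A` extends to a natural transformation on A + N, which is
then reassociated. This is what permits a morphism of A + N that does not come from a morphism of
`A` alone. -/
theorem LinFun.Hom.assocMap_app₂_natural (H : LinFun P N N') {a b : TSum P A N} (m : a ⟶ b) :
    F.sumMap₃ G H (TSum.assoc (μ.mapL m)) ≫ assocMap (η.app₂ b.fst) (H.obj b.snd) =
      assocMap (η.app₂ a.fst) (H.obj a.snd) ≫ TSum.assoc (μ'.mapL (Φ.sumMap H m)) := by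
  have h1 : F.sumMap₃ G H (TSum.assoc (μ.mapL m)) =
      TSum.assoc ((μ.comp (F.sum G)).sumMap H m) :=
    (F.sumMap₃_assoc G H (μ.mapL m)).trans
      (congrArg TSum.assoc ((F.sum G).sumMap_mapL H μ m))
  have h2 : TSum.assoc ((μ.comp (F.sum G)).sumMap H m) ≫
      assocMap (η.app₂ b.fst) (H.obj b.snd) =
      TSum.assoc ((μ.comp (F.sum G)).sumMap H m ≫ inl (η.app b.fst) (H.obj b.snd)) :=
    (comp_congr rfl (assoc_inl (η.app₂ b.fst) (H.obj b.snd)).symm).trans (assoc_comp _ _).symm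
  have h3 : assocMap (η.app₂ a.fst) (H.obj a.snd) ≫ TSum.assoc (μ'.mapL (Φ.sumMap H m)) =
      TSum.assoc (inl (η.app a.fst) (H.obj a.snd) ≫ (Φ.comp μ').sumMap H m) :=
    (comp_congr (assoc_inl (η.app₂ a.fst) (H.obj a.snd)).symm
      (congrArg TSum.assoc (Φ.mapL_sumMap H μ' m))).trans
      (assoc_comp (inl (η.app₂ a.fst) (H.obj a.snd)) ((Φ.comp μ').sumMap H m)).symm
  exact (comp_congr h1 rfl).trans (h2.trans ((congrArg TSum.assoc (η.sumMap_inl H m)).trans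
      h3.symm))

/-- Linearity of μ + id on morphisms of A + N, seen after reassociation and written with inverse
constraints. -/
theorem LinFun.lamInv_natural (μ : LinFun P A (TSum P L M)) (z : P) {a b : TSum P A N}
    (m : a ⟶ b) :
    actR z (TSum.assoc (μ.mapL m)) ≫ assocMap (μ.lamInv z b.fst) b.snd =
      assocMap (μ.lamInv z a.fst) a.snd ≫ TSum.assoc (μ.mapL (actR z m)) := by
  have h : TSum.assoc (μ.mapL (actR z m)) ≫ assocMap (μ.lamHom z b.fst) b.snd =
      assocMap (μ.lamHom z a.fst) a.snd ≫ actR z (TSum.assoc (μ.mapL m)) := by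
    have h := congrArg TSum.assoc (μ.mapL_actR z m)
    have h1 := TSum.assoc_comp (μ.mapL (actR z m)) (inl (μ.lamHom z b.fst) b.snd)
    have h2 := TSum.assoc_comp (inl (μ.lamHom z a.fst) a.snd) (actR z (μ.mapL m))
    rw [TSum.assoc_inl] at h1 h2
    rw [TSum.actR_assoc]
    exact (h1.symm.trans h).trans h2
  have h3 : assocMap (μ.lamInv z a.fst) a.snd ≫ assocMap (μ.lamHom z a.fst) a.snd = 𝟙 _ := by
    rw [← assocMap_comp, lamInv_lamHom, assocMap_id]
  have h4 : assocMap (μ.lamHom z b.fst) b.snd ≫ assocMap (μ.lamInv z b.fst) b.snd = 𝟙 _ := by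
    rw [← assocMap_comp, lamHom_lamInv, assocMap_id]
  have h5 := congrArg (fun k => assocMap (μ.lamInv z a.fst) a.snd ≫ k ≫
    assocMap (μ.lamInv z b.fst) b.snd) h
  simp only [Category.assoc, h4, reassoc_of% h3, Category.comp_id] at h5
  exact h5.symm

theorem LinFun.lamInv_natural_left (μ : LinFun P A (TSum P L M)) {z z' : P} (k : z ⟶ z') (v : A) :
    inl (k ⊵ₗ (μ.obj v).fst) (μ.obj v).snd ≫ μ.lamInv z' v = μ.lamInv z v ≫ μ.map (k ⊵ₗ v) := by
  have h : μ.map (k ⊵ₗ v) ≫ μ.lamHom z' v =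
      μ.lamHom z v ≫ inl (k ⊵ₗ (μ.obj v).fst) (μ.obj v).snd := μ.lam_natural_left k v
  have h5 := congrArg (fun k => μ.lamInv z v ≫ k ≫ μ.lamInv z' v) h
  simp only [Category.assoc, lamHom_lamInv, reassoc_of% μ.lamInv_lamHom z v,
    Category.comp_id] at h5
  exact h5.symm

end

/-- The objects and morphisms from which the exchange of `G` with `B + C` is built: `1`-morphisms
decomposing the torsors `BC`, `GB`, `GC`, decompositions of one object in the four possible ways,
and the morphisms comparing them. -/
structure ExchangeData (P : Type u) [Category.{v} P] [MonoidalCategory P] [SymmetricCategory P]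
    [IsPicardGroupoid P] (B C G BC GB GC : Type u)
    [Category.{max u v} B] [Category.{max u v} C] [Category.{max u v} G]
    [Category.{max u v} BC] [Category.{max u v} GB] [Category.{max u v} GC]
    [MonoidalLeftAction P B] [MonoidalLeftAction P C] [MonoidalLeftAction P G]
    [MonoidalLeftAction P BC] [MonoidalLeftAction P GB] [MonoidalLeftAction P GC]
    [IsGroupoid B] [IsGroupoid C] [IsGroupoid G] where
  bc : LinFun P BC (TSum P B C)
  gb : LinFun P GB (TSum P G B)
  bg : LinFun P GB (TSum P B G)
  gc : LinFun P GC (TSum P G C)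
  cg : LinFun P GC (TSum P C G)
  bc_g : TSum P BC G
  g_bc : TSum P G BC
  gb_c : TSum P GB C
  b_gc : TSum P B GC
  x : P
  y : P
  z : P
  exchZ : (⟨z ⊙ₗ bc_g.fst, bc_g.snd⟩ : TSum P BC G) ⟶ ⟨g_bc.snd, g_bc.fst⟩
  exchX : (gb.comp sumComm).Hom (bg.comp ((LinFun.Z P (TSum P B G)).obj x))
  exchY : (gc.comp sumComm).Hom (cg.comp ((LinFun.Z P (TSum P C G)).obj y))
  assocGBC : (⟨(gb.obj gb_c.fst).fst, ⟨(gb.obj gb_c.fst).snd, gb_c.snd⟩⟩ :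
    TSum P G (TSum P B C)) ⟶ ⟨g_bc.fst, bc.obj g_bc.snd⟩
  assocBGC : (⟨(bg.obj gb_c.fst).fst, ⟨(bg.obj gb_c.fst).snd, gb_c.snd⟩⟩ :
    TSum P B (TSum P G C)) ⟶ ⟨b_gc.fst, gc.obj b_gc.snd⟩
  assocBCG : (⟨(bc.obj bc_g.fst).fst, ⟨(bc.obj bc_g.fst).snd, bc_g.snd⟩⟩ :
    TSum P B (TSum P C G)) ⟶ ⟨b_gc.fst, cg.obj b_gc.snd⟩

end SumCalculus

section Exchange

variable {P : Type u} [Category.{v} P] [MonoidalCategory P] [SymmetricCategory P]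
  [IsPicardGroupoid P]
variable {B C G BC GB GC B' C' G' BC' GB' GC' : Type u}
  [Category.{max u v} B] [Category.{max u v} C] [Category.{max u v} G]
  [Category.{max u v} BC] [Category.{max u v} GB] [Category.{max u v} GC]
  [MonoidalLeftAction P B] [MonoidalLeftAction P C] [MonoidalLeftAction P G]
  [MonoidalLeftAction P BC] [MonoidalLeftAction P GB] [MonoidalLeftAction P GC]
  [IsGroupoid B] [IsGroupoid C] [IsGroupoid G]
  [IsGroupoid BC] [IsGroupoid GB] [IsGroupoid GC]
  [Category.{max u v} B'] [Category.{max u v} C'] [Category.{max u v} G']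
  [Category.{max u v} BC'] [Category.{max u v} GB'] [Category.{max u v} GC']
  [MonoidalLeftAction P B'] [MonoidalLeftAction P C'] [MonoidalLeftAction P G']
  [MonoidalLeftAction P BC'] [MonoidalLeftAction P GB'] [MonoidalLeftAction P GC']
  [IsGroupoid B'] [IsGroupoid C'] [IsGroupoid G']
  [IsGroupoid BC'] [IsGroupoid GB'] [IsGroupoid GC']

open TSum (inl inr move actR swap swapL swapR swap_comp swap_inl swap_inr swap_move assoc_comp
  assoc_inl assoc_inr assoc_move)

namespace ExchangeData

/-- The image in `B + (C + G)` of the decomposed object. -/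
def base (X : ExchangeData P B C G BC GB GC) : TSum P B (TSum P C G) :=
  ⟨(X.bc.obj X.bc_g.fst).fst, ⟨(X.bc.obj X.bc_g.fst).snd, X.bc_g.snd⟩⟩

/-- The exchange of `G` with `B`, on objects. -/
def appX (X : ExchangeData P B C G BC GB GC) (p : GB) :
    (⟨(X.gb.obj p).snd, (X.gb.obj p).fst⟩ : TSum P B G) ⟶
      ⟨X.x ⊙ₗ (X.bg.obj p).fst, (X.bg.obj p).snd⟩ :=
  X.exchX.app p

/-- The exchange of `G` with `C`, on objects. -/
def appY (X : ExchangeData P B C G BC GB GC) (p : GC) :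
    (⟨(X.gc.obj p).snd, (X.gc.obj p).fst⟩ : TSum P C G) ⟶
      ⟨X.y ⊙ₗ (X.cg.obj p).fst, (X.cg.obj p).snd⟩ :=
  X.exchY.app p

/-- The second half of `ExchangeData.chain`, exchanging `G` with `C`. -/
noncomputable def chainY (X : ExchangeData P B C G BC GB GC) :
    (⟨(X.bg.obj X.gb_c.fst).fst, ⟨X.gb_c.snd, (X.bg.obj X.gb_c.fst).snd⟩⟩ :
      TSum P B (TSum P C G)) ⟶
    ⟨X.y ⊙ₗ (X.bc.obj X.bc_g.fst).fst, ⟨(X.bc.obj X.bc_g.fst).snd, X.bc_g.snd⟩⟩ :=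
  swapR X.assocBGC ≫ inr X.b_gc.fst (X.appY X.b_gc.snd) ≫
    moveInv X.y X.b_gc.fst (X.cg.obj X.b_gc.snd) ≫ actR X.y (inv X.assocBCG)

/-- The comparison of the exchange of `G` with `BC` with the successive exchanges of `G` with `B`
and with `C`. -/
noncomputable def chain (X : ExchangeData P B C G BC GB GC) :
    (⟨X.z ⊙ₗ (X.bc.obj X.bc_g.fst).fst, ⟨(X.bc.obj X.bc_g.fst).snd, X.bc_g.snd⟩⟩ :
      TSum P B (TSum P C G)) ⟶
    ⟨(X.x ⊗ X.y) ⊙ₗ (X.bc.obj X.bc_g.fst).fst, ⟨(X.bc.obj X.bc_g.fst).snd, X.bc_g.snd⟩⟩ :=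
  assocMap (X.bc.lamInv X.z X.bc_g.fst) X.bc_g.snd ≫ TSum.assoc (X.bc.mapL X.exchZ) ≫
    TSum.assoc (swap (inv X.assocGBC)) ≫ swapR (assocMap (X.appX X.gb_c.fst) X.gb_c.snd) ≫
      actR X.x X.chainY ≫ inl (αₗ X.x X.y (X.bc.obj X.bc_g.fst).fst).inv
        (⟨(X.bc.obj X.bc_g.fst).snd, X.bc_g.snd⟩ : TSum P C G)

end ExchangeData

end Exchange

end PicExt

/-! ### The action of a morphism of `P` on squares, and maps of exchange data. -/

namespace PicExt

open scoped MonoidalLeftAction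

section SumCalculus

variable {P : Type u} [Category.{v} P] [MonoidalCategory P] [SymmetricCategory P]
  [IsPicardGroupoid P]
variable {L M N L' M' N' L'' M'' : Type u}
  [Category.{max u v} L] [Category.{max u v} M] [Category.{max u v} N]
  [Category.{max u v} L'] [Category.{max u v} M'] [Category.{max u v} N']
  [Category.{max u v} L''] [Category.{max u v} M'']
  [MonoidalLeftAction P L] [MonoidalLeftAction P M] [MonoidalLeftAction P N]
  [MonoidalLeftAction P L'] [MonoidalLeftAction P M'] [MonoidalLeftAction P N']
  [MonoidalLeftAction P L''] [MonoidalLeftAction P M'']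
  [IsGroupoid L] [IsGroupoid M] [IsGroupoid N] [IsGroupoid L'] [IsGroupoid M'] [IsGroupoid N']
  [IsGroupoid L''] [IsGroupoid M'']

open TSum (inl inr move actR swap swapL swapR swap_comp swap_inl swap_inr swap_move assoc_comp
  assoc_inl
  assoc_inr assoc_move)

/-- The action of a morphism `κ : x ⟶ x'` of `P` on a morphism from the value of a `1`-morphism. -/
def LinFun.actCell (F : LinFun P L L') {x x' : P} (κ : x ⟶ x') {v : L} {w : M} {a : TSum P L' M}
    (s : (⟨F.obj v, w⟩ : TSum P L' M) ⟶ a) :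
    (⟨F.obj (x ⊙ₗ v), w⟩ : TSum P L' M) ⟶ ⟨x' ⊙ₗ a.fst, a.snd⟩ :=
  inl (F.lam x v).hom w ≫ actR x s ≫ inl (κ ⊵ₗ a.fst) a.snd

/-- The morphism κ may be applied before or after `t`, by the interchange law of the action. -/
theorem LinFun.actCell_comp (F : LinFun P L L') {x x' : P} (κ : x ⟶ x') {v : L} {w : M}
    {a b : TSum P L' M} (s : (⟨F.obj v, w⟩ : TSum P L' M) ⟶ a) (t : a ⟶ b) :
    F.actCell κ (s ≫ t) = F.actCell κ s ≫ actR x' t := by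
  simp only [actCell, TSum.actR_comp, Category.assoc]
  rw [TSum.actR_exchange]

/-- A commuting square stays commutative after x acts on its source side and x' on its target side,
joined by κ. In the chain it moves a square under the action of C₂(g, b) or C₂(g, c). -/
theorem LinFun.sumMap_actR_actCell (F : LinFun P L L') (G : LinFun P M M') {x x' : P} (κ : x ⟶ x')
    {a b : TSum P L M} {a' b' : TSum P L' M'} (e : a ⟶ b)
    (s : (⟨F.obj a.fst, G.obj a.snd⟩ : TSum P L' M') ⟶ a')
    (t : (⟨F.obj b.fst, G.obj b.snd⟩ : TSum P L' M') ⟶ b') (e' : a' ⟶ b')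
    (h : F.sumMap G e ≫ t = s ≫ e') :
    F.sumMap G (actR x e) ≫ F.actCell κ t = F.actCell κ s ≫ actR x' e' := by
  rw [← actCell_comp, ← h]
  have h1 := F.sumMap_actR G x e
  simp only [actCell, TSum.actR_comp, Category.assoc]
  rw [reassoc_of% h1]

theorem LinFun.sumMap₃_actR_actCell (F : LinFun P L L') (G : LinFun P M M') (H : LinFun P N N')
    {x x' : P} (κ : x ⟶ x')
    {a b : TSum P L (TSum P M N)} {a' b' : TSum P L' (TSum P M' N')} (e : a ⟶ b)
    (s : (⟨F.obj a.fst, ⟨G.obj a.snd.fst, H.obj a.snd.snd⟩⟩ : TSum P L' (TSum P M' N')) ⟶ a')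
    (t : (⟨F.obj b.fst, ⟨G.obj b.snd.fst, H.obj b.snd.snd⟩⟩ : TSum P L' (TSum P M' N')) ⟶ b')
    (e' : a' ⟶ b') (h : F.sumMap₃ G H e ≫ t = s ≫ e') :
    F.sumMap₃ G H (actR x e) ≫ F.actCell κ t = F.actCell κ s ≫ actR x' e' :=
  F.sumMap_actR_actCell (G.sum H) κ e s t e' h

theorem LinFun.assocMap_actCell (F : LinFun P L L') {x x' : P} (κ : x ⟶ x') {v : L} {w : M}
    {a : TSum P L' M} (s : (⟨F.obj v, w⟩ : TSum P L' M) ⟶ a) (k : N) :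
    assocMap (F.actCell κ s) k = F.actCell κ (assocMap s k) := by
  simp only [actCell, assocMap_comp, assocMap_inl, actR_assocMap]

theorem LinFun.actCell_swapR (F : LinFun P L L') {x x' : P} (κ : x ⟶ x') {v : L} {w : TSum P M N}
    {a : TSum P L' (TSum P M N)} (s : (⟨F.obj v, w⟩ : TSum P L' (TSum P M N)) ⟶ a) :
    F.actCell κ (swapR s) = swapR (F.actCell κ s) := by
  simp only [actCell, TSum.swapR_comp, TSum.swapR_inl, TSum.actR_swapR]

/-- The action of an object of `P` on the second of three summands. -/
def TSum.actIn (z : P) {a b : TSum P L (TSum P M N)} (m : a ⟶ b) :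
    (⟨a.fst, ⟨z ⊙ₗ a.snd.fst, a.snd.snd⟩⟩ : TSum P L (TSum P M N)) ⟶
      ⟨b.fst, ⟨z ⊙ₗ b.snd.fst, b.snd.snd⟩⟩ :=
  ((LinFun.Z P (TSum P M N)).obj z).mapR m

/-- Interchange for the action on the middle summand, obtained by regarding `κ` as a 2-morphism
between two translations. -/
theorem TSum.actIn_exchange {z z' : P} (κ : z ⟶ z') {a b : TSum P L (TSum P M N)} (m : a ⟶ b) :
    actIn z m ≫ inr b.fst (inl (κ ⊵ₗ b.snd.fst) b.snd.snd) =
      inr a.fst (inl (κ ⊵ₗ a.snd.fst) a.snd.snd) ≫ actIn z' m :=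
  LinFun.Hom.mapR_inr ((LinFun.Z P (TSum P M N)).map κ) m

theorem moveIn_actIn (z : P) {a b : TSum P L (TSum P M N)} (m : a ⟶ b) :
    moveIn z a.fst a.snd ≫ TSum.actIn z m = actR z m ≫ moveIn z b.fst b.snd :=
  LinFun.move_id_sumMap_Z z m

/-- Acting with a tensor product is acting twice, up to associativity. This is the square over the
last factor of `ExchangeData.chain`. It combines the compatibility of the constraint of `F` with
associativity (`h2`), the same for the action on the sum (`h4`), and naturality of the associativity
of the action in κ and κ' (`h9`). -/
theorem LinFun.map_inl_assoc_actCell (F : LinFun P L L') {x x' y y' : P} (κ : x ⟶ x')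
    (κ' : y ⟶ y') {v : L} {w : M} {a : TSum P L' M} (s : (⟨F.obj v, w⟩ : TSum P L' M) ⟶ a) :
    inl (F.map (αₗ x y v).inv) w ≫ F.actCell (κ ⊗ₘ κ') s =
      F.actCell κ (F.actCell κ' s) ≫ inl (αₗ x' y' a.fst).inv a.snd := by
  have h1 := F.lam_tensor x y v
  have h2 : F.map (αₗ x y v).inv ≫ (F.lam (x ⊗ y) v).hom =
      (F.lam x (y ⊙ₗ v)).hom ≫ x ⊴ₗ (F.lam y v).hom ≫ (αₗ x y (F.obj v)).inv := by
    rw [← cancel_epi (F.map (αₗ x y v).hom), ← cancel_mono (αₗ x y (F.obj v)).hom]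
    have h3 : F.map (αₗ x y v).hom ≫ F.map (αₗ x y v).inv = 𝟙 _ := by
      rw [← F.map_comp, Iso.hom_inv_id, F.map_id]
    simp only [Category.assoc, reassoc_of% h3, Iso.inv_hom_id, Category.comp_id, h1]
  have h4 : inl (αₗ x y (F.obj v)).inv w ≫ actR (x ⊗ y) s =
      actR x (actR y s) ≫ inl (αₗ x y a.fst).inv a.snd := by
    have h5 := TSum.actR_tensor x y s
    have h6 : (inl (αₗ x y a.fst).hom a.snd : (⟨_, a.snd⟩ : TSum P L' M) ⟶ _) ≫
        inl (αₗ x y a.fst).inv a.snd = 𝟙 _ := by rw [TSum.inl_comp, Iso.hom_inv_id, TSum.inl_id]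
    have h7 : (inl (αₗ x y (F.obj v)).inv w : (⟨_, w⟩ : TSum P L' M) ⟶ _) ≫
        inl (αₗ x y (F.obj v)).hom w = 𝟙 _ := by rw [TSum.inl_comp, Iso.inv_hom_id, TSum.inl_id]
    have h8 := congrArg (fun k => inl (αₗ x y (F.obj v)).inv w ≫ k ≫
      inl (αₗ x y a.fst).inv a.snd) h5
    simp only [Category.assoc, h6, reassoc_of% h7, Category.comp_id] at h8
    exact h8
  have h9 : (αₗ x y a.fst).inv ≫ (κ ⊗ₘ κ') ⊵ₗ a.fst =
      x ⊴ₗ κ' ⊵ₗ a.fst ≫ κ ⊵ₗ (y' ⊙ₗ a.fst) ≫ (αₗ x' y' a.fst).inv := by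
    have h := MonoidalLeftAction.actionAssocIso_inv_naturality κ κ' (𝟙 a.fst)
    simp only [MonoidalLeftAction.actionHom_id] at h
    rw [← h, MonoidalLeftAction.actionHom_def', Category.assoc]
  simp only [actCell, TSum.actR_comp, TSum.actR_inl, Category.assoc]
  rw [TSum.inl_comp', h2, ← TSum.inl_comp, Category.assoc, ← TSum.inl_comp, Category.assoc,
    reassoc_of% h4, TSum.inl_comp, h9, ← TSum.inl_comp, ← TSum.inl_comp]

end SumCalculus

section Exchange

variable {P : Type u} [Category.{v} P] [MonoidalCategory P] [SymmetricCategory P]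
  [IsPicardGroupoid P]
variable {B C G BC GB GC B' C' G' BC' GB' GC' : Type u}
  [Category.{max u v} B] [Category.{max u v} C] [Category.{max u v} G]
  [Category.{max u v} BC] [Category.{max u v} GB] [Category.{max u v} GC]
  [MonoidalLeftAction P B] [MonoidalLeftAction P C] [MonoidalLeftAction P G]
  [MonoidalLeftAction P BC] [MonoidalLeftAction P GB] [MonoidalLeftAction P GC]
  [IsGroupoid B] [IsGroupoid C] [IsGroupoid G]
  [IsGroupoid BC] [IsGroupoid GB] [IsGroupoid GC]
  [Category.{max u v} B'] [Category.{max u v} C'] [Category.{max u v} G']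
  [Category.{max u v} BC'] [Category.{max u v} GB'] [Category.{max u v} GC']
  [MonoidalLeftAction P B'] [MonoidalLeftAction P C'] [MonoidalLeftAction P G']
  [MonoidalLeftAction P BC'] [MonoidalLeftAction P GB'] [MonoidalLeftAction P GC']
  [IsGroupoid B'] [IsGroupoid C'] [IsGroupoid G']
  [IsGroupoid BC'] [IsGroupoid GB'] [IsGroupoid GC']

open TSum (inl inr move actR swap swapL swapR swap_comp swap_inl swap_inr swap_move assoc_comp
  assoc_inl assoc_inr assoc_move)


/-- The data of a morphism of exchange data, without its compatibilities. -/
structure ExchangeData.PreMap (X : ExchangeData P B C G BC GB GC)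
    (X' : ExchangeData P B' C' G' BC' GB' GC') where
  fB : LinFun P B B'
  fC : LinFun P C C'
  fG : LinFun P G G'
  fBC : LinFun P BC BC'
  fGB : LinFun P GB GB'
  fGC : LinFun P GC GC'
  bc : (X.bc.comp (fB.sum fC)).Hom (fBC.comp X'.bc)
  gb : (X.gb.comp (fG.sum fB)).Hom (fGB.comp X'.gb)
  bg : (X.bg.comp (fB.sum fG)).Hom (fGB.comp X'.bg)
  gc : (X.gc.comp (fG.sum fC)).Hom (fGC.comp X'.gc)
  cg : (X.cg.comp (fC.sum fG)).Hom (fGC.comp X'.cg)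
  bc_g : (⟨fBC.obj X.bc_g.fst, fG.obj X.bc_g.snd⟩ : TSum P BC' G') ⟶ X'.bc_g
  g_bc : (⟨fG.obj X.g_bc.fst, fBC.obj X.g_bc.snd⟩ : TSum P G' BC') ⟶ X'.g_bc
  gb_c : (⟨fGB.obj X.gb_c.fst, fC.obj X.gb_c.snd⟩ : TSum P GB' C') ⟶ X'.gb_c
  b_gc : (⟨fB.obj X.b_gc.fst, fGC.obj X.b_gc.snd⟩ : TSum P B' GC') ⟶ X'.b_gc
  κx : X.x ⟶ X'.x
  κy : X.y ⟶ X'.y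
  κz : X.z ⟶ X'.z

/-- A morphism of exchange data. -/
structure ExchangeData.Map (X : ExchangeData P B C G BC GB GC)
    (X' : ExchangeData P B' C' G' BC' GB' GC') extends ExchangeData.PreMap X X' where
  assocGBC : fG.sumMap₃ fB fC X.assocGBC ≫ inr (fG.obj X.g_bc.fst) (bc.app₂ X.g_bc.snd) ≫
      X'.bc.mapR g_bc =
    assocMap (gb.app₂ X.gb_c.fst) (fC.obj X.gb_c.snd) ≫ TSum.assoc (X'.gb.mapL gb_c) ≫ X'.assocGBC
  assocBGC : fB.sumMap₃ fG fC X.assocBGC ≫ inr (fB.obj X.b_gc.fst) (gc.app₂ X.b_gc.snd) ≫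
      X'.gc.mapR b_gc =
    assocMap (bg.app₂ X.gb_c.fst) (fC.obj X.gb_c.snd) ≫ TSum.assoc (X'.bg.mapL gb_c) ≫ X'.assocBGC
  assocBCG : fB.sumMap₃ fC fG X.assocBCG ≫ inr (fB.obj X.b_gc.fst) (cg.app₂ X.b_gc.snd) ≫
      X'.cg.mapR b_gc =
    assocMap (bc.app₂ X.bc_g.fst) (fG.obj X.bc_g.snd) ≫ TSum.assoc (X'.bc.mapL bc_g) ≫ X'.assocBCG
  exchZ : fBC.sumMap fG X.exchZ ≫ swap g_bc = fBC.actCell κz bc_g ≫ X'.exchZ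
  exchX : fB.sumMap fG (X.appX X.gb_c.fst) ≫ fB.actCell κx (bg.app₂ X.gb_c.fst) =
    swap (gb.app₂ X.gb_c.fst) ≫ X'.appX (fGB.obj X.gb_c.fst)
  exchY : fC.sumMap fG (X.appY X.b_gc.snd) ≫ fC.actCell κy (cg.app₂ X.b_gc.snd) =
    swap (gc.app₂ X.b_gc.snd) ≫ X'.appY (fGC.obj X.b_gc.snd)

end Exchange

end PicExt

/-! ### Naturality of the exchange: one square for each factor of the chain. -/

namespace PicExt

open scoped MonoidalLeftAction

section Exchange

variable {P : Type u} [Category.{v} P] [MonoidalCategory P] [SymmetricCategory P]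
  [IsPicardGroupoid P]
variable {B C G BC GB GC B' C' G' BC' GB' GC' : Type u}
  [Category.{max u v} B] [Category.{max u v} C] [Category.{max u v} G]
  [Category.{max u v} BC] [Category.{max u v} GB] [Category.{max u v} GC]
  [MonoidalLeftAction P B] [MonoidalLeftAction P C] [MonoidalLeftAction P G]
  [MonoidalLeftAction P BC] [MonoidalLeftAction P GB] [MonoidalLeftAction P GC]
  [IsGroupoid B] [IsGroupoid C] [IsGroupoid G]
  [IsGroupoid BC] [IsGroupoid GB] [IsGroupoid GC]
  [Category.{max u v} B'] [Category.{max u v} C'] [Category.{max u v} G']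
  [Category.{max u v} BC'] [Category.{max u v} GB'] [Category.{max u v} GC']
  [MonoidalLeftAction P B'] [MonoidalLeftAction P C'] [MonoidalLeftAction P G']
  [MonoidalLeftAction P BC'] [MonoidalLeftAction P GB'] [MonoidalLeftAction P GC']
  [IsGroupoid B'] [IsGroupoid C'] [IsGroupoid G']
  [IsGroupoid BC'] [IsGroupoid GB'] [IsGroupoid GC']

open TSum (inl inr move actR swap swapL swapR swap_comp swap_inl swap_inr swap_move assoc_comp
  assoc_inl assoc_inr assoc_move)


namespace ExchangeData.PreMap

variable {X : ExchangeData P B C G BC GB GC} {X' : ExchangeData P B' C' G' BC' GB' GC'}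
  (Φ : PreMap X X')

/-- The comparison of the decompositions through `BC` and `G`, in `B + (C + G)`. -/
def base : (⟨Φ.fB.obj (X.bc.obj X.bc_g.fst).fst, ⟨Φ.fC.obj (X.bc.obj X.bc_g.fst).snd,
    Φ.fG.obj X.bc_g.snd⟩⟩ : TSum P B' (TSum P C' G')) ⟶
      ⟨(X'.bc.obj X'.bc_g.fst).fst, ⟨(X'.bc.obj X'.bc_g.fst).snd, X'.bc_g.snd⟩⟩ :=
  assocMap (Φ.bc.app₂ X.bc_g.fst) (Φ.fG.obj X.bc_g.snd) ≫ TSum.assoc (X'.bc.mapL Φ.bc_g)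

/-- The comparison of the translated decompositions through `BC` and `G`, in `B + (C + G)`. -/
def baseZ : (⟨Φ.fB.obj (X.bc.obj (X.z ⊙ₗ X.bc_g.fst)).fst,
    ⟨Φ.fC.obj (X.bc.obj (X.z ⊙ₗ X.bc_g.fst)).snd,
    Φ.fG.obj X.bc_g.snd⟩⟩ : TSum P B' (TSum P C' G')) ⟶
      ⟨(X'.bc.obj (X'.z ⊙ₗ X'.bc_g.fst)).fst,
        ⟨(X'.bc.obj (X'.z ⊙ₗ X'.bc_g.fst)).snd, X'.bc_g.snd⟩⟩ :=
  assocMap (Φ.bc.app₂ (X.z ⊙ₗ X.bc_g.fst)) (Φ.fG.obj X.bc_g.snd) ≫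
    TSum.assoc (X'.bc.mapL (Φ.fBC.actCell Φ.κz Φ.bc_g))

/-- The comparison of the decompositions through `G` and `BC`, in `B + (C + G)`. -/
noncomputable def baseGBC : (⟨Φ.fB.obj (X.bc.obj X.g_bc.snd).fst,
    ⟨Φ.fC.obj (X.bc.obj X.g_bc.snd).snd, Φ.fG.obj X.g_bc.fst⟩⟩ : TSum P B' (TSum P C' G')) ⟶
      ⟨(X'.bc.obj X'.g_bc.snd).fst, ⟨(X'.bc.obj X'.g_bc.snd).snd, X'.g_bc.fst⟩⟩ :=
  assocMap (Φ.bc.app₂ X.g_bc.snd) (Φ.fG.obj X.g_bc.fst) ≫ TSum.assoc (X'.bc.mapL (swap Φ.g_bc))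

/-- The comparison of the decompositions through `G + B` and `C`, in `G + (B + C)`. -/
def baseGB : (⟨Φ.fG.obj (X.gb.obj X.gb_c.fst).fst,
    ⟨Φ.fB.obj (X.gb.obj X.gb_c.fst).snd, Φ.fC.obj X.gb_c.snd⟩⟩ : TSum P G' (TSum P B' C')) ⟶
      ⟨(X'.gb.obj X'.gb_c.fst).fst, ⟨(X'.gb.obj X'.gb_c.fst).snd, X'.gb_c.snd⟩⟩ :=
  assocMap (Φ.gb.app₂ X.gb_c.fst) (Φ.fC.obj X.gb_c.snd) ≫ TSum.assoc (X'.gb.mapL Φ.gb_c)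

/-- The comparison of the decompositions through `B + G` and `C`, in `B + (G + C)`. -/
def baseBG : (⟨Φ.fB.obj (X.bg.obj X.gb_c.fst).fst,
    ⟨Φ.fG.obj (X.bg.obj X.gb_c.fst).snd, Φ.fC.obj X.gb_c.snd⟩⟩ : TSum P B' (TSum P G' C')) ⟶
      ⟨(X'.bg.obj X'.gb_c.fst).fst, ⟨(X'.bg.obj X'.gb_c.fst).snd, X'.gb_c.snd⟩⟩ :=
  assocMap (Φ.bg.app₂ X.gb_c.fst) (Φ.fC.obj X.gb_c.snd) ≫ TSum.assoc (X'.bg.mapL Φ.gb_c)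

/-- The comparison of the decompositions through `B` and `G + C`, in `B + (G + C)`. -/
def baseGC : (⟨Φ.fB.obj X.b_gc.fst, ⟨Φ.fG.obj (X.gc.obj X.b_gc.snd).fst,
    Φ.fC.obj (X.gc.obj X.b_gc.snd).snd⟩⟩ : TSum P B' (TSum P G' C')) ⟶
      ⟨X'.b_gc.fst, ⟨(X'.gc.obj X'.b_gc.snd).fst, (X'.gc.obj X'.b_gc.snd).snd⟩⟩ :=
  inr (Φ.fB.obj X.b_gc.fst) (Φ.gc.app₂ X.b_gc.snd) ≫ X'.gc.mapR Φ.b_gc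

/-- The comparison of the decompositions through `B` and `C + G`, in `B + (C + G)`. -/
def baseCG : (⟨Φ.fB.obj X.b_gc.fst, ⟨Φ.fC.obj (X.cg.obj X.b_gc.snd).fst,
    Φ.fG.obj (X.cg.obj X.b_gc.snd).snd⟩⟩ : TSum P B' (TSum P C' G')) ⟶
      ⟨X'.b_gc.fst, ⟨(X'.cg.obj X'.b_gc.snd).fst, (X'.cg.obj X'.b_gc.snd).snd⟩⟩ :=
  inr (Φ.fB.obj X.b_gc.fst) (Φ.cg.app₂ X.b_gc.snd) ≫ X'.cg.mapR Φ.b_gc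

/-- The comparison of the translated decompositions through `B` and `C + G`. -/
def baseY : (⟨Φ.fB.obj X.b_gc.fst, ⟨Φ.fC.obj (X.y ⊙ₗ (X.cg.obj X.b_gc.snd).fst),
    Φ.fG.obj (X.cg.obj X.b_gc.snd).snd⟩⟩ : TSum P B' (TSum P C' G')) ⟶
      ⟨X'.b_gc.fst, ⟨X'.y ⊙ₗ (X'.cg.obj X'.b_gc.snd).fst, (X'.cg.obj X'.b_gc.snd).snd⟩⟩ :=
  inr (Φ.fB.obj X.b_gc.fst) (Φ.fC.actCell Φ.κy (Φ.cg.app₂ X.b_gc.snd)) ≫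
    TSum.actIn X'.y (X'.cg.mapR Φ.b_gc)

/-- The square over the constraint of L_{bc} → L_b + L_c at z. It splits into the compatibility of
`Φ.bc` with translation (`h1`), the naturality of the constraint of `X'.bc` along `Φ.bc_g` (`h2`),
and its naturality along `Φ.κz` (`h3`). -/
theorem lamInv_baseZ :
    Φ.fB.sumMap₃ Φ.fC Φ.fG (assocMap (X.bc.lamInv X.z X.bc_g.fst) X.bc_g.snd) ≫ Φ.baseZ =
      Φ.fB.actCell Φ.κz Φ.base ≫ assocMap (X'.bc.lamInv X'.z X'.bc_g.fst) X'.bc_g.snd := by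
  have h1 := Φ.bc.assocMap_app₂_lamInv Φ.fG X.z X.bc_g.fst X.bc_g.snd
  have h2 := X'.bc.lamInv_natural X.z Φ.bc_g
  have h3 := congrArg (fun k => assocMap k X'.bc_g.snd)
    (X'.bc.lamInv_natural_left Φ.κz X'.bc_g.fst)
  dsimp only at h3
  rw [assocMap_comp, assocMap_comp, assocMap_inl] at h3
  dsimp only at h2 h1
  have h4 : TSum.assoc (X'.bc.mapL (Φ.fBC.actCell Φ.κz Φ.bc_g)) =
      TSum.assoc (X'.bc.mapL (inl (Φ.fBC.lam X.z X.bc_g.fst).hom (Φ.fG.obj X.bc_g.snd))) ≫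
        TSum.assoc (X'.bc.mapL (actR X.z Φ.bc_g)) ≫
          assocMap (X'.bc.map (Φ.κz ⊵ₗ X'.bc_g.fst)) X'.bc_g.snd := by
    rw [LinFun.actCell, LinFun.mapL_comp, LinFun.mapL_comp, assoc_comp, assoc_comp,
      LinFun.mapL_inl _ (Φ.κz ⊵ₗ X'.bc_g.fst), assoc_inl (X'.bc.map (Φ.κz ⊵ₗ X'.bc_g.fst))]
  rw [baseZ, h4, reassoc_of% h1, ← reassoc_of% h2, ← h3, base, LinFun.actCell, TSum.actR_comp]
  simp only [Category.assoc]

/-- The square over the exchange of G with BC: the hypothesis is transported along the decomposition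
of BC and joined to the naturality of `Φ.bc`. -/
theorem exchZ_baseGBC (h : Φ.fBC.sumMap Φ.fG X.exchZ ≫ swap Φ.g_bc =
      Φ.fBC.actCell Φ.κz Φ.bc_g ≫ X'.exchZ) :
    Φ.fB.sumMap₃ Φ.fC Φ.fG (TSum.assoc (X.bc.mapL X.exchZ)) ≫ Φ.baseGBC =
      Φ.baseZ ≫ TSum.assoc (X'.bc.mapL X'.exchZ) := by
  have h1 := Φ.bc.assocMap_app₂_natural Φ.fG X.exchZ
  have h2 := congrArg (fun k => TSum.assoc (X'.bc.mapL k)) h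
  dsimp only at h1 h2
  rw [LinFun.mapL_comp, LinFun.mapL_comp, assoc_comp, assoc_comp] at h2
  rw [baseGBC, reassoc_of% h1, h2, baseZ, Category.assoc]

theorem assoc_swap_baseGBC : TSum.assoc (swap (inr (Φ.fG.obj X.g_bc.fst) (Φ.bc.app₂ X.g_bc.snd) ≫
    X'.bc.mapR Φ.g_bc)) = Φ.baseGBC := by
  rw [swap_comp, assoc_comp, swap_inr, TSum.swap_mapR, assoc_inl]
  rfl

/-- The square over the structure 2-isomorphism for G, B, C. It enters the chain inverted and
rotated by the commutativity constraint, so the hypothesis is first inverted and then rotated. -/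
theorem assocGBC_baseGB (h : Φ.fG.sumMap₃ Φ.fB Φ.fC X.assocGBC ≫
      inr (Φ.fG.obj X.g_bc.fst) (Φ.bc.app₂ X.g_bc.snd) ≫ X'.bc.mapR Φ.g_bc =
        Φ.baseGB ≫ X'.assocGBC) :
    Φ.fB.sumMap₃ Φ.fC Φ.fG (TSum.assoc (swap (inv X.assocGBC))) ≫
        TSum.assoc (swap Φ.baseGB) =
      Φ.baseGBC ≫ TSum.assoc (swap (inv X'.assocGBC)) := by
  have h1 : Φ.fG.sumMap₃ Φ.fB Φ.fC (inv X.assocGBC) ≫ Φ.baseGB =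
      (inr (Φ.fG.obj X.g_bc.fst) (Φ.bc.app₂ X.g_bc.snd) ≫ X'.bc.mapR Φ.g_bc) ≫
        inv X'.assocGBC := by
    rw [LinFun.sumMap₃_inv, IsIso.inv_comp_eq, Category.assoc, reassoc_of% h, IsIso.hom_inv_id,
      Category.comp_id]
  have h2 := congrArg (fun k => TSum.assoc (swap k)) h1
  dsimp only at h2
  rw [swap_comp, assoc_comp, swap_comp, assoc_comp, assoc_swap_baseGBC] at h2
  rw [LinFun.sumMap₃_assoc_swap]
  exact h2

/-- The hexagon enters here: the exchange of G with the pair B + C becomes the exchange with B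
followed by the exchange with C, after which the exchange of G with B can act on the first two
summands alone. -/
theorem assoc_swap_baseGB : TSum.assoc (swap Φ.baseGB) =
    swapR (TSum.assoc (inl (swap (Φ.gb.app₂ X.gb_c.fst)) (Φ.fC.obj X.gb_c.snd) ≫
      (X'.gb.comp sumComm).mapL Φ.gb_c)) := by
  have h : Φ.baseGB = TSum.assoc (inl (Φ.gb.app₂ X.gb_c.fst) (Φ.fC.obj X.gb_c.snd) ≫
      X'.gb.mapL Φ.gb_c) := by
    rw [assoc_comp, assoc_inl]; rfl
  rw [h, TSum.assoc_swap_assoc, TSum.swapL_comp, TSum.swapL_inl, TSum.swapL_mapL]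
  rfl

theorem actCell_baseBG : Φ.fB.actCell Φ.κx (swapR Φ.baseBG) =
    swapR (TSum.assoc (inl (Φ.fB.actCell Φ.κx (Φ.bg.app₂ X.gb_c.fst)) (Φ.fC.obj X.gb_c.snd) ≫
      actR X'.x (X'.bg.mapL Φ.gb_c))) := by
  rw [LinFun.actCell_swapR, baseBG, LinFun.actCell_comp, ← LinFun.assocMap_actCell, assoc_comp,
    assoc_inl, TSum.actR_assoc]

/-- The square over the exchange of G with B. The hypothesis settles the object coming from
`X.gb_c`; the passage to `X'.gb_c` goes along a morphism of the sum GB' + C', for which naturality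
of the exchange is needed (`h1`). For this reason `exchX` is a whole 2-morphism, while a single
morphism is enough for `exchZ`. -/
theorem exchX_baseBG (h : Φ.fB.sumMap Φ.fG (X.appX X.gb_c.fst) ≫
      Φ.fB.actCell Φ.κx (Φ.bg.app₂ X.gb_c.fst) =
        swap (Φ.gb.app₂ X.gb_c.fst) ≫ X'.appX (Φ.fGB.obj X.gb_c.fst)) :
    Φ.fB.sumMap₃ Φ.fC Φ.fG (swapR (assocMap (X.appX X.gb_c.fst) X.gb_c.snd)) ≫
        Φ.fB.actCell Φ.κx (swapR Φ.baseBG) =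
      TSum.assoc (swap Φ.baseGB) ≫ swapR (assocMap (X'.appX X'.gb_c.fst) X'.gb_c.snd) := by
  have h1 : (X'.gb.comp sumComm).mapL Φ.gb_c ≫ inl (X'.appX X'.gb_c.fst) X'.gb_c.snd =
      inl (X'.appX (Φ.fGB.obj X.gb_c.fst)) (Φ.fC.obj X.gb_c.snd) ≫
        actR X'.x (X'.bg.mapL Φ.gb_c) := by
    refine (X'.exchX.mapL_inl Φ.gb_c).trans (comp_congr rfl ?_)
    exact (LinFun.mapL_mapL X'.bg ((LinFun.Z P (TSum P B' G')).obj X'.x) Φ.gb_c).symm.trans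
      (TSum.mapL_Z X'.x (X'.bg.mapL Φ.gb_c))
  have h2 : inl (Φ.fB.sumMap Φ.fG (X.appX X.gb_c.fst)) (Φ.fC.obj X.gb_c.snd) ≫
      inl (Φ.fB.actCell Φ.κx (Φ.bg.app₂ X.gb_c.fst)) (Φ.fC.obj X.gb_c.snd) ≫
        actR X'.x (X'.bg.mapL Φ.gb_c) =
      (inl (swap (Φ.gb.app₂ X.gb_c.fst)) (Φ.fC.obj X.gb_c.snd) ≫
        (X'.gb.comp sumComm).mapL Φ.gb_c) ≫ inl (X'.appX X'.gb_c.fst) X'.gb_c.snd := by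
    refine Eq.trans ?_ (Category.assoc _ _ _).symm
    refine Eq.trans ?_ (comp_congr rfl h1.symm)
    rw [TSum.inl_comp', h, ← TSum.inl_comp, Category.assoc]
  have h3 := congrArg (fun k => swapR (TSum.assoc k)) h2
  dsimp only at h3
  rw [assoc_comp, TSum.swapR_comp, assoc_inl] at h3
  rw [actCell_baseBG, assoc_swap_baseGB, LinFun.sumMap₃_swapR, LinFun.sumMap₃_assocMap]
  refine h3.trans ?_
  refine (congrArg swapR (assoc_comp _ _)).trans ((TSum.swapR_comp _ _).trans (comp_congr rfl ?_))
  exact congrArg swapR (assoc_inl _ _)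

theorem assocBGC_baseGC (h : Φ.fB.sumMap₃ Φ.fG Φ.fC X.assocBGC ≫ Φ.baseGC =
      Φ.baseBG ≫ X'.assocBGC) :
    Φ.fB.sumMap₃ Φ.fC Φ.fG (swapR X.assocBGC) ≫ swapR Φ.baseGC =
      swapR Φ.baseBG ≫ swapR X'.assocBGC := by
  rw [LinFun.sumMap₃_swapR]
  exact (TSum.swapR_comp _ _).symm.trans ((congrArg swapR h).trans (TSum.swapR_comp _ _))

/-- The analogue of `exchX_baseBG` on the right summand. Here the object of `P` acts inside the sum
C' + G', which is why `TSum.actIn` takes the place of `actR`. -/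
theorem exchY_baseY (h : Φ.fC.sumMap Φ.fG (X.appY X.b_gc.snd) ≫
      Φ.fC.actCell Φ.κy (Φ.cg.app₂ X.b_gc.snd) =
        swap (Φ.gc.app₂ X.b_gc.snd) ≫ X'.appY (Φ.fGC.obj X.b_gc.snd)) :
    Φ.fB.sumMap₃ Φ.fC Φ.fG (inr X.b_gc.fst (X.appY X.b_gc.snd)) ≫ Φ.baseY =
      swapR Φ.baseGC ≫ inr X'.b_gc.fst (X'.appY X'.b_gc.snd) := by
  have h1 : (X'.gc.comp sumComm).mapR Φ.b_gc ≫ inr X'.b_gc.fst (X'.appY X'.b_gc.snd) =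
      inr (Φ.fB.obj X.b_gc.fst) (X'.appY (Φ.fGC.obj X.b_gc.snd)) ≫
        TSum.actIn X'.y (X'.cg.mapR Φ.b_gc) := by
    refine (X'.exchY.mapR_inr Φ.b_gc).trans (comp_congr rfl ?_)
    exact (LinFun.mapR_mapR X'.cg ((LinFun.Z P (TSum P C' G')).obj X'.y) Φ.b_gc).symm
  have h2 : swapR Φ.baseGC = inr (Φ.fB.obj X.b_gc.fst) (swap (Φ.gc.app₂ X.b_gc.snd)) ≫
      (X'.gc.comp sumComm).mapR Φ.b_gc := by
    rw [baseGC, TSum.swapR_comp, TSum.swapR_inr, TSum.swapR_mapR]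
    rfl
  rw [h2]
  refine Eq.trans ?_ (Category.assoc _ _ _).symm
  refine Eq.trans ?_ (comp_congr rfl h1.symm)
  rw [LinFun.sumMap₃_inr, baseY]
  refine (Category.assoc _ _ _).symm.trans ?_
  refine Eq.trans ?_ (Category.assoc _ _ _)
  rw [TSum.inr_comp, h]
  exact comp_congr (TSum.inr_comp _ _ _).symm rfl

/-- Relates the action of y on the middle summand to its action on the first. It rests on the
naturality of `moveIn` in the morphism of `P` and in both summands, together with the interchange
for the action on the middle summand. -/
theorem moveIn_baseY :
    Φ.fB.sumMap₃ Φ.fC Φ.fG (moveIn X.y X.b_gc.fst (X.cg.obj X.b_gc.snd)) ≫ Φ.baseY =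
      Φ.fB.actCell Φ.κy Φ.baseCG ≫ moveIn X'.y X'.b_gc.fst (X'.cg.obj X'.b_gc.snd) := by
  have h1 := moveIn_actIn X.y (X'.cg.mapR Φ.b_gc)
  have h2 := TSum.actIn_exchange Φ.κy (X'.cg.mapR Φ.b_gc)
  have h3 := moveIn_right X.y (Φ.fB.obj X.b_gc.fst) (Φ.cg.app₂ X.b_gc.snd)
  have h4 := moveIn_natural Φ.κy X'.b_gc.fst (X'.cg.obj X'.b_gc.snd)
  have h5 : inl (Φ.fC.lam X.y (X.cg.obj X.b_gc.snd).fst).inv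
      (Φ.fG.obj (X.cg.obj X.b_gc.snd).snd) ≫ Φ.fC.actCell Φ.κy (Φ.cg.app₂ X.b_gc.snd) =
      actR X.y (Φ.cg.app₂ X.b_gc.snd) ≫ inl (Φ.κy ⊵ₗ _) _ := by
    rw [LinFun.actCell, TSum.inl_comp', Iso.inv_hom_id, TSum.inl_id, Category.id_comp]
  dsimp only at h1 h2
  rw [LinFun.sumMap₃_move, baseY, LinFun.actCell.eq_def Φ.fB, baseCG, TSum.actR_comp, TSum.actR_inr]
  simp only [Category.assoc]
  rw [h4, ← reassoc_of% h1, reassoc_of% h3, h2, TSum.inr_comp', h5, ← TSum.inr_comp,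
    Category.assoc]

theorem moveInv_baseCG :
    Φ.fB.sumMap₃ Φ.fC Φ.fG (moveInv X.y X.b_gc.fst (X.cg.obj X.b_gc.snd)) ≫
        Φ.fB.actCell Φ.κy Φ.baseCG =
      Φ.baseY ≫ moveInv X'.y X'.b_gc.fst (X'.cg.obj X'.b_gc.snd) := by
  have h1 : Φ.fB.sumMap₃ Φ.fC Φ.fG (moveInv X.y X.b_gc.fst (X.cg.obj X.b_gc.snd)) ≫
      Φ.fB.sumMap₃ Φ.fC Φ.fG (moveIn X.y X.b_gc.fst (X.cg.obj X.b_gc.snd)) = 𝟙 _ := by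
    rw [← LinFun.sumMap₃_comp, moveInv_moveIn, LinFun.sumMap₃_id]
  have h2 := congrArg (fun k => Φ.fB.sumMap₃ Φ.fC Φ.fG
    (moveInv X.y X.b_gc.fst (X.cg.obj X.b_gc.snd)) ≫ k ≫
      moveInv X'.y X'.b_gc.fst (X'.cg.obj X'.b_gc.snd)) Φ.moveIn_baseY
  simp only [Category.assoc, reassoc_of% h1, moveIn_moveInv, Category.comp_id] at h2
  exact h2.symm

theorem assocBCG_base (h : Φ.fB.sumMap₃ Φ.fC Φ.fG X.assocBCG ≫ Φ.baseCG =
      Φ.base ≫ X'.assocBCG) :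
    Φ.fB.sumMap₃ Φ.fC Φ.fG (inv X.assocBCG) ≫ Φ.base = Φ.baseCG ≫ inv X'.assocBCG := by
  rw [LinFun.sumMap₃_inv, IsIso.inv_comp_eq, reassoc_of% h, IsIso.hom_inv_id,
      Category.comp_id]

end ExchangeData.PreMap

namespace ExchangeData.Map

variable {X : ExchangeData P B C G BC GB GC} {X' : ExchangeData P B' C' G' BC' GB' GC'}
  (Φ : Map X X')

theorem chainY_base :
    Φ.fB.sumMap₃ Φ.fC Φ.fG X.chainY ≫ Φ.fB.actCell Φ.κy Φ.base =
      -- Four squares are pasted. The last factor of `chainY` is the image of a morphism under the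
      -- action of y, hence its square is first moved under that action.
      swapR Φ.baseBG ≫ X'.chainY := by
  have h1 := LinFun.sumMap₃_actR_actCell Φ.fB Φ.fC Φ.fG Φ.κy (inv X.assocBCG) Φ.baseCG Φ.base
    (inv X'.assocBCG) (Φ.assocBCG_base (Φ.assocBCG.trans (Category.assoc _ _ _).symm))
  have h2 := Φ.moveInv_baseCG
  have h3 := Φ.exchY_baseY Φ.exchY
  have h4 := Φ.assocBGC_baseGC (Φ.assocBGC.trans (Category.assoc _ _ _).symm)
  rw [chainY, chainY, LinFun.sumMap₃_comp, LinFun.sumMap₃_comp, LinFun.sumMap₃_comp]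
  simp only [Category.assoc]
  rw [h1, reassoc_of% h2, reassoc_of% h3, reassoc_of% h4]

/-- The comparison of exchanges is natural. -/
theorem chain_base :
    Φ.fB.sumMap₃ Φ.fC Φ.fG X.chain ≫ Φ.fB.actCell (Φ.κx ⊗ₘ Φ.κy) Φ.base =
      Φ.fB.actCell Φ.κz Φ.base ≫ X'.chain := by
  -- One square for each of the six factors of the chain, pasted from the last factor to the first.
  -- The vertical morphism at either end is an `actCell` on `Φ.base`, with `κx ⊗ₘ κy` at the target
  -- and `κz` at the source.
  have h1 := LinFun.map_inl_assoc_actCell Φ.fB Φ.κx Φ.κy Φ.base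
  have h2 := LinFun.sumMap₃_actR_actCell Φ.fB Φ.fC Φ.fG Φ.κx X.chainY (swapR Φ.baseBG)
    (Φ.fB.actCell Φ.κy Φ.base) X'.chainY Φ.chainY_base
  have h3 := Φ.exchX_baseBG Φ.exchX
  have h4 := Φ.assocGBC_baseGB (Φ.assocGBC.trans (Category.assoc _ _ _).symm)
  have h5 := Φ.exchZ_baseGBC Φ.exchZ
  have h6 := Φ.lamInv_baseZ
  have h7 := LinFun.sumMap₃_inl Φ.fB Φ.fC Φ.fG
    (αₗ X.x X.y (X.bc.obj X.bc_g.fst).fst).inv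
        (⟨(X.bc.obj X.bc_g.fst).snd, X.bc_g.snd⟩ : TSum P C G)
  rw [chain, chain, LinFun.sumMap₃_comp, LinFun.sumMap₃_comp, LinFun.sumMap₃_comp,
    LinFun.sumMap₃_comp, LinFun.sumMap₃_comp, h7]
  simp only [Category.assoc]
  rw [h1, reassoc_of% h2, reassoc_of% h3, reassoc_of% h4, reassoc_of% h5, reassoc_of% h6]

end ExchangeData.Map

end Exchange

end PicExt

/-! ### Calculus of 2-morphisms: inverses, whiskering, translations and quasi-inverses. -/

namespace PicExt

open scoped MonoidalLeftAction

section HomCalculus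

variable {P : Type u} [Category.{v} P] [MonoidalCategory P]
variable {A L M N : Type u} [Category.{max u v} A] [Category.{max u v} L] [Category.{max u v} M]
  [Category.{max u v} N] [MonoidalLeftAction P A] [MonoidalLeftAction P L] [MonoidalLeftAction P M]
  [MonoidalLeftAction P N]

namespace LinFun

/-- Composition of `2`-morphisms. -/
def Hom.comp {F G H : LinFun P L M} (η : F.Hom G) (θ : G.Hom H) : F.Hom H :=
  CategoryStruct.comp (obj := LinFun P L M) η θ

/-- The inverse of a `2`-morphism. -/
noncomputable def Hom.inverse [IsGroupoid M] {F G : LinFun P L M} (η : F.Hom G) : G.Hom F where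
  app v := inv (η.app v)
  naturality f := by
    rw [IsIso.comp_inv_eq, Category.assoc, η.naturality, IsIso.inv_hom_id_assoc]
  lam_comp x v := by
    have h := η.lam_comp x v
    have h1 : x ⊴ₗ η.app v ≫ x ⊴ₗ inv (η.app v) = 𝟙 _ := by
      rw [← MonoidalLeftAction.actionHomRight_comp, IsIso.hom_inv_id,
        MonoidalLeftAction.actionHomRight_id]
    rw [IsIso.inv_comp_eq, reassoc_of% h, h1, Category.comp_id]

/-- Postcomposition of a `2`-morphism with a `1`-morphism. -/
def Hom.whiskerR {F G : LinFun P L M} (η : F.Hom G) (H : LinFun P M N) :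
    (F.comp H).Hom (G.comp H) where
  app v := H.map (η.app v)
  naturality f := by
    change H.map (F.map f) ≫ H.map _ = H.map _ ≫ H.map (G.map f)
    rw [← H.map_comp, ← H.map_comp, η.naturality]
  lam_comp x v := by
    have h := congrArg H.map (η.lam_comp x v)
    rw [H.map_comp, H.map_comp] at h
    have h1 : H.map (η.app (x ⊙ₗ v)) ≫ H.map (G.lam x v).hom ≫ (H.lam x (G.obj v)).hom =
        (H.map (F.lam x v).hom ≫ (H.lam x (F.obj v)).hom) ≫ x ⊴ₗ H.map (η.app v) := by
      rw [reassoc_of% h, H.map_lam', Category.assoc]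
    exact h1

/-- Precomposition of a `2`-morphism with a `1`-morphism. -/
def Hom.whiskerL {G H : LinFun P M N} (F : LinFun P L M) (η : G.Hom H) :
    (F.comp G).Hom (F.comp H) where
  app v := η.app (F.obj v)
  naturality f := η.naturality (F.map f)
  lam_comp x v := by
    have h := η.naturality (F.lam x v).hom
    have h1 : η.app (F.obj (x ⊙ₗ v)) ≫ H.map (F.lam x v).hom ≫ (H.lam x (F.obj v)).hom =
        (G.map (F.lam x v).hom ≫ (G.lam x (F.obj v)).hom) ≫ x ⊴ₗ η.app (F.obj v) := by
      rw [← reassoc_of% h, η.lam_comp, Category.assoc]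
    exact h1

/-- The underlying functors of the two bracketings agree by definition, but the constraints agree
only after `map_comp`; hence the 2-morphisms `assocHom` and `assocHomInv` with identity components.
-/
theorem comp_lam_assoc (F : LinFun P A L) (G : LinFun P L M) (H : LinFun P M N) (x : P) (v : A) :
    (((F.comp G).comp H).lam x v).hom = ((F.comp (G.comp H)).lam x v).hom := by
  have h : H.map (G.map (F.lam x v).hom ≫ (G.lam x (F.obj v)).hom) ≫
      (H.lam x (G.obj (F.obj v))).hom = H.map (G.map (F.lam x v).hom) ≫
        H.map (G.lam x (F.obj v)).hom ≫ (H.lam x (G.obj (F.obj v))).hom := by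
    rw [H.map_comp, Category.assoc]
  exact h

/-- The associativity of composition of `1`-morphisms. -/
def assocHom (F : LinFun P A L) (G : LinFun P L M) (H : LinFun P M N) :
    ((F.comp G).comp H).Hom (F.comp (G.comp H)) where
  app v := 𝟙 (H.obj (G.obj (F.obj v)))
  naturality f := (Category.comp_id _).trans (Category.id_comp _).symm
  lam_comp x v := by
    refine (Category.id_comp _).trans (Eq.trans (comp_lam_assoc F G H x v).symm ?_)
    exact ((comp_congr rfl (MonoidalLeftAction.actionHomRight_id x _)).trans
      (Category.comp_id _)).symm

/-- The associativity of composition of `1`-morphisms. -/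
def assocHomInv (F : LinFun P A L) (G : LinFun P L M) (H : LinFun P M N) :
    (F.comp (G.comp H)).Hom ((F.comp G).comp H) where
  app v := 𝟙 (H.obj (G.obj (F.obj v)))
  naturality f := (Category.comp_id _).trans (Category.id_comp _).symm
  lam_comp x v := by
    refine (Category.id_comp _).trans (Eq.trans (comp_lam_assoc F G H x v) ?_)
    exact ((comp_congr rfl (MonoidalLeftAction.actionHomRight_id x _)).trans
      (Category.comp_id _)).symm

variable [SymmetricCategory P]

/-- The interchange of two translations is built from the associativity of the action and the
symmetry of `P`, and a 1-morphism respects both. It is the linearity condition in `translateHom`. -/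
theorem map_actSwap (F : LinFun P L M) (z x : P) (v : L) :
    F.map (actSwap z x v).hom ≫ (F.lam x (z ⊙ₗ v)).hom ≫ x ⊴ₗ (F.lam z v).hom =
      (F.lam z (x ⊙ₗ v)).hom ≫ z ⊴ₗ (F.lam x v).hom ≫ (actSwap z x (F.obj v)).hom := by
  have a1 := F.lam_tensor z x v
  have a2 := F.lam_tensor x z v
  have a3 := F.map_lam (β_ z x).hom v
  have a4 : F.map (αₗ z x v).hom ≫ F.map (actSwap z x v).hom =
      F.map ((β_ z x).hom ⊵ₗ v) ≫ F.map (αₗ x z v).hom := by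
    rw [← F.map_comp, ← F.map_comp, actSwap_hom, Iso.hom_inv_id_assoc]
  rw [← cancel_epi (F.map (αₗ z x v).hom), reassoc_of% a4, ← a2, reassoc_of% a3,
    ← reassoc_of% a1, actSwap_hom, Iso.hom_inv_id_assoc]

/-- A `1`-morphism commutes with translations. -/
def translateHom (F : LinFun P L M) (z : P) :
    (((Z P L).obj z).comp F).Hom (F.comp ((Z P M).obj z)) where
  app v := (F.lam z v).hom
  naturality f := F.map_lam' z f
  lam_comp x v := by
    change _ ≫ z ⊴ₗ (F.lam x v).hom ≫ (actSwap z x (F.obj v)).hom =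
      (F.map (actSwap z x v).hom ≫ (F.lam x (z ⊙ₗ v)).hom) ≫ _
    exact ((Category.assoc _ _ _).trans (F.map_actSwap z x v)).symm

/-- Composition with the chosen quasi-inverse and then with the functor itself. -/
noncomputable def counitHom [IsTorsor P L] [IsTorsor P M] (S : LinFun P A M) (F : LinFun P L M) :
    ((S.comp F.inverse).comp F).Hom S where
  app v := (F.counit (S.obj v)).hom
  naturality f := F.counit_natural (S.map f)
  lam_comp x v := by
    have h1 := F.counit_natural (S.lam x v).hom
    have h2 := F.map_inverseLam x (S.obj v)
    have h3 : (F.counit (S.obj (x ⊙ₗ v))).hom ≫ (S.lam x v).hom =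
        (F.map (F.invFunctor.map (S.lam x v).hom ≫ (F.inverseLam x (S.obj v)).hom) ≫
          (F.lam x (F.invFunctor.obj (S.obj v))).hom) ≫ x ⊴ₗ (F.counit (S.obj v)).hom := by
      rw [F.map_comp, Category.assoc, Category.assoc, h2, h1]
    exact h3

/-- A `2`-morphism with prescribed components. -/
def Hom.copy {F G : LinFun P L M} (η : F.Hom G) (app : ∀ v, F.obj v ⟶ G.obj v)
    (h : ∀ v, app v = η.app v) : F.Hom G where
  app := app
  naturality f := by rw [h, h]; exact η.naturality f
  lam_comp x v := by rw [h, h]; exact η.lam_comp x v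

end LinFun

end HomCalculus

/-! ### The isomorphisms `theta` as 2-morphisms, and `zetaChain` as an exchange chain. -/

section Theta

variable {G : Type w} [Group G]
variable {P : Type u} [Category.{v} P] [MonoidalCategory P] [SymmetricCategory P]
  [IsPicardGroupoid P]

namespace ExtensionData

variable (E : ExtensionData G P)

/-- The isomorphisms `theta` form a `2`-morphism. -/
noncomputable def thetaHom (a b ab : G) (h : a * b = ab) (h' : b * a = ab) :
    ((E.mul b a ab h').comp ((LinFun.Z P _).obj (E.C2 a b ab h h'))).Hom
      ((E.mul a b ab h).comp sumComm) :=
  (((((E.mul b a ab h').translateHom (E.C2 a b ab h h')).inverse.comp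
    (LinFun.Hom.whiskerR (E.commIso a b ab h h').hom (E.mul b a ab h'))).comp
    ((LinFun.assocHomInv (E.mul a b ab h) sumComm (E.mul b a ab h').inverse).whiskerR
      (E.mul b a ab h'))).comp
    (LinFun.counitHom ((E.mul a b ab h).comp sumComm) (E.mul b a ab h'))).copy
    (E.theta a b ab h h') (fun v => by
      -- The components of the composite 2-morphism differ from `theta` only by writing `inv` for
      -- the inverse of an isomorphism and by the image of the identity in `assocHomInv`.
      have h1 : inv ((E.mul b a ab h').lam (E.C2 a b ab h h') v).hom =
        ((E.mul b a ab h').lam (E.C2 a b ab h h') v).inv := IsIso.Iso.inv_hom _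
      have h2 := (E.mul b a ab h').map_id ((E.commMap a b ab h h').obj v)
      refine (Category.assoc _ _ _).symm.trans (comp_congr ?_ rfl)
      exact (comp_congr h1.symm rfl).trans
        ((Category.comp_id _).symm.trans (comp_congr rfl h2.symm)))

/-- The isomorphisms `thetaInv` form a `2`-morphism. -/
noncomputable def thetaInvHom (a b ab : G) (h : a * b = ab) (h' : b * a = ab) :
    ((E.mul a b ab h).comp sumComm).Hom
      ((E.mul b a ab h').comp ((LinFun.Z P _).obj (E.C2 a b ab h h'))) :=
  (E.thetaHom a b ab h h').inverse

section

variable (g b c gb gc bc t : G) (h_gb : g * b = gb) (h_bg : b * g = gb) (h_gc : g * c = gc)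
  (h_cg : c * g = gc) (h_bc : b * c = bc) (h_g_bc : g * bc = t) (h_bc_g : bc * g = t)
  (h_gb_c : gb * c = t) (h_b_gc : b * gc = t)

/-- The data defining the exchange of `g` with `bc`, at an object of `L_{gbc}`. -/
noncomputable def exchange (v : E.torsor t) :
    ExchangeData P (E.torsor b) (E.torsor c) (E.torsor g) (E.torsor bc) (E.torsor gb)
      (E.torsor gc) where
  bc := E.mul b c bc h_bc
  gb := E.mul g b gb h_gb
  bg := E.mul b g gb h_bg
  gc := E.mul g c gc h_gc
  cg := E.mul c g gc h_cg
  bc_g := (E.mul bc g t h_bc_g).obj v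
  g_bc := (E.mul g bc t h_g_bc).obj v
  gb_c := (E.mul gb c t h_gb_c).obj v
  b_gc := (E.mul b gc t h_b_gc).obj v
  x := E.C2 g b gb h_gb h_bg
  y := E.C2 g c gc h_gc h_cg
  z := E.C2 g bc t h_g_bc h_bc_g
  exchZ := E.theta g bc t h_g_bc h_bc_g v
  exchX := E.thetaInvHom g b gb h_gb h_bg
  exchY := E.thetaInvHom g c gc h_gc h_cg
  assocGBC := (E.assoc g b c gb bc t h_gb h_gb_c h_bc h_g_bc).app v
  assocBGC := (E.assoc b g c gb gc t h_bg h_gb_c h_gc h_b_gc).app v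
  assocBCG := (E.assoc b c g bc gc t h_bc h_bc_g h_cg h_b_gc).app v

/-- The two composites have the same factors up to identities, since the constraints of `sumAssoc`
and of id + C are identities. From here on only the abstract chain is needed. -/
theorem zetaChain_eq_chain (v : E.torsor t) :
    E.zetaChain g b c gb gc bc t h_gb h_bg h_gc h_cg h_bc h_g_bc h_bc_g h_gb_c h_b_gc v =
      (E.exchange g b c gb gc bc t h_gb h_bg h_gc h_cg h_bc h_g_bc h_bc_g h_gb_c h_b_gc v).chain :=
        by
  let X := E.exchange g b c gb gc bc t h_gb h_bg h_gc h_cg h_bc h_g_bc h_bc_g h_gb_c h_b_gc v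
  have h1 : ((((E.mul b c bc h_bc).sum LinFun.id).comp sumAssoc).lam X.z X.bc_g).inv =
      assocMap (X.bc.lamInv X.z X.bc_g.fst) X.bc_g.snd :=
    (Category.id_comp _).trans (TSum.assoc_inl _ _)
  have h2 : TSum.swapR (TSum.assoc (TSum.inl (X.appX X.gb_c.fst) X.gb_c.snd)) =
      TSum.swapR (assocMap (X.appX X.gb_c.fst) X.gb_c.snd) :=
    congrArg TSum.swapR (TSum.assoc_inl _ _)
  have h3 : ∀ a : TSum P (TSum P (E.torsor b) (E.torsor g)) (E.torsor c),
      ((sumAssoc.comp (LinFun.id.sum sumComm)).lam X.x a).hom = 𝟙 (⟨X.x ⊙ₗ a.fst.fst,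
        ⟨a.snd, a.fst.snd⟩⟩ : TSum P (E.torsor b) (TSum P (E.torsor c) (E.torsor g))) := fun a =>
    (comp_congr (LinFun.map_id (LinFun.id.sum sumComm) _) (TSum.inl_id _ _)).trans
      (Category.id_comp _)
  refine comp_congr h1 (comp_congr rfl (comp_congr rfl (comp_congr h2 ?_)))
  exact (comp_congr (h3 _) rfl).trans (Category.id_comp _)

end

end ExtensionData

end Theta

end PicExt

/-! ### Rigidity of sums of torsors, and translations of a sum. -/

namespace PicExt

open scoped MonoidalLeftAction

section SumCalculus

variable {P : Type u} [Category.{v} P] [MonoidalCategory P] [SymmetricCategory P]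
  [IsPicardGroupoid P]
variable {L M N L' M' N' L'' M'' : Type u}
  [Category.{max u v} L] [Category.{max u v} M] [Category.{max u v} N]
  [Category.{max u v} L'] [Category.{max u v} M'] [Category.{max u v} N']
  [Category.{max u v} L''] [Category.{max u v} M'']
  [MonoidalLeftAction P L] [MonoidalLeftAction P M] [MonoidalLeftAction P N]
  [MonoidalLeftAction P L'] [MonoidalLeftAction P M'] [MonoidalLeftAction P N']
  [MonoidalLeftAction P L''] [MonoidalLeftAction P M'']
  [IsGroupoid L] [IsGroupoid M] [IsGroupoid N] [IsGroupoid L'] [IsGroupoid M'] [IsGroupoid N']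
  [IsGroupoid L''] [IsGroupoid M'']

open TSum (inl inr move actR swap swapL swapR swap_comp swap_inl swap_inr swap_move assoc_comp
  assoc_inl
  assoc_inr assoc_move)

theorem LinFun.sumMap_inl_actCell (F : LinFun P L L') (G : LinFun P M M') {x y z : P} (ζ : x ⟶ y)
    (κ : y ⟶ z) {v : L} {w : M} {a : TSum P L' M'}
    (s : (⟨F.obj v, G.obj w⟩ : TSum P L' M') ⟶ a) :
    F.sumMap G (inl (ζ ⊵ₗ v) w) ≫ F.actCell κ s = F.actCell (ζ ≫ κ) s := by
  have h := TSum.actR_exchange ζ s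
  rw [sumMap_inl, actCell, actCell, TSum.inl_comp', F.map_lam, ← TSum.inl_comp, Category.assoc,
    ← reassoc_of% h, TSum.inl_comp, MonoidalLeftAction.comp_actionHomLeft]

theorem LinFun.actCell_inl (F : LinFun P L L') {x y z : P} (κ : x ⟶ y) (ζ : y ⟶ z)
    {v : L} {w : M} {a : TSum P L' M} (s : (⟨F.obj v, w⟩ : TSum P L' M) ⟶ a) :
    F.actCell κ s ≫ inl (ζ ⊵ₗ a.fst) a.snd = F.actCell (κ ≫ ζ) s := by
  simp only [actCell, Category.assoc]
  rw [TSum.inl_comp, MonoidalLeftAction.comp_actionHomLeft]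

/-- All factors of `actCell` other than the one containing κ are invertible, and both the inclusion
of the first summand and the action of `P` on a torsor are faithful. -/
theorem LinFun.actCell_injective (F : LinFun P L L') [IsTorsor P L'] [IsTorsor P M] {x y : P}
    {κ κ' : x ⟶ y} {v : L} {w : M} {a : TSum P L' M} (s : (⟨F.obj v, w⟩ : TSum P L' M) ⟶ a)
    (h : F.actCell κ s = F.actCell κ' s) : κ = κ' := by
  have h1 : actR x s ≫ inl (κ ⊵ₗ a.fst) a.snd = actR x s ≫ inl (κ' ⊵ₗ a.fst) a.snd :=
    (cancel_epi (inl (F.lam x v).hom w)).1 h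
  have h2 : inl (κ ⊵ₗ a.fst) a.snd = inl (κ' ⊵ₗ a.fst) a.snd := (cancel_epi (actR x s)).1 h1
  exact (MonoidalLeftAction.actionRight (C := P) a.fst).map_injective
    (TSum.inl_injective inferInstance h2)

/-- Fullness in two stages: with the second object fixed the morphism comes from the first torsor,
and there it comes from `P`. -/
theorem TSum.exists_inl_action [IsTorsor P L] [IsTorsor P M] {x y : P} (a : TSum P L M)
    (m : (⟨x ⊙ₗ a.fst, a.snd⟩ : TSum P L M) ⟶ ⟨y ⊙ₗ a.fst, a.snd⟩) :
    ∃ ζ : x ⟶ y, m = inl (ζ ⊵ₗ a.fst) a.snd := by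
  obtain ⟨f, rfl⟩ := TSum.exists_inl inferInstance m
  obtain ⟨ζ, hζ⟩ := (MonoidalLeftAction.actionRight (C := P) a.fst).map_surjective f
  exact ⟨ζ, congrArg (fun k => inl k a.snd) hζ.symm⟩

/-- A commuting square read with two opposite sides inverted; it converts statements about `move`,
`moveIn` or `theta` into statements about their inverses. -/
theorem comp_inverse_eq {C : Type u} [Category.{max u v} C] {a b c d : C} {f : a ⟶ b} {f' : b ⟶ a}
    {g : b ⟶ d} {k : a ⟶ c} {h : c ⟶ d} {h' : d ⟶ c} (e : f ≫ g = k ≫ h) (hf : f' ≫ f = 𝟙 b)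
    (hh : h ≫ h' = 𝟙 c) : g ≫ h' = f' ≫ k := by
  have e1 := congrArg (fun m => f' ≫ m ≫ h') e
  simp only [Category.assoc, hh, reassoc_of% hf, Category.comp_id] at e1
  exact e1

/-- The inverse of `move`. -/
noncomputable def moveBack (x : P) (v : L) (w : M) :
    (⟨v, x ⊙ₗ w⟩ : TSum P L M) ⟶ ⟨x ⊙ₗ v, w⟩ :=
  inv (move x v w)

theorem move_moveBack (x : P) (v : L) (w : M) : move x v w ≫ moveBack x v w = 𝟙 _ :=
  IsIso.hom_inv_id _

theorem moveBack_move (x : P) (v : L) (w : M) : moveBack x v w ≫ move x v w = 𝟙 _ :=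
  IsIso.inv_hom_id _

theorem swap_moveBack (x : P) (v : L) (w : M) : swap (moveBack x v w) = move x w v := by
  rw [moveBack, TSum.swap_inv]
  exact (inv_congr (swap_move x v w)).trans IsIso.inv_inv

theorem assocMap_moveBack (x : P) (v : L) (w : M) (k : N) :
    assocMap (moveBack x v w) k = moveInv x v (⟨w, k⟩ : TSum P M N) := by
  rw [moveBack, assocMap_inv]
  exact inv_congr (assocMap_move x v w k)

/-- The sum of a translation and an identity is a translation. -/
def LinFun.sumZHom (z : P) :
    (((LinFun.Z P L).obj z).sum (LinFun.id (P := P) (L := M))).Hom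
      ((LinFun.Z P (TSum P L M)).obj z) where
  app a := 𝟙 (⟨z ⊙ₗ a.fst, a.snd⟩ : TSum P L M)
  naturality m := (Category.comp_id _).trans
    ((LinFun.Z_sumMap_id z m).trans (Category.id_comp (TSum.actR z m)).symm)
  lam_comp x a := by
    refine (Category.id_comp _).trans ((TSum.actSwap_inl z x a).trans ?_)
    exact ((comp_congr rfl (TSum.actR_id x (⟨z ⊙ₗ a.fst, a.snd⟩ : TSum P L M))).trans
      (Category.comp_id _)).symm

/-- The sum of an identity and a translation is isomorphic to a translation. -/
noncomputable def LinFun.sumZHomRight (z : P) :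
    ((LinFun.id (P := P) (L := L)).sum ((LinFun.Z P M).obj z)).Hom
      ((LinFun.Z P (TSum P L M)).obj z) where
  app a := moveBack z a.fst a.snd
  naturality {a b} m := by
    exact comp_inverse_eq (LinFun.move_id_sumMap_Z z m) (moveBack_move z a.fst a.snd)
      (move_moveBack z b.fst b.snd)
  lam_comp x a := by
    -- The linearity condition for `moveBack` is the inverse of the formula for the action of x on
    -- `move`; the interchange of x and z is its own inverse with the arguments exchanged.
    have h1 := TSum.actR_move x z a.fst a.snd
    have h3 : actR x (move z a.fst a.snd) ≫ actR x (moveBack z a.fst a.snd) = 𝟙 _ := by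
      rw [← TSum.actR_comp, move_moveBack, TSum.actR_id]
    rw [h1, Category.assoc] at h3
    have h4 : (inl (actSwap z x a.fst).hom a.snd : (⟨_, a.snd⟩ : TSum P L M) ⟶ _) ≫
        inl (actSwap x z a.fst).hom a.snd = 𝟙 _ := by
      rw [TSum.inl_comp, ← actSwap_inv x z, Iso.inv_hom_id, TSum.inl_id]
    have h5 : moveBack z (x ⊙ₗ a.fst) a.snd ≫ inl (actSwap z x a.fst).hom a.snd =
        actR x (moveBack z a.fst a.snd) := by
      have h6 := congrArg (fun k => moveBack z (x ⊙ₗ a.fst) a.snd ≫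
        inl (actSwap z x a.fst).hom a.snd ≫ k) h3
      rw [reassoc_of% h4, Category.comp_id,
        ← Category.assoc, moveBack_move, Category.id_comp] at h6
      exact h6.symm
    refine (comp_congr rfl (TSum.actSwap_inl z x a)).trans (h5.trans ?_)
    exact ((comp_congr (TSum.inl_id _ _) rfl).trans (Category.id_comp _)).symm

end SumCalculus

/-! ### From the chain to an equation in `P`. -/

section Exchange

variable {P : Type u} [Category.{v} P] [MonoidalCategory P] [SymmetricCategory P]
  [IsPicardGroupoid P]
variable {B C G BC GB GC B' C' G' BC' GB' GC' : Type u}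
  [Category.{max u v} B] [Category.{max u v} C] [Category.{max u v} G]
  [Category.{max u v} BC] [Category.{max u v} GB] [Category.{max u v} GC]
  [MonoidalLeftAction P B] [MonoidalLeftAction P C] [MonoidalLeftAction P G]
  [MonoidalLeftAction P BC] [MonoidalLeftAction P GB] [MonoidalLeftAction P GC]
  [IsGroupoid B] [IsGroupoid C] [IsGroupoid G]
  [IsGroupoid BC] [IsGroupoid GB] [IsGroupoid GC]
  [Category.{max u v} B'] [Category.{max u v} C'] [Category.{max u v} G']
  [Category.{max u v} BC'] [Category.{max u v} GB'] [Category.{max u v} GC']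
  [MonoidalLeftAction P B'] [MonoidalLeftAction P C'] [MonoidalLeftAction P G']
  [MonoidalLeftAction P BC'] [MonoidalLeftAction P GB'] [MonoidalLeftAction P GC']
  [IsGroupoid B'] [IsGroupoid C'] [IsGroupoid G']
  [IsGroupoid BC'] [IsGroupoid GB'] [IsGroupoid GC']

open TSum (inl inr move actR swap swapL swapR swap_comp swap_inl swap_inr swap_move assoc_comp
  assoc_inl assoc_inr assoc_move)


namespace ExchangeData

theorem exists_chain_eq [IsTorsor P B] [IsTorsor P C] [IsTorsor P G]
    (X : ExchangeData P B C G BC GB GC) :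
    ∃ ζ : X.z ⟶ X.x ⊗ X.y, X.chain = inl (ζ ⊵ₗ X.base.fst) X.base.snd :=
  TSum.exists_inl_action X.base X.chain

/-- When the chains are the actions of ζ and ζ', both sides of `chain_base` are `actCell`s on the
same morphism `Φ.base`: one for ζ followed by `κx ⊗ₘ κy`, the other for `κz` followed by ζ'. They
can then be cancelled by `actCell_injective`. -/
theorem Map.comp_eq [IsTorsor P B'] [IsTorsor P C'] [IsTorsor P G']
    {X : ExchangeData P B C G BC GB GC} {X' : ExchangeData P B' C' G' BC' GB' GC'}
    (Φ : X.Map X') {ζ : X.z ⟶ X.x ⊗ X.y} (hζ : X.chain = inl (ζ ⊵ₗ X.base.fst) X.base.snd)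
    {ζ' : X'.z ⟶ X'.x ⊗ X'.y} (hζ' : X'.chain = inl (ζ' ⊵ₗ X'.base.fst) X'.base.snd) :
    ζ ≫ (Φ.κx ⊗ₘ Φ.κy) = Φ.κz ≫ ζ' := by
  have h := Φ.chain_base
  have h1 := Φ.fB.actCell_inl Φ.κz ζ' Φ.toPreMap.base
  have h2 := Φ.fB.sumMap_inl_actCell (Φ.fC.sum Φ.fG) ζ (Φ.κx ⊗ₘ Φ.κy) (w := X.base.snd)
    Φ.toPreMap.base
  rw [hζ, hζ'] at h
  exact Φ.fB.actCell_injective Φ.toPreMap.base (h2.symm.trans (h.trans h1))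

end ExchangeData

end Exchange

end PicExt

/-! ### Translation of decompositions along an isomorphism u + v ≅ v'. -/

namespace PicExt

open scoped MonoidalLeftAction

section SumCalculus

variable {P : Type u} [Category.{v} P] [MonoidalCategory P] [SymmetricCategory P]
  [IsPicardGroupoid P]
variable {A L M N L' M' N' L'' M'' : Type u}
  [Category.{max u v} A] [MonoidalLeftAction P A] [IsGroupoid A]
  [Category.{max u v} L] [Category.{max u v} M] [Category.{max u v} N]
  [Category.{max u v} L'] [Category.{max u v} M'] [Category.{max u v} N']
  [Category.{max u v} L''] [Category.{max u v} M'']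
  [MonoidalLeftAction P L] [MonoidalLeftAction P M] [MonoidalLeftAction P N]
  [MonoidalLeftAction P L'] [MonoidalLeftAction P M'] [MonoidalLeftAction P N']
  [MonoidalLeftAction P L''] [MonoidalLeftAction P M'']
  [IsGroupoid L] [IsGroupoid M] [IsGroupoid N] [IsGroupoid L'] [IsGroupoid M'] [IsGroupoid N']
  [IsGroupoid L''] [IsGroupoid M'']

open TSum (inl inr move actR swap swapL swapR swap_comp swap_inl swap_inr swap_move assoc_comp
  assoc_inl
  assoc_inr assoc_move)

namespace LinFun

/-- The components of a 2-morphism at v and at v' determine each other along u + v ⟶ v'. The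
translation squares for the structure 2-isomorphisms and for `theta` are instances of this. -/
theorem Hom.lam_inv_app {F G : LinFun P L M} (η : F.Hom G) (u : P) {v v' : L} (f : u ⊙ₗ v ⟶ v') :
    u ⊴ₗ η.app v ≫ (G.lam u v).inv ≫ G.map f = (F.lam u v).inv ≫ F.map f ≫ η.app v' := by
  have h := η.lam_comp u v
  rw [η.naturality, Iso.eq_inv_comp, ← reassoc_of% h, Iso.hom_inv_id_assoc]

/-- The image of an isomorphism `u + v ≅ v'` under a `1`-morphism to a sum. -/
def transL (μ : LinFun P A (TSum P L M)) (u : P) {v v' : A} (f : u ⊙ₗ v ⟶ v') :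
    (⟨u ⊙ₗ (μ.obj v).fst, (μ.obj v).snd⟩ : TSum P L M) ⟶ μ.obj v' :=
  μ.lamInv u v ≫ μ.map f

/-- The image of an isomorphism `u + v ≅ v'` under a `1`-morphism to a sum, where `u` acts on the
second summand. -/
noncomputable def transR (μ : LinFun P A (TSum P L M)) (u : P) {v v' : A} (f : u ⊙ₗ v ⟶ v') :
    (⟨(μ.obj v).fst, u ⊙ₗ (μ.obj v).snd⟩ : TSum P L M) ⟶ μ.obj v' :=
  moveBack u (μ.obj v).fst (μ.obj v).snd ≫ μ.transL u f

/-- A `1`-morphism to a sum commutes with translation in the first summand. -/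
noncomputable def zCell (μ : LinFun P A (TSum P L M)) (u : P) :
    (μ.comp (((Z P L).obj u).sum LinFun.id)).Hom (((Z P A).obj u).comp μ) :=
  ((Hom.whiskerL μ (sumZHom u)).comp (μ.translateHom u).inverse).copy (μ.lamInv u) fun v =>
    ((Category.id_comp _).trans (IsIso.Iso.inv_hom (μ.lam u v))).symm

/-- A `1`-morphism to a sum commutes with translation in the second summand. -/
noncomputable def zCellRight (μ : LinFun P A (TSum P L M)) (u : P) :
    (μ.comp (LinFun.id.sum ((Z P M).obj u))).Hom (((Z P A).obj u).comp μ) :=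
  ((Hom.whiskerL μ (sumZHomRight u)).comp (μ.translateHom u).inverse).copy
    (fun v => moveBack u (μ.obj v).fst (μ.obj v).snd ≫ μ.lamInv u v) fun v =>
      (comp_congr rfl (IsIso.Iso.inv_hom (μ.lam u v))).symm

/-- The sum of two identities is an identity. -/
def idCell (μ : LinFun P A (TSum P L M)) :
    (μ.comp (LinFun.id.sum LinFun.id)).Hom (LinFun.id.comp μ) where
  app v := 𝟙 (μ.obj v)
  naturality f := (Category.comp_id _).trans
    ((LinFun.id_sumMap_id (μ.map f)).trans (Category.id_comp (μ.map f)).symm)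
  lam_comp x v := by
    have h1 : (LinFun.id (P := P)).sumMap LinFun.id (μ.lamHom x v) = μ.lamHom x v :=
      LinFun.id_sumMap_id _
    have h2 : μ.map (𝟙 (x ⊙ₗ v)) = 𝟙 _ := μ.map_id _
    refine (Category.id_comp _).trans ?_
    refine ((comp_congr h2 rfl).trans (Category.id_comp _)).trans ?_
    refine Eq.trans ?_ (comp_congr (comp_congr h1.symm (TSum.inl_id _ _).symm)
      (TSum.actR_id x (μ.obj v)).symm)
    exact ((Category.comp_id _).trans (Category.comp_id _)).symm

/-- The translation square for a structure 2-isomorphism, with u acting on the first summand. The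
separate argument `app` restates the components of `η` with their endpoints as explicit triples, so
that they can be composed in the calculus of sums. -/
theorem Hom.actR_transL {K : Type u} [Category.{max u v} K] [MonoidalLeftAction P K]
    [IsGroupoid K] {K' : Type u} [Category.{max u v} K'] [MonoidalLeftAction P K']
    [IsGroupoid K'] {μ : LinFun P A (TSum P K N)} {ν : LinFun P K (TSum P L M)}
    {μ' : LinFun P A (TSum P L K')} {ρ : LinFun P K' (TSum P M N)}
    (η : ((μ.comp (ν.sum LinFun.id)).comp sumAssoc).Hom (μ'.comp (LinFun.id.sum ρ)))
    (app : ∀ v : A, (⟨(ν.obj (μ.obj v).fst).fst, ⟨(ν.obj (μ.obj v).fst).snd, (μ.obj v).snd⟩⟩ :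
      TSum P L (TSum P M N)) ⟶ ⟨(μ'.obj v).fst, ρ.obj (μ'.obj v).snd⟩)
    (happ : ∀ v, app v = η.app v) (u : P) {v v' : A} (f : u ⊙ₗ v ⟶ v') :
    actR u (app v) ≫ ρ.mapR (μ'.transL u f) =
      assocMap (ν.lamInv u (μ.obj v).fst) (μ.obj v).snd ≫
        TSum.assoc (ν.mapL (μ.transL u f)) ≫ app v' := by
  have h := η.lam_inv_app u f
  rw [← happ, ← happ] at h
  -- The constraint of each composite is unfolded; the constraints of the identity and of `sumAssoc`
  -- contribute identities.
  have h1 : ((μ'.comp (LinFun.id.sum ρ)).lam u v).inv = ρ.mapR (μ'.lamInv u v) :=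
    (comp_congr (TSum.inl_id _ _) rfl).trans (Category.id_comp _)
  have h2 : ((μ.comp (ν.sum LinFun.id)).comp sumAssoc).map f =
      TSum.assoc (ν.mapL (μ.map f)) := rfl
  have h3 : (((μ.comp (ν.sum LinFun.id)).comp sumAssoc).lam u v).inv =
      assocMap (ν.lamInv u (μ.obj v).fst) (μ.obj v).snd ≫ TSum.assoc (ν.mapL (μ.lamInv u v)) := by
    refine (Category.id_comp _).trans ?_
    refine (TSum.assoc_comp (inl (ν.lamInv u (μ.obj v).fst) (μ.obj v).snd)
      (ν.mapL (μ.lamInv u v))).trans ?_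
    exact comp_congr (TSum.assoc_inl _ _) rfl
  have h4 : ρ.mapR (μ'.transL u f) = ρ.mapR (μ'.lamInv u v) ≫ ρ.mapR (μ'.map f) :=
    ρ.mapR_comp _ _
  have h5 : TSum.assoc (ν.mapL (μ.transL u f)) =
      TSum.assoc (ν.mapL (μ.lamInv u v)) ≫ TSum.assoc (ν.mapL (μ.map f)) :=
    (congrArg TSum.assoc (ν.mapL_comp _ _)).trans (TSum.assoc_comp _ _)
  rw [h4, h5]
  refine (comp_congr rfl (comp_congr h1.symm rfl)).trans (h.trans ?_)
  refine (comp_congr h3 rfl).trans ?_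
  refine (Category.assoc _ _ _).trans (comp_congr rfl ?_)
  exact (Category.assoc _ _ _).symm

/-- The constraint of a translation is the interchange `actSwap`, whose inverse is the interchange
in the other order. -/
theorem comp_Z_lam_inv (μ : LinFun P A (TSum P L M)) (z u : P) (v : A) :
    ((μ.comp ((Z P (TSum P L M)).obj z)).lam u v).inv =
      inl (actSwap u z (μ.obj v).fst).hom (μ.obj v).snd ≫ actR z (μ.lamInv u v) := by
  refine comp_congr ?_ rfl
  have h : (actSwap z u (μ.obj v)).inv = (actSwap u z (μ.obj v)).hom := actSwap_inv z u (μ.obj v)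
  exact h.trans (TSum.actSwap_inl u z (μ.obj v))

theorem comp_sumComm_lam_inv (μ : LinFun P A (TSum P L M)) (u : P) (v : A) :
    ((μ.comp sumComm).lam u v).inv =
      move u (μ.obj v).snd (μ.obj v).fst ≫ swap (μ.lamInv u v) := rfl

theorem swap_transR (μ : LinFun P A (TSum P L M)) (u : P) {v v' : A} (f : u ⊙ₗ v ⟶ v') :
    swap (μ.transR u f) =
      move u (μ.obj v).snd (μ.obj v).fst ≫ swap (μ.lamInv u v) ≫ swap (μ.map f) := by
  rw [transR, transL, swap_comp, swap_moveBack]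
  exact comp_congr rfl (swap_comp _ _)

/-- The translation square in the direction of `theta`. On the side of μ' the object u acts on the
second summand, and it reaches the first one through the commutativity constraint. -/
theorem Hom.actR_swap_transR {μ : LinFun P A (TSum P L M)} {μ' : LinFun P A (TSum P M L)} {z : P}
    (η : (μ.comp ((Z P (TSum P L M)).obj z)).Hom (μ'.comp sumComm))
    (app : ∀ v : A, (⟨z ⊙ₗ (μ.obj v).fst, (μ.obj v).snd⟩ : TSum P L M) ⟶
      ⟨(μ'.obj v).snd, (μ'.obj v).fst⟩) (happ : ∀ v, app v = η.app v)
    (u : P) {v v' : A} (f : u ⊙ₗ v ⟶ v') :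
    actR u (app v) ≫ swap (μ'.transR u f) =
      inl (actSwap u z (μ.obj v).fst).hom (μ.obj v).snd ≫ actR z (μ.transL u f) ≫ app v' := by
  have h := η.lam_inv_app u f
  rw [← happ, ← happ, comp_Z_lam_inv, comp_sumComm_lam_inv] at h
  have h5 : actR z (μ.transL u f) = actR z (μ.lamInv u v) ≫ actR z (μ.map f) :=
    TSum.actR_comp z _ _
  rw [swap_transR, h5]
  refine (comp_congr rfl (Category.assoc _ _ _).symm).trans (h.trans ?_)
  refine (Category.assoc _ _ _).trans (comp_congr rfl ?_)
  exact (Category.assoc _ _ _).symm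

/-- The same square for a 2-morphism in the opposite direction, as needed for `thetaInv`. -/
theorem Hom.actR_transL_Z {μ : LinFun P A (TSum P L M)} {μ' : LinFun P A (TSum P M L)} {z : P}
    (η : (μ'.comp sumComm).Hom (μ.comp ((Z P (TSum P L M)).obj z)))
    (app : ∀ v : A, (⟨(μ'.obj v).snd, (μ'.obj v).fst⟩ : TSum P L M) ⟶
      ⟨z ⊙ₗ (μ.obj v).fst, (μ.obj v).snd⟩) (happ : ∀ v, app v = η.app v)
    (u : P) {v v' : A} (f : u ⊙ₗ v ⟶ v') :
    actR u (app v) ≫ inl (actSwap u z (μ.obj v).fst).hom (μ.obj v).snd ≫ actR z (μ.transL u f) =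
      swap (μ'.transR u f) ≫ app v' := by
  have h := η.lam_inv_app u f
  rw [← happ, ← happ, comp_Z_lam_inv, comp_sumComm_lam_inv] at h
  have h5 : actR z (μ.transL u f) = actR z (μ.lamInv u v) ≫ actR z (μ.map f) :=
    TSum.actR_comp z _ _
  rw [swap_transR, h5]
  refine (comp_congr rfl (Category.assoc _ _ _).symm).trans (h.trans ?_)
  refine (Category.assoc _ _ _).symm.trans (comp_congr ?_ rfl)
  exact Category.assoc _ _ _

end LinFun

end SumCalculus

end PicExt

/-! ### Translation in the middle summand. -/

namespace PicExt

open scoped MonoidalLeftAction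

section SumCalculus

variable {P : Type u} [Category.{v} P] [MonoidalCategory P] [SymmetricCategory P]
  [IsPicardGroupoid P]
variable {A L M N L' M' N' L'' M'' : Type u}
  [Category.{max u v} A] [MonoidalLeftAction P A] [IsGroupoid A]
  [Category.{max u v} L] [Category.{max u v} M] [Category.{max u v} N]
  [Category.{max u v} L'] [Category.{max u v} M'] [Category.{max u v} N']
  [Category.{max u v} L''] [Category.{max u v} M'']
  [MonoidalLeftAction P L] [MonoidalLeftAction P M] [MonoidalLeftAction P N]
  [MonoidalLeftAction P L'] [MonoidalLeftAction P M'] [MonoidalLeftAction P N']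
  [MonoidalLeftAction P L''] [MonoidalLeftAction P M'']
  [IsGroupoid L] [IsGroupoid M] [IsGroupoid N] [IsGroupoid L'] [IsGroupoid M'] [IsGroupoid N']
  [IsGroupoid L''] [IsGroupoid M'']

open TSum (inl inr move actR swap swapL swapR swap_comp swap_inl swap_inr swap_move assoc_comp
  assoc_inl
  assoc_inr assoc_move)

namespace LinFun

/-- The sum of two identities is an identity. -/
def sumIdHom : ((LinFun.id (P := P) (L := L)).sum (LinFun.id (P := P) (L := M))).Hom
    (LinFun.id (P := P) (L := TSum P L M)) where
  app a := 𝟙 a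
  naturality m := (Category.comp_id _).trans
    ((LinFun.id_sumMap_id m).trans (Category.id_comp m).symm)
  lam_comp x a := by
    refine (Category.id_comp _).trans (Eq.trans ?_
      (comp_congr (TSum.inl_id _ _).symm (TSum.actR_id x a).symm))
    exact (Category.comp_id _).symm

/-- The translation of the inner sum and the sum of a translation with an identity agree through
`sumZHom`, whose components are identities; its naturality gives the equality on morphisms. -/
theorem id_sumMap₃_Z_id (u : P) {a b : TSum P L (TSum P M N)} (m : a ⟶ b) :
    (LinFun.id (P := P)).sumMap₃ ((Z P M).obj u) LinFun.id m = TSum.actIn u m := by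
  have h := Hom.sumMap_inr (sumZHom (L := M) (M := N) u) (LinFun.id (P := P) (L := L)) m
  have h1 : ∀ a : TSum P L (TSum P M N), inr (P := P) ((LinFun.id (P := P)).obj a.fst)
    ((sumZHom (L := M) (M := N) u).app a.snd) = 𝟙 _ := fun a => TSum.inr_id _ _
  rw [h1, h1] at h
  exact (Category.comp_id _).symm.trans (h.trans (Category.id_comp _))

theorem Z_sumMap₃_id_id (u : P) {a b : TSum P L (TSum P M N)} (m : a ⟶ b) :
    ((Z P L).obj u).sumMap₃ LinFun.id LinFun.id m = actR u m := by
  have h := Hom.sumMap_inr (sumIdHom (P := P) (L := M) (M := N)) ((Z P L).obj u) m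
  have h1 : ∀ a : TSum P L (TSum P M N), inr (P := P) (((Z P L).obj u).obj a.fst)
    ((sumIdHom (P := P) (L := M) (M := N)).app a.snd) = 𝟙 _ := fun a => TSum.inr_id _ _
  rw [h1, h1] at h
  exact (Category.comp_id _).symm.trans (h.trans ((Category.id_comp _).trans (Z_sumMap_id u m)))

/-- The inverse form of `LinFun.mapR_move`. -/
theorem inr_lamInv_mapR_moveBack (ρ : LinFun P A (TSum P M N)) (u : P) (v : L) (w : A) :
    inr v (ρ.lamInv u w) ≫ ρ.mapR (moveBack u v w) = moveInv u v (ρ.obj w) := by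
  have h1 : ρ.mapR (move u v w) = moveIn u v (ρ.obj w) ≫ inr v (ρ.lamInv u w) :=
    ρ.mapR_move u v w
  have h2 : ρ.mapR (move u v w) ≫ ρ.mapR (moveBack u v w) = 𝟙 _ := by
    rw [← mapR_comp, move_moveBack]
    exact LinFun.id.sumMap_id ρ _
  rw [h1] at h2
  have h3 := congrArg (fun k => moveInv u v (ρ.obj w) ≫ k) h2
  have h4 := moveInv_moveIn u v (ρ.obj w)
  simp only [Category.assoc, reassoc_of% h4, Category.comp_id] at h3
  exact h3

/-- Conjugating `Hom.actR_transL` by `moveIn` turns the action of u on the first summand into its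
action on the middle one. It is needed for the decomposition as G + (B + C), where B stands in the
middle. -/
theorem Hom.actIn_transR {K : Type u} [Category.{max u v} K] [MonoidalLeftAction P K]
    [IsGroupoid K] {K' : Type u} [Category.{max u v} K'] [MonoidalLeftAction P K']
    [IsGroupoid K'] {μ : LinFun P A (TSum P K N)} {ν : LinFun P K (TSum P L M)}
    {μ' : LinFun P A (TSum P L K')} {ρ : LinFun P K' (TSum P M N)}
    (η : ((μ.comp (ν.sum LinFun.id)).comp sumAssoc).Hom (μ'.comp (LinFun.id.sum ρ)))
    (app : ∀ v : A, (⟨(ν.obj (μ.obj v).fst).fst, ⟨(ν.obj (μ.obj v).fst).snd, (μ.obj v).snd⟩⟩ :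
      TSum P L (TSum P M N)) ⟶ ⟨(μ'.obj v).fst, ρ.obj (μ'.obj v).snd⟩)
    (happ : ∀ v, app v = η.app v) (u : P) {v v' : A} (f : u ⊙ₗ v ⟶ v') :
    TSum.actIn u (app v) ≫ inr (μ'.obj v).fst (ρ.lamInv u (μ'.obj v).snd) ≫
        ρ.mapR (μ'.transR u f) =
      assocMap (moveBack u (ν.obj (μ.obj v).fst).fst (ν.obj (μ.obj v).fst).snd ≫
          ν.lamInv u (μ.obj v).fst) (μ.obj v).snd ≫
        TSum.assoc (ν.mapL (μ.transL u f)) ≫ app v' := by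
  have h := η.actR_transL app happ u f
  have h1 := ρ.inr_lamInv_mapR_moveBack u (μ'.obj v).fst (μ'.obj v).snd
  have h2 : ρ.mapR (μ'.transR u f) = ρ.mapR (moveBack u (μ'.obj v).fst (μ'.obj v).snd) ≫
    ρ.mapR (μ'.transL u f) := ρ.mapR_comp _ _
  have h3 : TSum.actIn u (app v) ≫ moveInv u (μ'.obj v).fst (ρ.obj (μ'.obj v).snd) =
      moveInv u (ν.obj (μ.obj v).fst).fst
        (⟨(ν.obj (μ.obj v).fst).snd, (μ.obj v).snd⟩ : TSum P M N) ≫ actR u (app v) :=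
    comp_inverse_eq (moveIn_actIn u (app v)) (moveInv_moveIn _ _ _) (moveIn_moveInv _ _ _)
  rw [h2, reassoc_of% h1, reassoc_of% h3, h, assocMap_comp, assocMap_moveBack, Category.assoc]

theorem Z_actCell_id (u : P) (z : P) {v : L} {w : M} {a : TSum P L M}
    (s : (⟨u ⊙ₗ v, w⟩ : TSum P L M) ⟶ a) :
    ((Z P L).obj u).actCell (𝟙 z) s = inl (actSwap u z v).hom w ≫ actR z s := by
  have h : inl (P := P) ((𝟙 z) ⊵ₗ a.fst) a.snd = 𝟙 _ :=
    (congrArg (fun k => inl k a.snd) (MonoidalLeftAction.id_actionHomLeft z a.fst)).trans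
      (TSum.inl_id _ _)
  refine comp_congr rfl ((comp_congr rfl h).trans (Category.comp_id _))

theorem id_actCell_id (z : P) {v : L} {w : M} {a : TSum P L M} (s : (⟨v, w⟩ : TSum P L M) ⟶ a) :
    (LinFun.id (P := P)).actCell (𝟙 z) s = actR z s := by
  have h : inl (P := P) ((𝟙 z) ⊵ₗ a.fst) a.snd = 𝟙 _ :=
    (congrArg (fun k => inl k a.snd) (MonoidalLeftAction.id_actionHomLeft z a.fst)).trans
      (TSum.inl_id _ _)
  refine (comp_congr (TSum.inl_id _ _) (comp_congr rfl h)).trans ?_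
  exact (Category.id_comp _).trans (Category.comp_id _)

end LinFun

end SumCalculus

/-! ### Independence of `zeta` from the chosen object. -/

section Translate

variable {G : Type w} [Group G]
variable {P : Type u} [Category.{v} P] [MonoidalCategory P] [SymmetricCategory P]
  [IsPicardGroupoid P]

open TSum (inl inr move actR swap swapL swapR)

namespace ExtensionData

variable (E : ExtensionData G P)
variable (g b c gb gc bc t : G) (h_gb : g * b = gb) (h_bg : b * g = gb) (h_gc : g * c = gc)
  (h_cg : c * g = gc) (h_bc : b * c = bc) (h_g_bc : g * bc = t) (h_bc_g : bc * g = t)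
  (h_gb_c : gb * c = t) (h_b_gc : b * gc = t)

/-- Translation of the decomposed object, on exchange data. -/
noncomputable def translatePre (u : P) {v v' : E.torsor t} (f : u ⊙ₗ v ⟶ v') :
    (E.exchange g b c gb gc bc t h_gb h_bg h_gc h_cg h_bc h_g_bc h_bc_g h_gb_c h_b_gc v).PreMap
      (E.exchange g b c gb gc bc t h_gb h_bg h_gc h_cg h_bc h_g_bc h_bc_g h_gb_c h_b_gc v') where
  -- The object u is made to act on the factor B throughout, hence on BC and GB but not on C, G or
  -- GC. In G + B and in G + BC it therefore acts on the second summand, which accounts for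
  -- `zCellRight` and `transR`. The objects C₂ do not change, so the three morphisms of `P` are
  -- identities.
  fB := (LinFun.Z P _).obj u
  fC := LinFun.id
  fG := LinFun.id
  fBC := (LinFun.Z P _).obj u
  fGB := (LinFun.Z P _).obj u
  fGC := LinFun.id
  bc := (E.mul b c bc h_bc).zCell u
  gb := (E.mul g b gb h_gb).zCellRight u
  bg := (E.mul b g gb h_bg).zCell u
  gc := (E.mul g c gc h_gc).idCell
  cg := (E.mul c g gc h_cg).idCell
  bc_g := (E.mul bc g t h_bc_g).transL u f
  g_bc := (E.mul g bc t h_g_bc).transR u f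
  gb_c := (E.mul gb c t h_gb_c).transL u f
  b_gc := (E.mul b gc t h_b_gc).transL u f
  κx := 𝟙 _
  κy := 𝟙 _
  κz := 𝟙 _

/-- Translation of the decomposed object, as a morphism of exchange data. -/
noncomputable def translate (u : P) {v v' : E.torsor t} (f : u ⊙ₗ v ⟶ v') :
    (E.exchange g b c gb gc bc t h_gb h_bg h_gc h_cg h_bc h_g_bc h_bc_g h_gb_c h_b_gc v).Map
      (E.exchange g b c gb gc bc t h_gb h_bg h_gc h_cg h_bc h_g_bc h_bc_g h_gb_c h_b_gc v') where
  toPreMap := E.translatePre g b c gb gc bc t h_gb h_bg h_gc h_cg h_bc h_g_bc h_bc_g h_gb_c h_b_gc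
      u f
  assocGBC := by
    have h := LinFun.Hom.actIn_transR (E.assoc g b c gb bc t h_gb h_gb_c h_bc h_g_bc)
      (E.assoc g b c gb bc t h_gb h_gb_c h_bc h_g_bc).app (fun _ => rfl) u f
    exact (comp_congr (LinFun.id_sumMap₃_Z_id u _) rfl).trans h
  assocBGC := by
    have h := LinFun.Hom.actR_transL (E.assoc b g c gb gc t h_bg h_gb_c h_gc h_b_gc)
      (E.assoc b g c gb gc t h_bg h_gb_c h_gc h_b_gc).app (fun _ => rfl) u f
    refine (comp_congr (LinFun.Z_sumMap₃_id_id u _) ?_).trans h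
    exact (comp_congr (TSum.inr_id _ _) rfl).trans (Category.id_comp _)
  assocBCG := by
    have h := LinFun.Hom.actR_transL (E.assoc b c g bc gc t h_bc h_bc_g h_cg h_b_gc)
      (E.assoc b c g bc gc t h_bc h_bc_g h_cg h_b_gc).app (fun _ => rfl) u f
    refine (comp_congr (LinFun.Z_sumMap₃_id_id u _) ?_).trans h
    exact (comp_congr (TSum.inr_id _ _) rfl).trans (Category.id_comp _)
  exchZ := by
    have h := LinFun.Hom.actR_swap_transR (E.thetaHom g bc t h_g_bc h_bc_g)
      (E.theta g bc t h_g_bc h_bc_g) (fun _ => rfl) u f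
    refine (comp_congr (LinFun.Z_sumMap_id u _) rfl).trans (h.trans ?_)
    exact (Category.assoc _ _ _).symm.trans (comp_congr (LinFun.Z_actCell_id u _ _).symm rfl)
  exchX := by
    -- The required square involves only u + p and not the passage to v', so the general translation
    -- square is applied to the identity of u + p.
    let p := ((E.mul gb c t h_gb_c).obj v).fst
    have h := LinFun.Hom.actR_transL_Z (E.thetaInvHom g b gb h_gb h_bg)
      (E.thetaInv g b gb h_gb h_bg) (fun _ => rfl) u (𝟙 (u ⊙ₗ p))
    have h1 : ∀ {M N : Type u} [Category.{max u v} M] [Category.{max u v} N]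
      [MonoidalLeftAction P M] [MonoidalLeftAction P N] [IsGroupoid M] [IsGroupoid N]
      (μ : LinFun P (E.torsor gb) (TSum P M N)), μ.transL u (𝟙 (u ⊙ₗ p)) = μ.lamInv u p :=
      fun μ => (comp_congr rfl (μ.map_id _)).trans (Category.comp_id _)
    rw [LinFun.transR, h1, h1] at h
    refine (comp_congr (LinFun.Z_sumMap_id u _) (LinFun.Z_actCell_id u _ _)).trans h
  exchY := by
    -- Neither G nor C is translated, so every comparison in this square is an identity.
    let p := ((E.mul b gc t h_b_gc).obj v).snd
    refine (comp_congr (LinFun.id_sumMap_id _) (LinFun.id_actCell_id _ _)).trans ?_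
    refine (comp_congr rfl (TSum.actR_id _ _)).trans ((Category.comp_id _).trans ?_)
    exact ((comp_congr (TSum.swap_id _) rfl).trans (Category.id_comp _)).symm

/-- By definition `zeta` describes the chain at one chosen object. The torsor has only one object up
to translation, and translating leaves the element of `P` unchanged. -/
theorem zeta_chain (v : E.torsor t) :
    (E.exchange g b c gb gc bc t h_gb h_bg h_gc h_cg h_bc h_g_bc h_bc_g h_gb_c h_b_gc v).chain =
      inl ((E.zeta g b c gb gc bc t h_gb h_bg h_gc h_cg h_bc h_g_bc h_bc_g h_gb_c h_b_gc).hom ⊵ₗ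
      (E.exchange g b c gb gc bc t h_gb h_bg h_gc h_cg h_bc h_g_bc h_bc_g h_gb_c h_b_gc v).base.fst)
      (E.exchange g b c gb gc bc t h_gb h_bg h_gc h_cg h_bc h_g_bc h_bc_g h_gb_c h_b_gc v).base.snd
        := by
  let v₀ : E.torsor t := (E.torsor t).isTorsor.nonempty.some
  have h₀ : (E.exchange g b c gb gc bc t h_gb h_bg h_gc h_cg h_bc h_g_bc h_bc_g h_gb_c h_b_gc
      v₀).chain = inl ((E.zeta g b c gb gc bc t h_gb h_bg h_gc h_cg h_bc h_g_bc h_bc_g h_gb_c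
      h_b_gc).hom ⊵ₗ (E.exchange g b c gb gc bc t h_gb h_bg h_gc h_cg h_bc h_g_bc h_bc_g h_gb_c
      h_b_gc v₀).base.fst)
      (E.exchange g b c gb gc bc t h_gb h_bg h_gc h_cg h_bc h_g_bc h_bc_g h_gb_c h_b_gc
        v₀).base.snd :=
    (E.zetaChain_eq_chain g b c gb gc bc t h_gb h_bg h_gc h_cg h_bc h_g_bc h_bc_g h_gb_c h_b_gc
      v₀).symm.trans
      ((MonoidalLeftAction.actionRight (C := P)
        ((E.triple g b c bc t h_bc h_bc_g).obj v₀)).map_preimage _).symm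
  -- The chain at v is the action of some ζ. Below, v is written as a translate of the chosen
  -- object, and the resulting map of exchange data, with identities in `P`, forces ζ to be `zeta`.
  obtain ⟨ζ, hζ⟩ := (E.exchange g b c gb gc bc t h_gb h_bg h_gc h_cg h_bc h_g_bc h_bc_g h_gb_c
      h_b_gc v).exists_chain_eq
  let A := MonoidalLeftAction.actionRight (C := P) v₀
  have h := (E.translate g b c gb gc bc t h_gb h_bg h_gc h_cg h_bc h_g_bc h_bc_g h_gb_c h_b_gc
      (A.objPreimage v) (A.objObjPreimageIso v).hom).comp_eq h₀ hζ
  have h1 : (E.zeta g b c gb gc bc t h_gb h_bg h_gc h_cg h_bc h_g_bc h_bc_g h_gb_c h_b_gc).hom = ζ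
      := by
    refine Eq.trans ?_ (h.trans (Category.id_comp _))
    exact ((congrArg (CategoryStruct.comp _) (MonoidalCategory.id_tensorHom_id _ _)).trans
      (Category.comp_id _)).symm
  subst h1
  exact hζ

end ExtensionData

end Translate

end PicExt

/-! ### Linearity of the naturality of the commutativity constraint. -/

namespace PicExt

open scoped MonoidalLeftAction

section SumCalculus

variable {P : Type u} [Category.{v} P] [MonoidalCategory P] [SymmetricCategory P]
  [IsPicardGroupoid P]
variable {L M N L' M' N' L'' M'' : Type u}
  [Category.{max u v} L] [Category.{max u v} M] [Category.{max u v} N]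
  [Category.{max u v} L'] [Category.{max u v} M'] [Category.{max u v} N']
  [Category.{max u v} L''] [Category.{max u v} M'']
  [MonoidalLeftAction P L] [MonoidalLeftAction P M] [MonoidalLeftAction P N]
  [MonoidalLeftAction P L'] [MonoidalLeftAction P M'] [MonoidalLeftAction P N']
  [MonoidalLeftAction P L''] [MonoidalLeftAction P M'']
  [IsGroupoid L] [IsGroupoid M] [IsGroupoid N] [IsGroupoid L'] [IsGroupoid M'] [IsGroupoid N']
  [IsGroupoid L''] [IsGroupoid M'']

open TSum (inl inr move actR swap swapL swapR swap_comp swap_inl swap_inr swap_move assoc_comp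
  assoc_inl
  assoc_inr assoc_move)

/-- The naturality of the commutativity constraint with respect to `1`-morphisms. -/
noncomputable def LinFun.swapHom (F : LinFun P L L') (G : LinFun P M M') :
    (sumComm.comp (G.sum F)).Hom ((F.sum G).comp sumComm) where
  app a := 𝟙 (⟨G.obj a.snd, F.obj a.fst⟩ : TSum P M' L')
  naturality m := (Category.comp_id _).trans
    ((TSum.swap_sumMap F G m).symm.trans (Category.id_comp (swap (F.sumMap G m))).symm)
  lam_comp x a := by
    -- The constraint of `sumComm` is the inverse of a `move`. Linearity is therefore the formula
    -- for F + G on `move`, freed of the right-hand constraint here and then inverted.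
    have h1 : G.sumMap F (move x a.snd a.fst) ≫ inr (G.obj a.snd) (F.lam x a.fst).hom =
        inl (G.lam x a.snd).hom (F.obj a.fst) ≫ move x (G.obj a.snd) (F.obj a.fst) := by
      rw [LinFun.sumMap_move, Category.assoc, Category.assoc, TSum.inr_comp, Iso.inv_hom_id,
        TSum.inr_id, Category.comp_id]
    have h2 : G.sumMap F (moveBack x a.snd a.fst) ≫ G.sumMap F (move x a.snd a.fst) = 𝟙 _ := by
      rw [← LinFun.sumMap_comp, moveBack_move, LinFun.sumMap_id]
    have h3 := comp_inverse_eq h1 h2 (move_moveBack x (G.obj a.snd) (F.obj a.fst))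
    refine (Category.id_comp _).trans ?_
    refine Eq.trans ?_ (comp_congr rfl (TSum.actR_id x _).symm)
    refine Eq.trans ?_ (Category.comp_id _).symm
    exact (comp_congr (TSum.swap_inl _ _) rfl).trans h3

end SumCalculus

/-! ### The morphisms of C₂ induced by an isomorphism of extensions. -/

section Isomorphism

variable {G : Type w} [Group G]
variable {P : Type u} [Category.{v} P] [MonoidalCategory P] [SymmetricCategory P]
  [IsPicardGroupoid P]

theorem ExtensionData.theta_thetaInv (E : ExtensionData G P) (a b ab : G) (h : a * b = ab)
    (h' : b * a = ab) (v : E.torsor ab) :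
    E.theta a b ab h h' v ≫ E.thetaInv a b ab h h' v = 𝟙 _ := by
  unfold ExtensionData.thetaInv
  exact IsIso.hom_inv_id _

theorem ExtensionData.thetaInv_theta (E : ExtensionData G P) (a b ab : G) (h : a * b = ab)
    (h' : b * a = ab) (v : E.torsor ab) :
    E.thetaInv a b ab h h' v ≫ E.theta a b ab h h' v = 𝟙 _ := by
  unfold ExtensionData.thetaInv
  exact IsIso.inv_hom_id _

open TSum (inl inr move actR swap swapL swapR)

namespace CentralExtension.Isomorphism

variable {E E' : CentralExtension G P} (Φ : Isomorphism E E')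

/-- The composite of `E.theta` with the structure `2`-isomorphism of `Φ`. -/
noncomputable def thetaMul (a b ab : G) (h : a * b = ab) (h' : b * a = ab) :
    (((E.mul b a ab h').comp ((LinFun.Z P _).obj (E.C2 a b ab h h'))).comp
      ((Φ.toFun b).sum (Φ.toFun a))).Hom ((Φ.toFun ab).comp ((E'.mul a b ab h).comp sumComm)) :=
  (((((((E.thetaHom a b ab h h').whiskerR _).comp (LinFun.assocHom _ _ _)).comp
    (LinFun.Hom.whiskerL (E.mul a b ab h) (LinFun.swapHom (Φ.toFun a) (Φ.toFun b)))).comp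
    (LinFun.assocHomInv _ _ _)).comp (LinFun.Hom.whiskerR (Φ.mul a b ab h) sumComm)).comp
    (LinFun.assocHom _ _ _)).copy
    (fun v => (Φ.toFun b).sumMap (Φ.toFun a) (E.theta a b ab h h' v) ≫
      swap (LinFun.Hom.app₂ (Φ.mul a b ab h) v)) (fun v => by
      -- The associativity 2-morphisms and the naturality of the commutativity constraint have
      -- identity components; removing them gives the stated component.
      have aux : ∀ {p q r : TSum P (E'.torsor b) (E'.torsor a)} (f : p ⟶ q) (g : q ⟶ r),
        f ≫ g = ((((f ≫ 𝟙 q) ≫ 𝟙 q) ≫ 𝟙 q) ≫ g) ≫ 𝟙 r := by intros; simp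
      exact aux _ _)

/-- The composite of the structure `2`-isomorphism of `Φ` with `E'.theta`. -/
noncomputable def mulTheta (a b ab : G) (h : a * b = ab) (h' : b * a = ab)
    (κ : E.C2 a b ab h h' ⟶ E'.C2 a b ab h h') :
    (((E.mul b a ab h').comp ((LinFun.Z P _).obj (E.C2 a b ab h h'))).comp
      ((Φ.toFun b).sum (Φ.toFun a))).Hom ((Φ.toFun ab).comp ((E'.mul a b ab h).comp sumComm)) :=
  (((((((LinFun.assocHom _ _ _).comp (LinFun.Hom.whiskerL (E.mul b a ab h')
    (((Φ.toFun b).sum (Φ.toFun a)).translateHom (E.C2 a b ab h h')))).comp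
    (LinFun.assocHomInv _ _ _)).comp (LinFun.Hom.whiskerR (Φ.mul b a ab h')
      ((LinFun.Z P _).obj (E.C2 a b ab h h')))).comp (LinFun.assocHom _ _ _)).comp
    (LinFun.Hom.whiskerL (Φ.toFun ab) (LinFun.Hom.whiskerL (E'.mul b a ab h')
      ((LinFun.Z P _).map κ)))).comp
    (LinFun.Hom.whiskerL (Φ.toFun ab) (E'.thetaHom a b ab h h'))).copy
    (fun v => (Φ.toFun b).actCell κ (LinFun.Hom.app₂ (Φ.mul b a ab h') v) ≫
      E'.theta a b ab h h' ((Φ.toFun ab).obj v)) (fun v => by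
      have aux : ∀ {o p q r s : TSum P (E'.torsor b) (E'.torsor a)} (f : o ⟶ p) (g : p ⟶ q)
        (k : q ⟶ r) (l : r ⟶ s),
        (f ≫ g ≫ k) ≫ l = (((((𝟙 o ≫ f) ≫ 𝟙 p) ≫ g) ≫ 𝟙 q) ≫ k) ≫ l := by intros; simp
      exact aux _ _ _ _)

/-- The isomorphism `C₂(a, b) → C₂'(a, b)` induced by an isomorphism of central extensions. -/
theorem exists_C2_hom (a b ab : G) (h : a * b = ab) (h' : b * a = ab) :
    ∃ κ : E.C2 a b ab h h' ⟶ E'.C2 a b ab h h', ∀ v : E.torsor ab,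
      (Φ.toFun b).sumMap (Φ.toFun a) (E.theta a b ab h h' v) ≫
          swap (LinFun.Hom.app₂ (Φ.mul a b ab h) v) =
        (Φ.toFun b).actCell κ (LinFun.Hom.app₂ (Φ.mul b a ab h') v) ≫
          E'.theta a b ab h h' ((Φ.toFun ab).obj v) := by
  let v₀ : E.torsor ab := (E.torsor ab).isTorsor.nonempty.some
  let s := inl ((Φ.toFun b).lam (E.C2 a b ab h h') ((E.mul b a ab h').obj v₀).fst).hom
    ((Φ.toFun a).obj ((E.mul b a ab h').obj v₀).snd) ≫
      actR (E.C2 a b ab h h') (LinFun.Hom.app₂ (Φ.mul b a ab h') v₀)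
  let l := (Φ.toFun b).sumMap (Φ.toFun a) (E.theta a b ab h h' v₀) ≫
    swap (LinFun.Hom.app₂ (Φ.mul a b ab h) v₀)
  let θ : (⟨E'.C2 a b ab h h' ⊙ₗ ((E'.mul b a ab h').obj ((Φ.toFun ab).obj v₀)).fst,
      ((E'.mul b a ab h').obj ((Φ.toFun ab).obj v₀)).snd⟩ :
        TSum P (E'.torsor b) (E'.torsor a)) ⟶
      ⟨((E'.mul a b ab h).obj ((Φ.toFun ab).obj v₀)).snd,
        ((E'.mul a b ab h).obj ((Φ.toFun ab).obj v₀)).fst⟩ :=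
    E'.theta a b ab h h' ((Φ.toFun ab).obj v₀)
  -- At the object v₀ the equation can be solved for κ: after the invertible factors on both sides
  -- are removed, what remains is a morphism between two translates of one object of the sum, hence
  -- the action of a morphism of `P`.
  obtain ⟨κ, hκ⟩ := TSum.exists_inl_action
    ((E'.mul b a ab h').obj ((Φ.toFun ab).obj v₀)) (inv s ≫ l ≫ inv θ)
  refine ⟨κ, fun v => ?_⟩
  have h1 : l = (s ≫ inl (κ ⊵ₗ _) _) ≫ θ := by
    have aux : ∀ {o p q r : TSum P (E'.torsor b) (E'.torsor a)} (s : o ⟶ p) (l : o ⟶ q)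
        (k : p ⟶ r) (θ : r ⟶ q), inv s ≫ l ≫ inv θ = k → l = (s ≫ k) ≫ θ := by
      rintro _ _ _ _ s l _ θ rfl
      simp
    exact aux s l _ θ hκ
  have h2 : (Φ.thetaMul a b ab h h').app v₀ = (Φ.mulTheta a b ab h h' κ).app v₀ :=
    h1.trans (comp_congr (Category.assoc _ _ _) rfl)
  -- Both sides are 2-morphisms out of a torsor, so agreement at v₀ gives agreement at every object.
  -- This is why the two composites were assembled as 2-morphisms.
  have h3 : Φ.thetaMul a b ab h h' = Φ.mulTheta a b ab h h' κ :=
    LinFun.hom_ext_of_app_eq _ _ v₀ h2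
  exact congrArg (fun η => LinFun.Hom.app η v) h3

/-- The induced isomorphism `C₂(a, b) → C₂'(a, b)`. -/
noncomputable def C2Hom (a b ab : G) (h : a * b = ab) (h' : b * a = ab) :
    E.C2 a b ab h h' ⟶ E'.C2 a b ab h h' := (Φ.exists_C2_hom a b ab h h').choose

theorem theta_C2Hom (a b ab : G) (h : a * b = ab) (h' : b * a = ab) (v : E.torsor ab) :
    (Φ.toFun b).sumMap (Φ.toFun a) (E.theta a b ab h h' v) ≫
        swap (LinFun.Hom.app₂ (Φ.mul a b ab h) v) =
      (Φ.toFun b).actCell (Φ.C2Hom a b ab h h') (LinFun.Hom.app₂ (Φ.mul b a ab h') v) ≫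
        E'.theta a b ab h h' ((Φ.toFun ab).obj v) :=
  (Φ.exists_C2_hom a b ab h h').choose_spec v

/-- The square for `theta` with its `theta` sides inverted, since the exchanges with b and with c
occur in the chain through `thetaInv`. -/
theorem thetaInv_C2Hom (a b ab : G) (h : a * b = ab) (h' : b * a = ab) (v : E.torsor ab) :
    (Φ.toFun b).sumMap (Φ.toFun a) (E.thetaInv a b ab h h' v) ≫
        (Φ.toFun b).actCell (Φ.C2Hom a b ab h h') (LinFun.Hom.app₂ (Φ.mul b a ab h') v) =
      swap (LinFun.Hom.app₂ (Φ.mul a b ab h) v) ≫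
        E'.thetaInv a b ab h h' ((Φ.toFun ab).obj v) := by
  refine (comp_inverse_eq (Φ.theta_C2Hom a b ab h h' v) ?_ (E'.toExtensionData.theta_thetaInv
      ..)).symm
  refine (LinFun.sumMap_comp _ _ _ _).symm.trans ?_
  exact (congrArg ((Φ.toFun b).sumMap (Φ.toFun a)) (E.toExtensionData.thetaInv_theta ..)).trans
    (LinFun.sumMap_id _ _ _)

variable (g b c gb gc bc t : G) (h_gb : g * b = gb) (h_bg : b * g = gb) (h_gc : g * c = gc)
  (h_cg : c * g = gc) (h_bc : b * c = bc) (h_g_bc : g * bc = t) (h_bc_g : bc * g = t)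
  (h_gb_c : gb * c = t) (h_b_gc : b * gc = t)

/-- The data of `exchangeMap`. -/
noncomputable def exchangePre (v : E.torsor t) :
    (E.exchange g b c gb gc bc t h_gb h_bg h_gc h_cg h_bc h_g_bc h_bc_g h_gb_c h_b_gc v).PreMap
      (E'.exchange g b c gb gc bc t h_gb h_bg h_gc h_cg h_bc h_g_bc h_bc_g h_gb_c h_b_gc ((Φ.toFun
      t).obj v)) where
  fB := Φ.toFun b
  fC := Φ.toFun c
  fG := Φ.toFun g
  fBC := Φ.toFun bc
  fGB := Φ.toFun gb
  fGC := Φ.toFun gc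
  bc := Φ.mul b c bc h_bc
  gb := Φ.mul g b gb h_gb
  bg := Φ.mul b g gb h_bg
  gc := Φ.mul g c gc h_gc
  cg := Φ.mul c g gc h_cg
  bc_g := (Φ.mul bc g t h_bc_g).app v
  g_bc := (Φ.mul g bc t h_g_bc).app v
  gb_c := (Φ.mul gb c t h_gb_c).app v
  b_gc := (Φ.mul b gc t h_b_gc).app v
  κx := Φ.C2Hom g b gb h_gb h_bg
  κy := Φ.C2Hom g c gc h_gc h_cg
  κz := Φ.C2Hom g bc t h_g_bc h_bc_g

/-- An isomorphism of central extensions induces a morphism of exchange data. -/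
noncomputable def exchangeMap (v : E.torsor t) :
    (E.exchange g b c gb gc bc t h_gb h_bg h_gc h_cg h_bc h_g_bc h_bc_g h_gb_c h_b_gc v).Map
      (E'.exchange g b c gb gc bc t h_gb h_bg h_gc h_cg h_bc h_g_bc h_bc_g h_gb_c h_b_gc ((Φ.toFun
      t).obj v)) where
  toPreMap := Φ.exchangePre g b c gb gc bc t h_gb h_bg h_gc h_cg h_bc h_g_bc h_bc_g h_gb_c h_b_gc v
  assocGBC := (Φ.assoc g b c gb bc t h_gb h_gb_c h_bc h_g_bc v).trans
    (comp_congr (TSum.assoc_inl _ _) rfl)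
  assocBGC := (Φ.assoc b g c gb gc t h_bg h_gb_c h_gc h_b_gc v).trans
    (comp_congr (TSum.assoc_inl _ _) rfl)
  assocBCG := (Φ.assoc b c g bc gc t h_bc h_bc_g h_cg h_b_gc v).trans
    (comp_congr (TSum.assoc_inl _ _) rfl)
  exchZ := Φ.theta_C2Hom g bc t h_g_bc h_bc_g v
  exchX := Φ.thetaInv_C2Hom g b gb h_gb h_bg _
  exchY := Φ.thetaInv_C2Hom g c gc h_gc h_cg _

/-- The map of exchange data given by `Φ` goes from the chain of `E` at v to the chain of `E'` at
the image of v. That image need not be the object chosen in the definition of `zeta` for `E'`, so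
`zeta_chain` is required there. -/
theorem zeta_C2Hom : (E.zeta g b c gb gc bc t h_gb h_bg h_gc h_cg h_bc h_g_bc h_bc_g h_gb_c
    h_b_gc).hom ≫
      (Φ.C2Hom g b gb h_gb h_bg ⊗ₘ Φ.C2Hom g c gc h_gc h_cg) =
    Φ.C2Hom g bc t h_g_bc h_bc_g ≫ (E'.zeta g b c gb gc bc t h_gb h_bg h_gc h_cg h_bc h_g_bc h_bc_g
      h_gb_c h_b_gc).hom :=
  let v : E.torsor t := (E.torsor t).isTorsor.nonempty.some
  (Φ.exchangeMap g b c gb gc bc t h_gb h_bg h_gc h_cg h_bc h_g_bc h_bc_g h_gb_c h_b_gc v).comp_eq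
      (E.zeta_chain g b c gb gc bc t h_gb h_bg h_gc h_cg h_bc h_g_bc h_bc_g h_gb_c h_b_gc v)
    (E'.zeta_chain g b c gb gc bc t h_gb h_bg h_gc h_cg h_bc h_g_bc h_bc_g h_gb_c h_b_gc ((Φ.toFun
      t).obj v))

end CentralExtension.Isomorphism

end Isomorphism

end PicExt

/-! ### Commutators of homomorphisms to a Picard groupoid. -/

namespace PicExt

section Commutator

variable {H : Type w} [Group H]
variable {P : Type u} [Category.{v} P] [MonoidalCategory P] [SymmetricCategory P]
  [IsPicardGroupoid P]

theorem whiskerLeft_toPi (x : P) (φ : x ⟶ x) : x ◁ toPi x φ = (ρ_ x).hom ≫ φ ≫ (ρ_ x).inv :=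
  (tensorLeft x).map_preimage _

/-- Conjugate automorphisms have the same class in π₁. Tensoring with x' is faithful, so it suffices
to compare after tensoring, where k slides past an endomorphism of the unit by the interchange law.
-/
theorem toPi_congr {x x' : P} {φ : x ⟶ x} {φ' : x' ⟶ x'} (k : x ⟶ x')
    (h : φ ≫ k = k ≫ φ') : toPi x φ = toPi x' φ' := by
  apply (tensorLeft x').map_injective
  change x' ◁ toPi x φ = x' ◁ toPi x' φ'
  have : IsIso k := IsGroupoid.all_isIso k
  rw [← cancel_epi (k ▷ 𝟙_ P), whiskerLeft_toPi, ← whisker_exchange, whiskerLeft_toPi]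
  simp only [Category.assoc]
  rw [← rightUnitor_inv_naturality, rightUnitor_naturality_assoc, reassoc_of% h]

theorem toPi_id (x : P) : toPi x (𝟙 x) = 1 := by
  apply (tensorLeft x).map_injective
  change x ◁ toPi x (𝟙 x) = x ◁ 𝟙 _
  rw [whiskerLeft_toPi]
  simp

/-- An isomorphism of homomorphisms conjugates one defining automorphism into the other: it passes
the structure isomorphisms by hypothesis, the symmetry by naturality, and the identification of
f(ba) with f(ab) because it is a family indexed by group elements. -/
theorem commutator_congr {f f' : H → P} {m : ∀ a b : H, f (a * b) ≅ f a ⊗ f b}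
    {m' : ∀ a b : H, f' (a * b) ≅ f' a ⊗ f' b} (κ : ∀ a, f a ⟶ f' a)
    (hκ : ∀ a b, (m a b).hom ≫ (κ a ⊗ₘ κ b) = κ (a * b) ≫ (m' a b).hom) (a b : H)
    (h : a * b = b * a) : commutator f m a b h = commutator f' m' a b h := by
  refine toPi_congr (κ (a * b)) ?_
  have h1 : (m b a).inv ≫ κ (b * a) = (κ b ⊗ₘ κ a) ≫ (m' b a).inv := by
    rw [Iso.inv_comp_eq, ← Category.assoc, Iso.eq_comp_inv, hκ]
  have h2 : ∀ {c d : H} (e : c = d),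
      eqToHom (congrArg f e) ≫ κ d = κ c ≫ eqToHom (congrArg f' e) := by
    rintro c _ rfl
    simp
  simp only [Category.assoc]
  rw [h2 h.symm, reassoc_of% h1, ← BraidedCategory.braiding_naturality_assoc, reassoc_of% hκ]

/-- Cancelling c in c ≅ c + c shows that c is isomorphic to the unit, whose symmetry with itself is
the identity; naturality carries this back to c. For a general object of `P` the self-symmetry need
not be trivial. -/
theorem braiding_eq_id_of_iso {c : P} (ζ : c ≅ c ⊗ c) : (β_ c c).hom = 𝟙 (c ⊗ c) := by
  -- The composite c + e ≅ c ≅ c + c is lifted through the equivalence y ↦ c + y.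
  let e : c ≅ 𝟙_ P := ((tensorLeft c).preimageIso
    (X := 𝟙_ P) (Y := c) (ρ_ c ≪≫ ζ)).symm
  have h := BraidedCategory.braiding_naturality e.hom e.hom
  have h' : (β_ (𝟙_ P) (𝟙_ P)).hom = 𝟙 _ := by
    rw [braiding_tensorUnit_left, unitors_equal]
    simp
  rw [h', Category.comp_id] at h
  rw [← cancel_mono (e.hom ⊗ₘ e.hom), ← h, Category.id_comp]

/-- With a trivial self-symmetry, the defining automorphism reduces to ζ followed by its inverse. -/
theorem commutator_eq_one {c : P} (ζ : c ≅ c ⊗ c) (a b : H) (h : a * b = b * a) :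
    commutator (fun _ : H => c) (fun _ _ => ζ) a b h = 1 := by
  refine Eq.trans (congrArg (toPi c) ?_) (toPi_id c)
  rw [braiding_eq_id_of_iso ζ]
  simp

end Commutator

/-! ### Conclusion for `C3`. -/

section C

variable {G : Type w} [Group G]
variable {P : Type u} [Category.{v} P] [MonoidalCategory P] [SymmetricCategory P]
  [IsPicardGroupoid P]

open CentralExtension (centralizer_comm)

/-- The isomorphism `C_g ≅ C_g'` induced by an isomorphism of central extensions. -/
noncomputable def CentralExtension.Isomorphism.CgHom {E E' : CentralExtension G P}
    (Φ : Isomorphism E E') (g : G) (a : Subgroup.centralizer ({g} : Set G)) :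
    E.Cg g a ⟶ E'.Cg g a :=
  Φ.C2Hom g a (g * a) rfl (centralizer_comm a)

/-- States that the morphisms `CgHom` form an isomorphism of homomorphisms from the centralizer of g
to `P`; it is the hypothesis of `commutator_congr`. -/
theorem CentralExtension.Isomorphism.CgMul_CgHom {E E' : CentralExtension G P}
    (Φ : Isomorphism E E') (g : G) (a b : Subgroup.centralizer ({g} : Set G)) :
    (E.CgMul g a b).hom ≫ (Φ.CgHom g a ⊗ₘ Φ.CgHom g b) =
      Φ.CgHom g (a * b) ≫ (E'.CgMul g a b).hom :=
  Φ.zeta_C2Hom g a b (g * a) (g * b) (a * b) (g * (a * b)) rfl (centralizer_comm a) rfl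
    (centralizer_comm b) rfl rfl (centralizer_comm (a * b)) (mul_assoc _ _ _)
    (by rw [← mul_assoc, centralizer_comm a, mul_assoc])

theorem CentralExtension.Isomorphism.C3_eq {E E' : CentralExtension G P} (Φ : Isomorphism E E') :
    E.C3 = E'.C3 :=
  funext fun t => commutator_congr (Φ.CgHom t.1.1) (Φ.CgMul_CgHom t.1.1) _ _ _

/-- No datum of the trivial extension depends on the group elements, so by unfolding C_g is a
constant map, and all its structure isomorphisms coincide with the one at the pair (1, 1). -/
theorem C3_trivialExtension (t : CommTriple G) : (trivialExtension P G).C3 t = 1 :=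
  commutator_eq_one ((trivialExtension P G).CgMul t.1.1 1 1) _ _ _

end C

end PicExt


theorem mainTheorem7 {G : Type w} [Group G]
    {P : Type u} [CategoryTheory.Category.{v} P] [CategoryTheory.MonoidalCategory P]
    [CategoryTheory.SymmetricCategory P] [PicExt.IsPicardGroupoid P] :
    (∀ E E' : PicExt.CentralExtension G P,
      Nonempty (PicExt.CentralExtension.Isomorphism E E') → E.C3 = E'.C3) ∧
    ∀ t : PicExt.CommTriple G, (PicExt.trivialExtension P G).C3 t = 1 :=
  ⟨fun _ _ ⟨Φ⟩ => Φ.C3_eq, PicExt.C3_trivialExtension⟩
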